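/- **Setting.** Let $F$ be a finite real abelian extension of $\mathbb Q$ and let $M$ be an odd positive integer. Let $\mathbf r$ be the formal product of all odd primes $\ell\equiv 1 \bmod M$ that split completely in $F$; thus a positive integer $r$ divides $\mathbf r$ if and only if $r$ is squarefree and all its prime factors are such primes. Let $G$ be the Galois group over $F$ of the field $L$ generated over $F$ by all roots of unity of order dividing $\mathbf r$. For each prime $\ell\mid\mathbf r$ let $G_\ell\subset G$ be the inertia subgroup at a place above $\ell$ (it is cyclic of order $\ell-1$ and independent of the place), $\sigma_\ell$ a generator of $G_\ell$, $N_\ell=\sum_{i=0}^{\ell-2}\sigma_\ell^i$, $N'_\ell=\sum_{i=1}^{\ell-2}i\,\sigma_\ell^i$ in $\mathbb Z[G_\ell]$, and let $\mathrm{Frob}_\ell\in G/G_\ell$ be the arithmetic Frobenius above $\ell$. For a positive integer $r\mid\mathbf r$ let $N'_r=\prod_{\ell\mid r}N'_\ell$, let $F_r$ be the extension of $F$ generated by the $r$-th roots of unity, $\mathcal O_r$ its ring of integers, and $\mathcal O=\mathcal O_1$. For a prime $\ell$ let $\mathcal O_{r,(\ell)}$ be the localization of $\mathcal O_r$ by the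 elements prime to $\ell$, and $\mathcal O_{(\ell)}=\mathcal O_{1,(\ell)}$. For an ideal $I$, $\sqrt I$ denotes its radical. For an abelian group $A$, $A_M$ denotes its $M$-torsion subgroup. Let $\{\xi_r\in\mathcal O_r^\times\}_{r\mid\mathbf r}$ be an Euler system: for all positive integers $r\mid\mathbf r$ and primes $\ell\mid r$, $$\xi_r^{N_\ell}=\xi_{r/\ell}^{\mathrm{Frob}_\ell-1}\qquad\text{and}\qquad \xi_r\equiv\xi_{r/\ell}\bmod\sqrt{\ell\mathcal O_r}.$$ **Proposition.** (a) For every positive integer $r\mid\mathbf r$ there is a unique class $\kappa_r\in F^\times/F^{\times M}$ (the Kolyvagin class) such that $\xi_r^{N'_r}\equiv\kappa_r\bmod F_r^{\times M}$. (b) For every prime $\ell\mid\mathbf r$ there is a unique homomorphism $\nu_\ell:\mathcal O_{(\ell)}^\times/\mathcal O_{(\ell)}^{\times M}\to(\mathcal O/\ell)^\times_M$ with $\nu_\ell(x)\equiv x^{(\ell-1)/M}\bmod\ell\mathcal O_{(\ell)}$ for all $x\in\mathcal O_{(\ell)}^\times$, and a unique isomorphism $$\exp_\ell:\{\text{fractional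 }\mathcal O_{(\ell)}\text{-ideals}\}\otimes\mathbb Z/M\mathbb Z\ \xrightarrow{\ \sim\ }\ (\mathcal O/\ell)^\times_M$$ such that $\exp_\ell\big((x^{N_\ell})\otimes 1\big)\equiv(x^{1-\sigma_\ell})^{(\ell-1)/M}\bmod\sqrt{\ell\mathcal O_{\ell,(\ell)}}$ for all $x\in F_\ell^\times$. (c) Write $[x]_\ell$ for the class in $\{\text{fractional }\mathcal O_{(\ell)}\text{-ideals}\}\otimes\mathbb Z/M\mathbb Z$ of the fractional ideal generated by $x\in F^\times$. For every positive integer $r\mid\mathbf r$ and every prime $\ell\mid r$, the class $\kappa_{r/\ell}$ is the image of a unique class in $\mathcal O_{(\ell)}^\times/\mathcal O_{(\ell)}^{\times M}$, the elements $\xi_r^{N'_r(\sigma_\ell-1)}$ and $\xi_{r/\ell}^{N'_{r/\ell}(\ell-\mathrm{Frob}_\ell)}$ have unique $M$-th roots in $\mathcal O_r^\times$, and for these roots $$\exp_\ell[\kappa_r]_\ell\equiv\sqrt[M]{\xi_r^{N'_r(\sigma_\ell-1)}}\equiv\sqrt[M]{\xi_{r/\ell}^{N'_{r/\ell}(\ell-\mathrm{Frob}_\ell)}}\equiv\nu_\ell\kappa_{r/\ell}\bmod\sqrt{\ell\mathcal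 O_{r,(\ell)}}.$$ -/

import Mathlib

open scoped NumberField nonZeroDivisors

namespace CyclotomicEuler

noncomputable section

/-! ### General notions -/

/-- `A / A ^ M`, for a commutative group `A` written multiplicatively. This is also
`A ⊗ ℤ/Mℤ`. -/
abbrev ModPow (A : Type*) [CommGroup A] (M : ℕ) : Type _ :=
  A ⧸ (powMonoidHom M : A →* A).range

/-- The homomorphism `A / A ^ M → B / B ^ M` induced by a homomorphism `A → B`. -/
def ModPow.map {A B : Type*} [CommGroup A] [CommGroup B] (M : ℕ) (f : A →* B) :
    ModPow A M →* ModPow B M :=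
  QuotientGroup.map _ _ f (by
    rintro _ ⟨a, rfl⟩
    exact ⟨f a, by simp⟩)

/-- The localization of a subring `A` of a field by the multiplicative system of the (nonzero)
elements of `A` that are prime to `ℓ`, as a subring of the field. -/
def locAt {K : Type*} [Field K] (A : Subring K) (ℓ : ℕ) : Subring K where
  carrier := {x | ∃ a s : A, s ≠ 0 ∧ IsCoprime s (ℓ : A) ∧ x = (a : K) / (s : K)}
  mul_mem' := by
    rintro _ _ ⟨a, s, hs, hsl, rfl⟩ ⟨b, t, ht, htl, rfl⟩
    refine ⟨a * b, s * t, mul_ne_zero hs ht, hsl.mul_left htl, ?_⟩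
    push_cast
    rw [div_mul_div_comm]
  one_mem' := ⟨1, 1, one_ne_zero, isCoprime_one_left, by simp⟩
  add_mem' := by
    rintro _ _ ⟨a, s, hs, hsl, rfl⟩ ⟨b, t, ht, htl, rfl⟩
    refine ⟨a * t + s * b, s * t, mul_ne_zero hs ht, hsl.mul_left htl, ?_⟩
    have hs' : (s : K) ≠ 0 := by simpa using hs
    have ht' : (t : K) ≠ 0 := by simpa using ht
    push_cast
    rw [div_add_div _ _ hs' ht']
  zero_mem' := ⟨0, 1, one_ne_zero, isCoprime_one_left, by simp⟩
  neg_mem' := by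
    rintro _ ⟨a, s, hs, hsl, rfl⟩
    exact ⟨-a, s, hs, hsl, by push_cast; rw [neg_div]⟩

theorem le_locAt {K : Type*} [Field K] (A : Subring K) (ℓ : ℕ) : A ≤ locAt A ℓ :=
  fun x hx => ⟨⟨x, hx⟩, 1, one_ne_zero, isCoprime_one_left, by simp⟩

/-- The ideal generated by `ℓ` in a ring `A`. -/
abbrev idealOf (A : Type*) [CommRing A] (ℓ : ℕ) : Ideal A := Ideal.span {(ℓ : A)}

/-! ### The setting -/

section Setting

variable (F : Type*) [Field F] [NumberField F]

/-- The prime number `ℓ` splits completely in the number field `F`: there are `[F : ℚ]` primes of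
the ring of integers above `ℓ`. -/
def SplitsCompletely (ℓ : ℕ) : Prop :=
  ((Ideal.span {(ℓ : ℤ)}).primesOver (𝓞 F)).ncard = Module.finrank ℚ F

/-- The odd prime numbers congruent to `1` modulo `M` that split completely in `F`. -/
def IsGoodPrime (M ℓ : ℕ) : Prop :=
  ℓ.Prime ∧ Odd ℓ ∧ ℓ ≡ 1 [MOD M] ∧ SplitsCompletely F ℓ

/-- The positive integers dividing the formal product of all good primes. -/
def levels (M : ℕ) : Set ℕ :=
  {r | Squarefree r ∧ ∀ ℓ : ℕ, ℓ.Prime → ℓ ∣ r → IsGoodPrime F M ℓ}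

/-- `𝓞 / ℓ`, where `𝓞` is the ring of integers of `F`. -/
abbrev ResidueRing (ℓ : ℕ) : Type _ := 𝓞 F ⧸ idealOf (𝓞 F) ℓ

/-- `𝓞_(ℓ)`: the localization of the ring of integers of `F` by the elements prime to `ℓ`. -/
abbrev baseLoc (ℓ : ℕ) : Subring F := locAt (integralClosure ℤ F).toSubring ℓ

/-- The inclusion `𝓞 → 𝓞_(ℓ)`. -/
def intToBaseLoc (ℓ : ℕ) : 𝓞 F →+* baseLoc F ℓ :=
  (algebraMap (𝓞 F) F).codRestrict (baseLoc F ℓ) fun x => le_locAt _ ℓ x.2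

/-- The natural homomorphism `𝓞 / ℓ → 𝓞_(ℓ) / ℓ 𝓞_(ℓ)`. -/
def residueToBaseLoc (ℓ : ℕ) : ResidueRing F ℓ →+* baseLoc F ℓ ⧸ idealOf (baseLoc F ℓ) ℓ :=
  Ideal.quotientMap _ (intToBaseLoc F ℓ) (by
    rw [Ideal.span_le, Set.singleton_subset_iff]
    simp)

instance baseLoc_isFractionRing (ℓ : ℕ) : IsFractionRing (baseLoc F ℓ) F := by
  refine IsFractionRing.of_field (baseLoc F ℓ) F fun z => ?_
  obtain ⟨a, b, -, rfl⟩ := IsFractionRing.div_surjective (A := 𝓞 F) z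
  exact ⟨intToBaseLoc F ℓ a, intToBaseLoc F ℓ b, rfl⟩

/-- The natural homomorphism `𝓞_(ℓ)ˣ / 𝓞_(ℓ)ˣ^M → Fˣ / Fˣ^M`. -/
def unitClassToField (M ℓ : ℕ) : ModPow (baseLoc F ℓ)ˣ M →* ModPow Fˣ M :=
  ModPow.map M (Units.map ((baseLoc F ℓ).subtype : baseLoc F ℓ →* F))

/-- The group of fractional `𝓞_(ℓ)`-ideals. -/
abbrev FracIdeals (ℓ : ℕ) : Type _ := (FractionalIdeal (baseLoc F ℓ)⁰ F)ˣ

/-- The `M`-torsion subgroup of `(𝓞 / ℓ)ˣ`. -/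
abbrev ResidueTorsion (M ℓ : ℕ) : Type _ := rootsOfUnity M (ResidueRing F ℓ)

/-- The map `[·]_ℓ` from `Fˣ / Fˣ^M` to the group of fractional `𝓞_(ℓ)`-ideals modulo `M`-th
powers, induced by `x ↦ (x)`. -/
def idealClass (M ℓ : ℕ) : ModPow Fˣ M →* ModPow (FracIdeals F ℓ) M :=
  ModPow.map M (toPrincipalIdeal (baseLoc F ℓ) F)

/-- The characterization of `ν_ℓ`: the class of a unit `x` goes to `x ^ ((ℓ - 1) / M)` modulo
`ℓ 𝓞_(ℓ)`. -/
def IsNu (M ℓ : ℕ) (n : ModPow (baseLoc F ℓ)ˣ M →* ResidueTorsion F M ℓ) : Prop :=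
  ∀ x : (baseLoc F ℓ)ˣ,
    residueToBaseLoc F ℓ (((n (QuotientGroup.mk x) : (ResidueRing F ℓ)ˣ)) : ResidueRing F ℓ) =
      Ideal.Quotient.mk _ ((x : baseLoc F ℓ) ^ ((ℓ - 1) / M))

/-- `ν_ℓ`: the unique homomorphism with the property `IsNu`. -/
def nu (M ℓ : ℕ) : ModPow (baseLoc F ℓ)ˣ M →* ResidueTorsion F M ℓ :=
  Classical.epsilon (IsNu F M ℓ)

variable (L : Type*) [Field L] [Algebra F L]

/-- `F_r`: the extension of `F` generated by the `r`-th roots of unity. -/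
def cyc (r : ℕ) : IntermediateField F L := IntermediateField.adjoin F {ζ : L | ζ ^ r = 1}

/-- `𝓞_r`: the ring of algebraic integers of `F_r`. -/
def intRing (r : ℕ) : Subring L :=
  (cyc F L r).toSubfield.toSubring ⊓ (integralClosure ℤ L).toSubring

/-- `𝓞_{r,(ℓ)}`: the localization of `𝓞_r` by the elements prime to `ℓ`. -/
abbrev intLoc (r ℓ : ℕ) : Subring L := locAt (intRing F L r) ℓ

/-- The quotient of `𝓞_{r,(ℓ)}` by the radical of the ideal generated by `ℓ`. -/
abbrev RadQuot (r ℓ : ℕ) : Type _ :=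
  intLoc F L r ℓ ⧸ (idealOf (intLoc F L r ℓ) ℓ).radical

/-- The reduction of an element of `𝓞_r` modulo the radical of `ℓ 𝓞_{r,(ℓ)}`. -/
def intToRadQuot (r ℓ : ℕ) : intRing F L r →+* RadQuot F L r ℓ :=
  (Ideal.Quotient.mk _).comp (Subring.inclusion (le_locAt (intRing F L r) ℓ))

/-- The inclusion `𝓞 → 𝓞_r`. -/
def baseToInt (r : ℕ) : 𝓞 F →+* intRing F L r :=
  ((algebraMap F L).comp (algebraMap (𝓞 F) F)).codRestrict (intRing F L r) fun x =>
    ⟨(cyc F L r).algebraMap_mem _, (show IsIntegral ℤ (x : F) from x.2).map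
      ((algebraMap F L).toIntAlgHom)⟩

/-- The natural homomorphism from `𝓞 / ℓ` to the quotient of `𝓞_{r,(ℓ)}` by the radical of the
ideal generated by `ℓ`. -/
def residueToRadQuot (r ℓ : ℕ) : ResidueRing F ℓ →+* RadQuot F L r ℓ :=
  Ideal.Quotient.lift _ ((intToRadQuot F L r ℓ).comp (baseToInt F L r)) (by
    intro a ha
    have h : idealOf (𝓞 F) ℓ ≤
        RingHom.ker ((intToRadQuot F L r ℓ).comp (baseToInt F L r)) := by
      rw [Ideal.span_le, Set.singleton_subset_iff, SetLike.mem_coe, RingHom.mem_ker, map_natCast,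
        ← map_natCast (Ideal.Quotient.mk (idealOf (intLoc F L r ℓ) ℓ).radical),
        Ideal.Quotient.eq_zero_iff_mem]
      exact Ideal.le_radical (Ideal.mem_span_singleton_self _)
    exact h ha)

/-- `u ^ θ` for `θ` in the group ring `ℤ[G]`: if `θ = ∑ n_g g` it is `∏ (g u) ^ n_g`. -/
def gpow {F L : Type*} [Field F] [Field L] [Algebra F L] (u : Lˣ) (θ : MonoidAlgebra ℤ Gal(L/F)) : Lˣ :=
  θ.coeff.prod fun g n => (g • u) ^ n

/-- An element of `Fˣ`, as an element of `Lˣ`. -/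
def baseUnit (a : Fˣ) : Lˣ := Units.map (algebraMap F L : F →* L) a

/-- An element of `𝓞_rˣ`, as an element of `Lˣ`. -/
def intUnit (r : ℕ) (u : (intRing F L r)ˣ) : Lˣ :=
  Units.map ((intRing F L r).subtype : intRing F L r →* L) u

/-- The choices made for every good prime `ℓ`: a place of `L` above `ℓ`, a generator `σ_ℓ` of the
inertia subgroup `G_ℓ` at that place, and a representative in the Galois group `G` of the arithmetic
Frobenius `Frob_ℓ ∈ G / G_ℓ` at that place. -/
structure LocalData (M : ℕ) where
  place : ℕ → Ideal (𝓞 L)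
  gen : ℕ → Gal(L/F)
  frob : ℕ → Gal(L/F)
  place_isPrime : ∀ ℓ, IsGoodPrime F M ℓ → (place ℓ).IsPrime
  mem_place : ∀ ℓ, IsGoodPrime F M ℓ → (ℓ : 𝓞 L) ∈ place ℓ
  zpowers_gen : ∀ ℓ, IsGoodPrime F M ℓ →
    Subgroup.zpowers (gen ℓ) = (place ℓ).inertia Gal(L/F)
  frob_spec : ∀ ℓ, IsGoodPrime F M ℓ → ∀ x : 𝓞 L,
    frob ℓ • x - x ^ Nat.card (𝓞 F ⧸ (place ℓ).under (𝓞 F)) ∈ place ℓ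

end Setting

namespace LocalData

variable {F : Type*} [Field F] [NumberField F] {L : Type*} [Field L] [Algebra F L] {M : ℕ} (D : LocalData F L M)

/-- `σ_ℓ`, as an element of `ℤ[G]`. -/
def sig (ℓ : ℕ) : MonoidAlgebra ℤ Gal(L/F) := MonoidAlgebra.of ℤ _ (D.gen ℓ)

/-- `Frob_ℓ`, lifted to an element of `ℤ[G]`. -/
def Fr (ℓ : ℕ) : MonoidAlgebra ℤ Gal(L/F) := MonoidAlgebra.of ℤ _ (D.frob ℓ)

/-- `N_ℓ = ∑_{i=0}^{ℓ-2} σ_ℓ^i`. -/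
def N (ℓ : ℕ) : MonoidAlgebra ℤ Gal(L/F) := ∑ i ∈ Finset.range (ℓ - 1), D.sig ℓ ^ i

/-- `N'_ℓ = ∑_{i=1}^{ℓ-2} i σ_ℓ^i`. -/
def N' (ℓ : ℕ) : MonoidAlgebra ℤ Gal(L/F) :=
  ∑ i ∈ Finset.Icc 1 (ℓ - 2), (i : MonoidAlgebra ℤ Gal(L/F)) * D.sig ℓ ^ i

/-- `N'_r = ∏_{ℓ ∣ r} N'_ℓ`, for squarefree `r`. (The group `G` is abelian, so that the order of
the factors is irrelevant; they are taken in increasing order of `ℓ`.) -/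
def Nr' (r : ℕ) : MonoidAlgebra ℤ Gal(L/F) := (r.primeFactorsList.map D.N').prod

/-- Euler systems: families of units `ξ_r ∈ 𝓞_rˣ` indexed by the levels `r`. (The values at other
natural numbers play no role.) -/
structure IsEulerSystem (ξ : ∀ r : ℕ, (intRing F L r)ˣ) : Prop where
  norm_rel : ∀ r ∈ levels F M, ∀ ℓ : ℕ, ℓ.Prime → ℓ ∣ r →
    gpow (intUnit F L r (ξ r)) (D.N ℓ) =
      gpow (intUnit F L (r / ℓ) (ξ (r / ℓ))) (D.Fr ℓ - 1)
  congr_rel : ∀ r ∈ levels F M, ∀ ℓ : ℕ, ℓ.Prime → ℓ ∣ r →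
    ∃ y : intRing F L r, (y : L) = ((ξ (r / ℓ) : intRing F L (r / ℓ)) : L) ∧
      (ξ r : intRing F L r) - y ∈ (idealOf (intRing F L r) ℓ).radical

/-- The characterization of the Kolyvagin class `κ_r`: it is a class in `Fˣ / Fˣ^M` which is
congruent to `ξ_r ^ N'_r` modulo `F_rˣ^M`. -/
def IsKolyvaginClass (ξ : ∀ r : ℕ, (intRing F L r)ˣ) (r : ℕ) (κ : ModPow Fˣ M) : Prop :=
  ∃ a : Fˣ, QuotientGroup.mk a = κ ∧ ∃ b : Lˣ, (b : L) ∈ cyc F L r ∧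
    gpow (intUnit F L r (ξ r)) (D.Nr' r) = baseUnit F L a * b ^ M

/-- The Kolyvagin class `κ_r`: the unique class with the property `IsKolyvaginClass`. -/
def kolyvaginClass (ξ : ∀ r : ℕ, (intRing F L r)ˣ) (r : ℕ) : ModPow Fˣ M :=
  Classical.epsilon (D.IsKolyvaginClass ξ r)

/-- The characterization of `exp_ℓ`: it is an isomorphism and, for `x ∈ F_ℓˣ`, the class of the
ideal generated by `x ^ N_ℓ ∈ Fˣ` goes to `(x ^ (1 - σ_ℓ)) ^ ((ℓ - 1) / M)` modulo the radical of
`ℓ 𝓞_{ℓ,(ℓ)}`. -/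
def IsExp (ℓ : ℕ) (e : ModPow (FracIdeals F ℓ) M →* ResidueTorsion F M ℓ) : Prop :=
  Function.Bijective e ∧
    ∀ x : Lˣ, (x : L) ∈ cyc F L ℓ →
      ∃ (y : Fˣ) (z : intLoc F L ℓ ℓ), baseUnit F L y = gpow x (D.N ℓ) ∧
        (z : L) = ((gpow x (1 - D.sig ℓ) ^ ((ℓ - 1) / M) : Lˣ) : L) ∧
        residueToRadQuot F L ℓ ℓ
            ((e (QuotientGroup.mk (toPrincipalIdeal (baseLoc F ℓ) F y)) : (ResidueRing F ℓ)ˣ) :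
              ResidueRing F ℓ) =
          Ideal.Quotient.mk _ z

/-- `exp_ℓ`: the unique isomorphism with the property `IsExp`. -/
def exp (ℓ : ℕ) : ModPow (FracIdeals F ℓ) M →* ResidueTorsion F M ℓ :=
  Classical.epsilon (D.IsExp ℓ)

end LocalData

end

end CyclotomicEuler

/-! Kolyvagin classes. In `ℤ[G]` one has `N'_ℓ (σ_ℓ - 1) = (ℓ - 1) - N_ℓ`
(`LocalData.N'_mul_sub_one`). With the norm relation, the derivative `D_r = ξ_r ^ N'_r` therefore
satisfies `D_r ^ (σ_ℓ - 1) = ξ_r ^ (N'_{r/ℓ} (ℓ - 1)) / D_{r/ℓ} ^ (Frob_ℓ - 1)`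
(`LocalData.gen_smul_derived_div`). Since `M ∣ ℓ - 1`, induction on `r` shows that the class of
`D_r` modulo `M`-th powers of `F_r` is fixed by all `σ_ℓ` with `ℓ ∣ r`, and these generate
`Gal(F_r/F)` (`LocalData.exists_mem_subgroup_eq_on_cyc`). An `M`-th root of unity in `F_r` is fixed
by the `σ_ℓ`, because `M` is prime to `ℓ`; so it lies in the real field `F` and is `1`, as `M` is
odd. Thus `M`-th roots in `F_r` are unique, and Hilbert 90 (`exists_eq_map_mul_pow`) gives `D_r = a
* b ^ M` with `a ∈ F` unique modulo `M`-th powers.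

Local analysis. As `ℓ` splits completely in `F`, it is a uniformizer at the places `w ∣ ℓ`, the
residue fields have `ℓ` elements, and `𝓞/ℓ` can be handled place by place (`Red`). In `F_r/F` the
ramification index above `ℓ` is `ℓ - 1`, with uniformizer `1 - ζ_ℓ` (`total_ramification`), and
`σ_ℓ` raises `ζ_ℓ` to a power `g` that is a primitive root modulo `ℓ`
(`LocalData.exists_primitive_exponent`). Everything then follows from two congruences at a place `v
∣ ℓ` of `F_r`: `x ^ (σ_ℓ - 1) ≡ g ^ ord_v x` for all nonzero `x` (`tame_character`), and `Frob_ℓ x ≡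
x ^ ℓ` for `v`-units `x` of `F_{r/ℓ}`. Valuations are multiplicative, so `log` of a valuation is
`-ord`.

The two maps. The value of `ν_ℓ` is `M`-torsion by Fermat's little theorem. Fractional ideals of the
semilocal ring `𝓞_(ℓ)` are principal, and `exp_ℓ` sends `(y)` to `g ^ (-ord_w y * (ℓ - 1)/M)` at `w`
(`exists_exp`). The first congruence turns this into the required formula, because `ord_w (x ^ N_ℓ)
= ord_v x` for `x` in `F_ℓ`.

The congruences. Let `D_r = a * b ^ M`. As `D_r` is a unit, `M * ord_v b = -(ℓ - 1) * ord_w a`, so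
the first root `b ^ (σ_ℓ - 1) ≡ g ^ ord_v b` represents `exp_ℓ [a]`. The quotient of the two roots
is `(ξ_r / ξ_{r/ℓ}) ^ (N'_{r/ℓ} (ℓ - 1)/M)`, which is `≡ 1` by the Euler system congruence. Finally
`D_{r/ℓ} = c * b ^ M` with `c` a unit at `ℓ`, and the second root `c ^ ((ℓ - 1)/M) * b ^ (ℓ -
Frob_ℓ)` is congruent to `c ^ ((ℓ - 1)/M)`, that is, to `ν_ℓ c`. -/

open scoped NumberField nonZeroDivisors

namespace CyclotomicEuler

noncomputable section

/-! ### Primes that split completely -/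

section
open IsDedekindDomain HeightOneSpectrum WithZero

section Split
variable {F : Type*} [Field F] [NumberField F] [IsGalois ℚ F]

/-- In the Galois extension `F/ℚ` one has `g * e * f = [F : ℚ]`; complete splitting means that `g`
is already the whole degree. -/
theorem SplitsCompletely.ramificationIdx_and_inertiaDeg {ℓ : ℕ} (hℓ : ℓ.Prime)
    (hs : SplitsCompletely F ℓ) (P : Ideal (𝓞 F)) [P.IsPrime] (hP : (ℓ : 𝓞 F) ∈ P) :
    P.LiesOver (Ideal.span {(ℓ : ℤ)}) ∧ P.ramificationIdx ℤ = 1 ∧ P.inertiaDeg ℤ = 1 := by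
  have hp : Prime (ℓ : ℤ) := Nat.prime_iff_prime_int.mp hℓ
  have hI : (Ideal.span {(ℓ : ℤ)}).IsPrime :=
    (Ideal.span_singleton_prime hp.ne_zero).mpr hp
  have hM : (Ideal.span {(ℓ : ℤ)}).IsMaximal :=
    hI.isMaximal (by simpa using hp.ne_zero)
  have hle : P.LiesOver (Ideal.span {(ℓ : ℤ)}) := by
    constructor
    refine hM.eq_of_le (Ideal.IsPrime.ne_top inferInstance) ?_
    rw [Ideal.span_le, Set.singleton_subset_iff]
    simpa [Ideal.under, Ideal.mem_comap] using hP
  refine ⟨hle, ?_⟩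
  have h := Ideal.ncard_primesOver_mul_ramificationIdxIn_mul_inertiaDegIn
    (Ideal.span {(ℓ : ℤ)}) (𝓞 F) Gal(F/ℚ)
  rw [IsGalois.card_aut_eq_finrank, hs] at h
  have hpos : 0 < Module.finrank ℚ F := Module.finrank_pos
  have h1 : Ideal.ramificationIdxIn (Ideal.span {(ℓ : ℤ)}) (𝓞 F) *
      Ideal.inertiaDegIn (Ideal.span {(ℓ : ℤ)}) (𝓞 F) = 1 :=
    Nat.eq_of_mul_eq_mul_left hpos (by rw [h, mul_one])
  rw [Ideal.ramificationIdxIn_eq_ramificationIdx _ P Gal(F/ℚ),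
    Ideal.inertiaDegIn_eq_inertiaDeg _ P Gal(F/ℚ)] at h1
  exact mul_eq_one.mp h1

theorem SplitsCompletely.card_quotient {ℓ : ℕ} (hℓ : ℓ.Prime)
    (hs : SplitsCompletely F ℓ) (P : Ideal (𝓞 F)) [P.IsPrime] (hP : (ℓ : 𝓞 F) ∈ P) :
    Nat.card (𝓞 F ⧸ P) = ℓ := by
  obtain ⟨h, -, hf⟩ := hs.ramificationIdx_and_inertiaDeg hℓ P hP
  have hp : Prime (ℓ : ℤ) := Nat.prime_iff_prime_int.mp hℓ
  have hI : (Ideal.span {(ℓ : ℤ)}).IsPrime :=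
    (Ideal.span_singleton_prime hp.ne_zero).mpr hp
  have hM : (Ideal.span {(ℓ : ℤ)}).IsMaximal :=
    hI.isMaximal (by simpa using hp.ne_zero)
  have : P.IsMaximal := Ideal.IsMaximal.of_liesOver_isMaximal P (Ideal.span {(ℓ : ℤ)})
  have := Ideal.absNorm_eq_pow_inertiaDeg' P hℓ
  rw [Ideal.inertiaDeg'_eq_inertiaDeg, hf, pow_one] at this
  exact this

theorem SplitsCompletely.intValuation_eq {ℓ : ℕ} (hℓ : ℓ.Prime)
    (hs : SplitsCompletely F ℓ) (w : HeightOneSpectrum (𝓞 F)) (hw : (ℓ : 𝓞 F) ∈ w.asIdeal) :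
    w.intValuation (ℓ : 𝓞 F) = exp (-1 : ℤ) := by
  have := w.isPrime
  obtain ⟨h, he, -⟩ := hs.ramificationIdx_and_inertiaDeg hℓ w.asIdeal hw
  have hp : Prime (ℓ : ℤ) := Nat.prime_iff_prime_int.mp hℓ
  let v : HeightOneSpectrum ℤ := ⟨Ideal.span {(ℓ : ℤ)},
    (Ideal.span_singleton_prime hp.ne_zero).mpr hp, by simpa using hp.ne_zero⟩
  have : w.asIdeal.LiesOver v.asIdeal := h
  have h2 := intValuation_liesOver v w (ℓ : ℤ)
  rw [Ideal.ramificationIdx'_eq_ramificationIdx _ _ v.ne_bot, he, pow_one,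
    v.intValuation_singleton hp.ne_zero rfl] at h2
  simpa using h2.symm

theorem SplitsCompletely.valuation_eq {ℓ : ℕ} (hℓ : ℓ.Prime)
    (hs : SplitsCompletely F ℓ) (w : HeightOneSpectrum (𝓞 F)) (hw : (ℓ : 𝓞 F) ∈ w.asIdeal) :
    w.valuation F (ℓ : F) = exp (-1 : ℤ) := by
  rw [← hs.intValuation_eq hℓ w hw, ← valuation_of_algebraMap (K := F)]
  simp

end Split

end

/-! ### Congruence to one at a place -/

section
open IsDedekindDomain HeightOneSpectrum WithZero

section PrincipalUnits
variable {E : Type*} [Field E] [NumberField E]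

/-- The units `x` with `x ≡ 1` at the place `v`. -/
def principalUnits (v : HeightOneSpectrum (𝓞 E)) : Subgroup Eˣ where
  carrier := {x | v.valuation E ((x : E) - 1) < 1}
  one_mem' := by simp
  mul_mem' := by
    intro x y hx hy
    have hx' : v.valuation E (x : E) ≤ 1 := by
      have := (v.valuation E).map_add ((x : E) - 1) 1
      rw [sub_add_cancel, map_one] at this
      exact this.trans (max_le (le_of_lt hx) le_rfl)
    have h : ((x * y : Eˣ) : E) - 1 = x * ((y : E) - 1) + ((x : E) - 1) := by push_cast; ring
    change v.valuation E (((x * y : Eˣ) : E) - 1) < 1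
    rw [h]
    refine ((v.valuation E).map_add _ _).trans_lt (max_lt ?_ hx)
    rw [map_mul]
    exact (mul_le_of_le_one_left' hx').trans_lt hy
  inv_mem' := by
    intro x hx
    have hx1 : v.valuation E (x : E) = 1 := by
      have h := Valuation.map_one_add_of_lt (v := v.valuation E) hx
      simpa using h
    change v.valuation E (((x⁻¹ : Eˣ) : E) - 1) < 1
    have h : ((x⁻¹ : Eˣ) : E) - 1 = -(((x⁻¹ : Eˣ) : E) * ((x : E) - 1)) := by
      rw [mul_sub]; simp
    rw [h, Valuation.map_neg, map_mul]
    have : v.valuation E ((x⁻¹ : Eˣ) : E) = 1 := by simp [hx1]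
    rw [this, one_mul]
    exact hx

variable {v : HeightOneSpectrum (𝓞 E)}

theorem mem_principalUnits {x : Eˣ} :
    x ∈ principalUnits v ↔ v.valuation E ((x : E) - 1) < 1 := Iff.rfl

theorem valuation_eq_one_of_mem_principalUnits {x : Eˣ} (hx : x ∈ principalUnits v) :
    v.valuation E (x : E) = 1 := by
  have h := Valuation.map_one_add_of_lt (v := v.valuation E) hx
  simpa using h

/-- For a `v`-unit `y`, this passes between multiplicative and additive congruences. -/
theorem div_mem_principalUnits {x y : Eˣ} (hy : v.valuation E (y : E) = 1) :
    x / y ∈ principalUnits v ↔ v.valuation E ((x : E) - y) < 1 := by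
  have h : (x : E) - y = y * (((x / y : Eˣ) : E) - 1) := by
    rw [mul_sub, Units.val_div_eq_div_val, mul_div_cancel₀ _ y.ne_zero, mul_one]
  rw [mem_principalUnits, h, map_mul, hy, one_mul]

theorem valuation_units_ne_zero (x : Eˣ) : v.valuation E (x : E) ≠ 0 := by simp

/-- Fractions prime to `v` represent the elements that are integral at `v`. -/
theorem exists_eq_div_of_valuation_le_one {x : E} (hx : v.valuation E x ≤ 1) :
    ∃ a s : 𝓞 E, s ∉ v.asIdeal ∧ x = (a : E) / s := by
  obtain ⟨a, s, h⟩ := exists_primeCompl_mul_eq_of_integer v x hx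
  refine ⟨a, s, s.2, ?_⟩
  have hs : ((s : 𝓞 E) : E) ≠ 0 := by
    intro h0
    apply s.2
    rw [NumberField.RingOfIntegers.coe_eq_zero_iff.mp h0]
    exact zero_mem _
  rw [eq_div_iff hs]
  exact h

variable {F : Type*} [Field F] [Algebra F E]

/-- If `τ` acts on `𝓞` like the `q`-th power modulo `v`, then it does so for the `v`-units. -/
theorem smul_div_pow_mem_principalUnits {τ : Gal(E/F)} {q : ℕ}
    (h : ∀ a : 𝓞 E, τ • a - a ^ q ∈ v.asIdeal) {x : Eˣ} (hx : v.valuation E (x : E) = 1) :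
    (τ • x) / x ^ q ∈ principalUnits v := by
  rw [div_mem_principalUnits (by simp [hx])]
  obtain ⟨a, s, hs, hxe⟩ := exists_eq_div_of_valuation_le_one hx.le
  have hp := v.isPrime
  have hsq : s ^ q ∉ v.asIdeal := fun h' => hs (hp.mem_of_pow_mem _ h')
  -- `τ s` is congruent to `s ^ q`, hence nonzero modulo `v`.
  have hτs : τ • s ∉ v.asIdeal := fun h' => hsq (by
    have := sub_mem h' (h s)
    simpa using this)
  have hs0 : (s : E) ≠ 0 := fun h0 => hs (by
    rw [NumberField.RingOfIntegers.coe_eq_zero_iff.mp h0]; exact zero_mem _)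
  have hτs0 : ((τ • s : 𝓞 E) : E) ≠ 0 := fun h0 => hτs (by
    rw [NumberField.RingOfIntegers.coe_eq_zero_iff.mp h0]; exact zero_mem _)
  have hτx : ((τ • x : Eˣ) : E) = ((τ • a : 𝓞 E) : E) / ((τ • s : 𝓞 E) : E) := by
    change τ (x : E) = _
    rw [hxe, map_div₀]
    rfl
  -- Over the common denominator `τ s * s ^ q` the numerator is `τ a * s ^ q - τ s * a ^ q`; adding
  -- and subtracting `τ a * τ s` exhibits both summands as elements of `v`.
  have key : ((τ • x : Eˣ) : E) - ((x ^ q : Eˣ) : E) =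
      ((((τ • a) * (s ^ q - τ • s) + (τ • s) * (τ • a - a ^ q) : 𝓞 E)) : E) /
        ((τ • s * s ^ q : 𝓞 E) : E) := by
    rw [hτx]
    generalize τ • s = s' at *
    generalize τ • a = a' at *
    push_cast
    rw [hxe, div_pow, div_sub_div _ _ hτs0 (pow_ne_zero q hs0)]
    congr 1
    ring
  rw [key, map_div₀]
  have h1 : v.valuation E ((τ • s * s ^ q : 𝓞 E) : E) = 1 := by
    rw [valuation_eq_one_iff_notMem]
    exact fun h' => (hp.mem_or_mem h').elim hτs hsq
  rw [h1, div_one]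
  change v.valuation E (algebraMap (𝓞 E) E _) < 1
  rw [valuation_lt_one_iff_mem]
  refine add_mem (Ideal.mul_mem_left _ _ ?_) (Ideal.mul_mem_left _ _ (h a))
  rw [← neg_mem_iff, neg_sub]
  exact h s

/-- Inertia is the case `q = 1` of the preceding lemma. -/
theorem smul_div_mem_principalUnits {τ : Gal(E/F)} (h : τ ∈ v.asIdeal.inertia Gal(E/F)) {x : Eˣ}
    (hx : v.valuation E (x : E) = 1) : (τ • x) / x ∈ principalUnits v := by
  have := smul_div_pow_mem_principalUnits (τ := τ) (q := 1) (v := v) (fun a => by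
    rw [pow_one]; exact h a) hx
  simpa using this

end PrincipalUnits

end

/-! ### Roots of unity at a place, and the tame character -/

section
open IsDedekindDomain HeightOneSpectrum WithZero

/-- Reduction modulo `Q` is injective on `m`-th roots of unity if `m ∉ Q`. -/
theorem eq_of_pow_eq_one_of_sub_mem {S : Type*} [CommRing S] [IsDomain S] (Q : Ideal S)
    {ζ η : S} {m : ℕ} (hζ : ζ ^ m = 1) (hη : η ^ m = 1) (hm : (m : S) ∉ Q) (h : ζ - η ∈ Q) :
    ζ = η := by
  have hm0 : m ≠ 0 := by rintro rfl; simp at hm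
  -- `δ` is `ζ / η`, written without division.
  set δ := ζ * η ^ (m - 1) with hδ
  have hη' : η ^ (m - 1) * η = 1 := by rw [← pow_succ, Nat.sub_add_cancel (by omega), hη]
  have hδm : δ ^ m = 1 := by
    rw [hδ, mul_pow, hζ, one_mul, ← pow_mul, mul_comm, pow_mul, hη, one_pow]
  have hδQ : δ - 1 ∈ Q := by
    have : δ - 1 = (ζ - η) * η ^ (m - 1) := by rw [sub_mul, mul_comm η, hη']
    rw [this]
    exact Q.mul_mem_right _ h
  have h1 : (∑ i ∈ Finset.range m, δ ^ i) * (δ - 1) = 0 := by rw [geom_sum_mul, hδm, sub_self]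
  rcases mul_eq_zero.mp h1 with h2 | h2
  · refine absurd ?_ hm
    -- As `δ ≡ 1`, the geometric sum is congruent to `m`, so its vanishing would put `m` into `Q`.
    have h3 : ∑ i ∈ Finset.range m, (δ ^ i - 1) ∈ Q :=
      sum_mem fun i _ => Q.mem_of_dvd (sub_one_dvd_pow_sub_one δ i) hδQ
    rw [Finset.sum_sub_distrib, h2] at h3
    simpa using h3
  · calc ζ = δ * η := by rw [hδ, mul_assoc, hη', mul_one]
      _ = η := by rw [sub_eq_zero.mp h2, one_mul]

section Tame
variable {E : Type*} [Field E] [NumberField E] {v : HeightOneSpectrum (𝓞 E)}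
variable {ℓ : ℕ}

theorem notMem_of_coprime {R : Type*} [CommRing R] (P : Ideal R) [P.IsPrime] {m : ℕ}
    (hP : (ℓ : R) ∈ P) (h : Nat.Coprime m ℓ) : (m : R) ∉ P := by
  intro hm
  have h1 : IsCoprime (m : R) (ℓ : R) := by
    have := (Nat.isCoprime_iff_coprime.mpr h).map (Int.castRingHom R)
    simpa using this
  obtain ⟨a, b, hab⟩ := h1
  apply Ideal.IsPrime.ne_top ‹_›
  rw [Ideal.eq_top_iff_one, ← hab]
  exact add_mem (P.mul_mem_left _ hm) (P.mul_mem_left _ hP)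

theorem valuation_natCast_eq_one (hv : (ℓ : 𝓞 E) ∈ v.asIdeal) {m : ℕ} (h : Nat.Coprime m ℓ) :
    v.valuation E (m : E) = 1 := by
  have := v.isPrime
  have h1 := notMem_of_coprime v.asIdeal hv h
  rw [← valuation_eq_one_iff_notMem (K := E)] at h1
  simpa using h1

theorem valuation_natCast_lt_one (hv : (ℓ : 𝓞 E) ∈ v.asIdeal) :
    v.valuation E (ℓ : E) < 1 := by
  have h1 := (valuation_lt_one_iff_mem (K := E) v (ℓ : 𝓞 E)).mpr hv
  simpa using h1

theorem valuation_eq_one_of_pow_eq_one {ζ : E} {n : ℕ} (hn : n ≠ 0) (h : ζ ^ n = 1) :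
    v.valuation E ζ = 1 := by
  have : v.valuation E ζ ^ n = 1 := by rw [← map_pow, h, map_one]
  exact (pow_eq_one_iff.mp this).resolve_right hn

/-- `1 - ζ` divides `1 - ζ ^ i`, with a sum of powers of `ζ` as quotient. -/
theorem valuation_one_sub_pow_le {ζ : E} {n : ℕ} (hn : n ≠ 0) (h : ζ ^ n = 1) (i : ℕ) :
    v.valuation E (1 - ζ ^ i) ≤ v.valuation E (1 - ζ) := by
  rw [← mul_neg_geom_sum ζ i, map_mul]
  refine mul_le_of_le_one_right' ?_
  refine Valuation.map_sum_le _ fun j _ => ?_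
  rw [map_pow, valuation_eq_one_of_pow_eq_one hn h, one_pow]

/-- `ℓ = Φ_ℓ(1)` is the product of `1 - μ` over the primitive `ℓ`-th roots `μ`. All factors have the
same valuation, because `μ` and `ζ` are powers of each other. -/
theorem valuation_one_sub_pow (hℓ : ℓ.Prime) {ζ : E} (hζ : IsPrimitiveRoot ζ ℓ) :
    v.valuation E (1 - ζ) ^ (ℓ - 1) = v.valuation E (ℓ : E) := by
  have := Fact.mk hℓ
  have h1 := Polynomial.eval_one_cyclotomic_prime (R := E) (p := ℓ)
  rw [Polynomial.cyclotomic_eq_prod_X_sub_primitiveRoots hζ, Polynomial.eval_prod] at h1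
  simp only [Polynomial.eval_sub, Polynomial.eval_X, Polynomial.eval_C] at h1
  rw [← h1, map_prod, Finset.prod_congr rfl (g := fun _ => v.valuation E (1 - ζ)), Finset.prod_const,
    hζ.card_primitiveRoots, Nat.totient_prime hℓ]
  intro μ hμ
  have hμ' := (mem_primitiveRoots hℓ.pos).mp hμ
  obtain ⟨i, -, rfl⟩ := hζ.eq_pow_of_pow_eq_one hμ'.pow_eq_one
  refine le_antisymm (valuation_one_sub_pow_le hℓ.ne_zero hζ.pow_eq_one i) ?_
  obtain ⟨j, -, hj⟩ := hμ'.eq_pow_of_pow_eq_one hζ.pow_eq_one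
  conv_lhs => rw [← hj]
  exact valuation_one_sub_pow_le hℓ.ne_zero hμ'.pow_eq_one j

theorem valuation_one_sub_lt_one (hℓ : ℓ.Prime) (hv : (ℓ : 𝓞 E) ∈ v.asIdeal) {ζ : E}
    (hζ : IsPrimitiveRoot ζ ℓ) : v.valuation E (1 - ζ) < 1 := by
  have h := valuation_natCast_lt_one hv
  rw [← valuation_one_sub_pow hℓ hζ] at h
  by_contra! hc
  exact absurd h (not_lt.mpr (one_le_pow₀ hc))

variable {F : Type*} [Field F] [Algebra F E]

/-- The tame character: an element of the inertia group that raises `ℓ`-th roots of unity to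
the `g`-th power multiplies uniformizers by `g`. -/
theorem tame_character (hℓ : ℓ.Prime) (hv : (ℓ : 𝓞 E) ∈ v.asIdeal) {ζ : E}
    (hζ : IsPrimitiveRoot ζ ℓ) (hπ : v.valuation E (1 - ζ) = exp (-1 : ℤ)) {τ : Gal(E/F)}
    (hτ : τ ∈ v.asIdeal.inertia Gal(E/F)) {g : ℕ} (hg : Nat.Coprime g ℓ) (hτζ : τ ζ = ζ ^ g)
    (gU : Eˣ) (hgU : (gU : E) = g) (x : Eˣ) :
    (τ • x) / x * gU ^ (log (v.valuation E (x : E))) ∈ principalUnits v := by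
  have hπ0 : (1 - ζ) ≠ 0 := by
    intro h
    rw [h, map_zero] at hπ
    exact exp_ne_zero hπ.symm
  set π : Eˣ := Units.mk0 (1 - ζ) hπ0
  have hgv : v.valuation E (gU : E) = 1 := by rw [hgU]; exact valuation_natCast_eq_one hv hg
  have h1 : (τ • π) / π / gU ∈ principalUnits v := by
    rw [div_mem_principalUnits hgv]
    -- For the uniformizer itself the quotient is `(1 - ζ ^ g) / (1 - ζ)`, a sum of `g` terms
    -- congruent to `1`.
    have h2 : (((τ • π) / π : Eˣ) : E) = ∑ i ∈ Finset.range g, ζ ^ i := by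
      rw [Units.val_div_eq_div_val, div_eq_iff π.ne_zero]
      change τ (1 - ζ) = _ * (1 - ζ)
      rw [map_sub, map_one, hτζ, ← geom_sum_mul_neg]
    rw [h2, hgU]
    have h3 : (∑ i ∈ Finset.range g, ζ ^ i) - (g : E) = ∑ i ∈ Finset.range g, (ζ ^ i - 1) := by
      simp
    rw [h3]
    refine Valuation.map_sum_lt _ one_ne_zero fun i _ => ?_
    rw [Valuation.map_sub_swap]
    exact (valuation_one_sub_pow_le hℓ.ne_zero hζ.pow_eq_one i).trans_lt
      (valuation_one_sub_lt_one hℓ hv hζ)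
  set n := log (v.valuation E (x : E)) with hn
  -- Since `log` is minus the order and `π` has order `1`, multiplying by `π ^ n` makes `x` a
  -- `v`-unit, on which inertia acts trivially modulo `v`.
  have hvu : v.valuation E ((x * π ^ n : Eˣ) : E) = 1 := by
    rw [Units.val_mul, map_mul, Units.val_zpow_eq_zpow_val, map_zpow₀]
    change _ * v.valuation E (1 - ζ) ^ n = 1
    rw [hπ, ← exp_zsmul, ← exp_log (valuation_units_ne_zero (v := v) x), ← hn, ← exp_add]
    simp
  have h2 := smul_div_mem_principalUnits hτ hvu
  have h3 := mul_mem h2 (inv_mem (zpow_mem h1 n))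
  convert! h3 using 1
  have hs : ∀ a b : Eˣ, τ • (a * b) = (τ • a) * (τ • b) := fun a b => smul_mul' τ a b
  have hz : τ • (π ^ n) = (τ • π) ^ n := map_zpow (MulDistribMulAction.toMonoidHom Eˣ τ) π n
  rw [hs, hz]
  simp only [div_eq_mul_inv, mul_inv, inv_inv, mul_zpow, inv_zpow]
  have : (τ • π) ^ n * ((τ • π) ^ n)⁻¹ = 1 := mul_inv_cancel _
  calc _ = (τ • x) * x⁻¹ * gU ^ n * 1 * 1 := by simp
    _ = (τ • x) * x⁻¹ * gU ^ n * ((τ • π) ^ n * ((τ • π) ^ n)⁻¹) * (π ^ n * (π ^ n)⁻¹) := by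
        rw [mul_inv_cancel, mul_inv_cancel]
    _ = _ := by
      simp only [mul_assoc, mul_comm, mul_left_comm]

end Tame

end

/-! ### Ramification and Frobenius after adjoining roots of unity -/

section
open IsDedekindDomain HeightOneSpectrum WithZero

section Ramification
variable {F E : Type*} [Field F] [Field E] [Algebra F E] {v : HeightOneSpectrum (𝓞 E)} {ℓ : ℕ}

theorem natCast_mem_under (hv : (ℓ : 𝓞 E) ∈ v.asIdeal) : (ℓ : 𝓞 F) ∈ (v.under (𝓞 F)).asIdeal := by
  simpa [Ideal.mem_comap] using hv

/-- `τ η` and `η` are congruent modulo `v`, and reduction is injective on roots of unity of order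
prime to `ℓ`. -/
theorem apply_eq_of_mem_inertia {τ : Gal(E/F)} (hτ : τ ∈ v.asIdeal.inertia Gal(E/F))
    (hv : (ℓ : 𝓞 E) ∈ v.asIdeal) {s : ℕ} (hs : s.Coprime ℓ) (hs0 : s ≠ 0) {η : E} (hη : η ^ s = 1) :
    τ η = η := by
  have := v.isPrime
  have hint : IsIntegral ℤ η := IsIntegral.of_pow (Nat.pos_of_ne_zero hs0) (by
    rw [hη]; exact isIntegral_one)
  set a : 𝓞 E := ⟨η, hint⟩
  have ha : a ^ s = 1 := by ext; exact hη
  have hτa : (τ • a) ^ s = 1 := by rw [← smul_pow', ha, smul_one]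
  have := eq_of_pow_eq_one_of_sub_mem v.asIdeal hτa ha (notMem_of_coprime _ hv hs) (hτ a)
  exact congrArg (fun x : 𝓞 E => (x : E)) this

variable [NumberField F] [NumberField E]

theorem valuation_under (y : F) :
    (v.under (𝓞 F)).valuation F y ^ ((v.under (𝓞 F)).asIdeal.ramificationIdx' v.asIdeal) =
      v.valuation E (algebraMap F E y) := by
  have : v.asIdeal.LiesOver (v.under (𝓞 F)).asIdeal := ⟨rfl⟩
  exact valuation_liesOver E (v.under (𝓞 F)) v y

theorem card_inertia [IsGalois F E] :
    Nat.card (v.asIdeal.inertia Gal(E/F)) =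
      (v.under (𝓞 F)).asIdeal.ramificationIdx' v.asIdeal := by
  have : v.asIdeal.LiesOver (v.under (𝓞 F)).asIdeal := ⟨rfl⟩
  have := v.isPrime
  have := (v.under (𝓞 F)).isPrime
  have : (v.under (𝓞 F)).asIdeal.IsMaximal := (v.under (𝓞 F)).isMaximal
  have : Finite (𝓞 F ⧸ (v.under (𝓞 F)).asIdeal) :=
    Ideal.finiteQuotientOfFreeOfNeBot _ (v.under (𝓞 F)).ne_bot
  have : Finite (v.under (𝓞 F)).asIdeal.ResidueField := inferInstance
  rw [Ideal.card_inertia_eq_ramificationIdxIn (v.under (𝓞 F)).asIdeal v.asIdeal,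
    Ideal.ramificationIdxIn_eq_ramificationIdx _ v.asIdeal Gal(E/F),
    Ideal.ramificationIdx'_eq_ramificationIdx _ _ (v.under (𝓞 F)).ne_bot]

/-- In the totally ramified case, the exponents of elements of `F` are multiplied by `ℓ - 1`. -/
theorem log_valuation_algebraMap
    (he : (v.under (𝓞 F)).asIdeal.ramificationIdx' v.asIdeal = ℓ - 1) (y : F) :
    log (v.valuation E (algebraMap F E y)) =
      ((ℓ - 1 : ℕ) : ℤ) * log ((v.under (𝓞 F)).valuation F y) := by
  rw [← valuation_under, he, log_pow, nsmul_eq_mul]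

variable [IsGalois F E] [IsGalois ℚ F]

/-- Total ramification of `ℓ` when an `ℓ`-th root of unity is adjoined to an extension in which
`ℓ` is unramified. -/
theorem total_ramification (hℓ : ℓ.Prime) (hsplit : SplitsCompletely F ℓ)
    (hv : (ℓ : 𝓞 E) ∈ v.asIdeal) {ζ : E} (hζ : IsPrimitiveRoot ζ ℓ) {s : ℕ} (hs : s.Coprime ℓ)
    (hs0 : s ≠ 0)
    (hgen : ∀ τ τ' : Gal(E/F), (∀ η : E, η ^ s = 1 → τ η = τ' η) → τ ζ = τ' ζ → τ = τ') :
    (v.under (𝓞 F)).asIdeal.ramificationIdx' v.asIdeal = ℓ - 1 ∧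
    v.valuation E (1 - ζ) = exp (-1 : ℤ) ∧
    ∀ μ : E, IsPrimitiveRoot μ ℓ → ∃ τ ∈ v.asIdeal.inertia Gal(E/F), τ ζ = μ := by
  set e := (v.under (𝓞 F)).asIdeal.ramificationIdx' v.asIdeal with he
  have hvl : v.valuation E (ℓ : E) = exp (-(e : ℤ)) := by
    have h := valuation_under (v := v) (ℓ : F)
    have h2 := hsplit.valuation_eq hℓ (v.under (𝓞 F)) (natCast_mem_under hv)
    rw [h2, map_natCast, ← exp_nsmul] at h
    rw [← h]
    simp [he]
  have hπ0 : v.valuation E (1 - ζ) ≠ 0 := by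
    intro h
    have := valuation_one_sub_pow (v := v) hℓ hζ
    rw [h, hvl, zero_pow (Nat.sub_pos_of_lt hℓ.one_lt).ne'] at this
    exact exp_ne_zero this.symm
  set k := log (v.valuation E (1 - ζ)) with hk
  have hvk : v.valuation E (1 - ζ) = exp k := (exp_log hπ0).symm
  have hk0 : k < 0 := by
    have := valuation_one_sub_lt_one hℓ hv hζ
    rw [hvk, ← exp_zero, exp_lt_exp] at this
    exact this
  -- The valuation of `ℓ` computed twice: as `1 - ζ` to the power `ℓ - 1`, and through `F`, where
  -- `ℓ` is a uniformizer. As `k ≤ -1`, this gives `ℓ - 1 ≤ e`.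
  have hek : ((ℓ - 1 : ℕ) : ℤ) * k = -(e : ℤ) := by
    have h := valuation_one_sub_pow (v := v) hℓ hζ
    rw [hvl, hvk, ← exp_nsmul, exp_inj] at h
    simpa using h
  have hl1 : 0 < ℓ - 1 := Nat.sub_pos_of_lt hℓ.one_lt
  have hle : ℓ - 1 ≤ e := by
    zify
    nlinarith
  have : Fact ℓ.Prime := ⟨hℓ⟩
  let f : v.asIdeal.inertia Gal(E/F) → primitiveRoots ℓ E := fun τ =>
    ⟨(τ : Gal(E/F)) ζ, (mem_primitiveRoots hℓ.pos).mpr (hζ.map_of_injective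
      (τ : Gal(E/F)).injective)⟩
  -- Inertia fixes the `s`-th roots of unity, so its elements are determined by the image of `ζ`. As
  -- the inertia group has order `e`, this gives `e ≤ ℓ - 1`.
  have hf : Function.Injective f := by
    intro τ τ' h
    apply Subtype.ext
    refine hgen _ _ (fun η hη => ?_) (congrArg Subtype.val h)
    rw [apply_eq_of_mem_inertia τ.2 hv hs hs0 hη, apply_eq_of_mem_inertia τ'.2 hv hs hs0 hη]
  have hcard : Nat.card (primitiveRoots ℓ E) = ℓ - 1 := by
    rw [Nat.card_eq_fintype_card, Fintype.card_coe, hζ.card_primitiveRoots, Nat.totient_prime hℓ]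
  have hci : Nat.card (v.asIdeal.inertia Gal(E/F)) = e := card_inertia
  have hle' : e ≤ ℓ - 1 := by
    rw [← hci, ← hcard]
    exact Nat.card_le_card_of_injective f hf
  have hee : e = ℓ - 1 := le_antisymm hle' hle
  refine ⟨hee, ?_, ?_⟩
  · rw [hvk, exp_inj]
    rw [hee] at hek
    have : ((ℓ - 1 : ℕ) : ℤ) ≠ 0 := by exact_mod_cast hl1.ne'
    exact mul_left_cancel₀ this (by rw [hek]; ring)
  · intro μ hμ
    have hb : Function.Bijective f :=
      (Nat.bijective_iff_injective_and_card f).mpr ⟨hf, by rw [hci, hcard, hee]⟩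
    obtain ⟨τ, hτ⟩ := hb.2 ⟨μ, (mem_primitiveRoots hℓ.pos).mpr hμ⟩
    exact ⟨τ, τ.2, congrArg Subtype.val hτ⟩

/-- Inertia is transitive on the primitive `ℓ`-th roots of unity, so some inertia element agrees
with `τ` on `ζ`. Both fix the `s`-th roots of unity, hence they are equal. -/
theorem mem_inertia_of_forall_apply_eq (hℓ : ℓ.Prime) (hsplit : SplitsCompletely F ℓ)
    (hv : (ℓ : 𝓞 E) ∈ v.asIdeal) {ζ : E} (hζ : IsPrimitiveRoot ζ ℓ) {s : ℕ} (hs : s.Coprime ℓ)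
    (hs0 : s ≠ 0)
    (hgen : ∀ τ τ' : Gal(E/F), (∀ η : E, η ^ s = 1 → τ η = τ' η) → τ ζ = τ' ζ → τ = τ')
    {τ : Gal(E/F)} (hτ : ∀ η : E, η ^ s = 1 → τ η = η) : τ ∈ v.asIdeal.inertia Gal(E/F) := by
  obtain ⟨τ', hτ', h⟩ := (total_ramification hℓ hsplit hv hζ hs hs0 hgen).2.2 (τ ζ)
    (hζ.map_of_injective τ.injective)
  rwa [hgen τ τ' (fun η hη => by rw [hτ η hη, apply_eq_of_mem_inertia hτ' hv hs hs0 hη]) h.symm]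

/-- A Frobenius element at `v`. -/
theorem exists_frobenius (hℓ : ℓ.Prime) (hsplit : SplitsCompletely F ℓ)
    (hv : (ℓ : 𝓞 E) ∈ v.asIdeal) :
    ∃ φ : Gal(E/F), (∀ a : 𝓞 E, φ • a - a ^ ℓ ∈ v.asIdeal) ∧
      ∀ (s : ℕ), s.Coprime ℓ → s ≠ 0 → ∀ η : E, η ^ s = 1 → φ η = η ^ ℓ := by
  have := v.isPrime
  have : Finite (𝓞 E ⧸ v.asIdeal) := Ideal.finiteQuotientOfFreeOfNeBot _ v.ne_bot
  obtain ⟨φ, hφ⟩ := IsArithFrobAt.exists_of_isInvariant (𝓞 F) Gal(E/F) v.asIdeal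
  have hc : Nat.card (𝓞 F ⧸ v.asIdeal.under (𝓞 F)) = ℓ :=
    hsplit.card_quotient hℓ _ (natCast_mem_under hv)
  have h1 : ∀ a : 𝓞 E, φ • a - a ^ ℓ ∈ v.asIdeal := fun a => by
    have := hφ a
    rwa [hc] at this
  refine ⟨φ, h1, fun s hs hs0 η hη => ?_⟩
  have hint : IsIntegral ℤ η := IsIntegral.of_pow (Nat.pos_of_ne_zero hs0) (by
    rw [hη]; exact isIntegral_one)
  set a : 𝓞 E := ⟨η, hint⟩
  have ha : a ^ s = 1 := by ext; exact hη
  have hφa : (φ • a) ^ s = 1 := by rw [← smul_pow', ha, smul_one]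
  have := eq_of_pow_eq_one_of_sub_mem v.asIdeal hφa (by rw [← pow_mul, mul_comm, pow_mul, ha,
    one_pow]) (notMem_of_coprime _ hv hs) (h1 a)
  exact congrArg (fun x : 𝓞 E => (x : E)) this

end Ramification

end

/-! ### Localization at `ℓ` in terms of valuations, and approximation -/

section
open IsDedekindDomain HeightOneSpectrum WithZero

section Localization
variable {K : Type*} [Field K] [NumberField K] {L : Type*} [Field L] {ι : K →+* L} {A : Subring L}
  {ℓ : ℕ}

/-- The denominators of `y` form an ideal `I`. Integrality at the places above `ℓ` says that no
maximal ideal contains both `I` and `ℓ`, so some denominator is `≡ 1` modulo `ℓ`. -/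
theorem exists_coprime_eq_div {y : K}
    (hy : ∀ v : HeightOneSpectrum (𝓞 K), (ℓ : 𝓞 K) ∈ v.asIdeal → v.valuation K y ≤ 1) :
    ∃ a s : 𝓞 K, s ≠ 0 ∧ IsCoprime s (ℓ : 𝓞 K) ∧ y = (a : K) / s := by
  let I : Ideal (𝓞 K) :=
    { carrier := {s | ∃ a : 𝓞 K, (s : K) * y = a}
      add_mem' := by
        rintro s t ⟨a, ha⟩ ⟨b, hb⟩
        exact ⟨a + b, by push_cast; rw [add_mul, ha, hb]⟩
      zero_mem' := ⟨0, by simp⟩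
      smul_mem' := by
        rintro c s ⟨a, ha⟩
        exact ⟨c * a, by rw [smul_eq_mul]; push_cast; rw [mul_assoc, ha]⟩ }
  obtain ⟨d, b, hb, hdb⟩ := IsFractionRing.div_surjective (A := 𝓞 K) y
  have hb0 : b ≠ 0 := nonZeroDivisors.ne_zero hb
  have hbK : (b : K) ≠ 0 := by simpa using hb0
  have hbI : b ∈ I := ⟨d, by rw [← hdb]; exact mul_div_cancel₀ _ hbK⟩
  have htop : I ⊔ Ideal.span {(ℓ : 𝓞 K)} = ⊤ := by
    by_contra hne
    obtain ⟨m, hm, hle⟩ := Ideal.exists_le_maximal _ hne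
    have hbm : b ∈ m := hle (Ideal.mem_sup_left hbI)
    let v : HeightOneSpectrum (𝓞 K) := ⟨m, hm.isPrime, fun h => hb0 (by simpa [h] using hbm)⟩
    have hv : (ℓ : 𝓞 K) ∈ v.asIdeal :=
      hle (Ideal.mem_sup_right (Ideal.mem_span_singleton_self _))
    obtain ⟨a, s, hs, hys⟩ := exists_eq_div_of_valuation_le_one (hy v hv)
    have hsK : (s : K) ≠ 0 := by
      intro h0
      apply hs
      rw [NumberField.RingOfIntegers.coe_eq_zero_iff.mp h0]
      exact zero_mem _
    exact hs (hle (Ideal.mem_sup_left ⟨a, by rw [hys]; exact mul_div_cancel₀ _ hsK⟩))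
  have h1 : (1 : 𝓞 K) ∈ I ⊔ Ideal.span {(ℓ : 𝓞 K)} := by rw [htop]; trivial
  obtain ⟨s, ⟨a, ha⟩, t, ht, hst⟩ := Submodule.mem_sup.mp h1
  obtain ⟨c, rfl⟩ := Ideal.mem_span_singleton'.mp ht
  by_cases hs0 : s = 0
  -- If the denominator found is zero, then `ℓ` is invertible and every denominator is prime to it.
  · refine ⟨d, b, hb0, ⟨0, c, ?_⟩, hdb.symm⟩
    rw [← hst, hs0]
    ring
  · refine ⟨a, s, hs0, ⟨1, c, by rw [one_mul, hst]⟩, ?_⟩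
    have hsK : (s : K) ≠ 0 := by simpa using hs0
    rw [← ha, mul_div_cancel_left₀ _ hsK]

/-- The embedding `ι` allows a uniform treatment of `𝓞_(ℓ)` inside `F` (with `ι` the identity) and
of `𝓞_{r,(ℓ)}` inside `L`. -/
theorem mem_locAt_iff (hA : ∀ x, x ∈ A ↔ ∃ a : 𝓞 K, ι a = x) {x : L} :
    x ∈ locAt A ℓ ↔ ∃ y : K, ι y = x ∧
      ∀ v : HeightOneSpectrum (𝓞 K), (ℓ : 𝓞 K) ∈ v.asIdeal → v.valuation K y ≤ 1 := by
  constructor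
  · rintro ⟨a, s, hs, ⟨u, w, huw⟩, rfl⟩
    obtain ⟨a', ha'⟩ := (hA a).mp a.2
    obtain ⟨s', hs'⟩ := (hA s).mp s.2
    obtain ⟨u', hu'⟩ := (hA u).mp u.2
    obtain ⟨w', hw'⟩ := (hA w).mp w.2
    refine ⟨a' / s', by rw [map_div₀, ha', hs'], fun v hv => ?_⟩
    have hc : u' * s' + w' * (ℓ : 𝓞 K) = 1 := by
      apply NumberField.RingOfIntegers.coe_injective
      apply ι.injective
      have := congrArg (Subtype.val : A → L) huw
      push_cast at this ⊢
      simpa [hs', hu', hw'] using this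
    have hsv : s' ∉ v.asIdeal := fun h => v.isPrime.ne_top (by
      rw [Ideal.eq_top_iff_one, ← hc]
      exact add_mem (Ideal.mul_mem_left _ _ h) (Ideal.mul_mem_left _ _ hv))
    rw [map_div₀, (valuation_eq_one_iff_notMem v).mpr hsv, div_one]
    exact valuation_le_one v a'
  · rintro ⟨y, rfl, hy⟩
    obtain ⟨a, s, hs0, ⟨u, w, huw⟩, rfl⟩ := exists_coprime_eq_div hy
    refine ⟨⟨ι a, (hA _).mpr ⟨a, rfl⟩⟩, ⟨ι s, (hA _).mpr ⟨s, rfl⟩⟩, ?_, ?_, ?_⟩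
    · intro h
      have : ι s = 0 := congrArg Subtype.val h
      apply hs0
      simpa using this
    · refine ⟨⟨ι u, (hA _).mpr ⟨u, rfl⟩⟩, ⟨ι w, (hA _).mpr ⟨w, rfl⟩⟩, ?_⟩
      apply Subtype.ext
      have := congrArg (fun z : 𝓞 K => ι z) huw
      push_cast at this ⊢
      simpa using this
    · simp

/-- The radical is the intersection of the primes containing `ℓ`, and each of these contracts to a
place of `K` above `ℓ`. -/
theorem mk_mem_radical_iff (hA : ∀ x, x ∈ A ↔ ∃ a : 𝓞 K, ι a = x) (hℓ : ℓ ≠ 0) {y : K}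
    (hy : ι y ∈ locAt A ℓ) :
    (⟨ι y, hy⟩ : locAt A ℓ) ∈ (idealOf (locAt A ℓ) ℓ).radical ↔
      ∀ v : HeightOneSpectrum (𝓞 K), (ℓ : 𝓞 K) ∈ v.asIdeal → v.valuation K y < 1 := by
  obtain ⟨y', hyy', hval⟩ := (mem_locAt_iff hA).mp hy
  obtain rfl := ι.injective hyy'
  constructor
  · rintro ⟨n, hn⟩ v hv
    obtain ⟨z, hz⟩ := Ideal.mem_span_singleton'.mp hn
    obtain ⟨z', hz', hzval⟩ := (mem_locAt_iff hA).mp z.2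
    have h1 : z' * ℓ = y' ^ n := by
      apply ι.injective
      have := congrArg (Subtype.val : locAt A ℓ → L) hz
      push_cast at this
      rw [map_mul, hz', map_pow, map_natCast, this]
    have h2 : v.valuation K y' ^ n < 1 := by
      rw [← map_pow, ← h1, map_mul]
      exact (mul_le_of_le_one_left' (hzval v hv)).trans_lt (valuation_natCast_lt_one hv)
    by_contra! hc
    exact absurd h2 (not_lt.mpr (one_le_pow₀ hc))
  · intro h
    rw [Ideal.radical_eq_sInf, Submodule.mem_sInf]
    rintro P ⟨hle, hP⟩
    have hlP : (ℓ : locAt A ℓ) ∈ P := hle (Ideal.mem_span_singleton_self _)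
    obtain ⟨a, s, hs0, ⟨u, w, huw⟩, has⟩ := exists_coprime_eq_div hval
    let j : 𝓞 K →+* locAt A ℓ := (ι.comp (algebraMap (𝓞 K) K)).codRestrict (locAt A ℓ)
      fun x => le_locAt _ ℓ ((hA _).mpr ⟨x, rfl⟩)
    have hprime : (Ideal.comap j P).IsPrime := Ideal.comap_isPrime j P
    have hlJ : (ℓ : 𝓞 K) ∈ Ideal.comap j P := by rw [Ideal.mem_comap, map_natCast]; exact hlP
    let v : HeightOneSpectrum (𝓞 K) := ⟨Ideal.comap j P, hprime, fun h0 => by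
      rw [h0, Ideal.mem_bot] at hlJ
      exact hℓ (by exact_mod_cast hlJ)⟩
    have hsK : (s : K) ≠ 0 := by simpa using hs0
    have hs : s ∉ v.asIdeal := fun h' => v.isPrime.ne_top (by
      rw [Ideal.eq_top_iff_one, ← huw]
      exact add_mem (Ideal.mul_mem_left _ _ h') (Ideal.mul_mem_left _ _ hlJ))
    have hv1 := h v hlJ
    rw [has, map_div₀, (valuation_eq_one_iff_notMem v).mpr hs, div_one] at hv1
    have ha : a ∈ v.asIdeal := (valuation_lt_one_iff_mem v a).mp hv1
    have hmul : (⟨ι y', hy⟩ : locAt A ℓ) * j s = j a := by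
      apply Subtype.ext
      change ι y' * ι s = ι a
      rw [has, ← map_mul, div_mul_cancel₀ _ hsK]
    have : (⟨ι y', hy⟩ : locAt A ℓ) * j s ∈ P := by rw [hmul]; exact ha
    exact (hP.mem_or_mem this).resolve_right hs

theorem exp_neg_one_le_of_lt {x : ℤᵐ⁰} (hx : x < 1) : x ≤ exp (-1 : ℤ) := by
  by_cases h0 : x = 0
  · rw [h0]; exact zero_le
  · lift x to ℤ using h0
    rw [← exp_zero, exp_lt_exp] at hx
    rw [exp_le_exp]
    omega

theorem valuation_div_natCast_le_one {v : HeightOneSpectrum (𝓞 K)}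
    (hram : v.valuation K (ℓ : K) = exp (-1 : ℤ)) {y : K} (hy : v.valuation K y < 1) :
    v.valuation K (y / ℓ) ≤ 1 := by
  rw [map_div₀, hram, div_le_one₀ (by simp)]
  exact exp_neg_one_le_of_lt hy

/-- If `ℓ` is a uniformizer at all places above it, then `y / ℓ` is still integral there, so that no
radical is needed. -/
theorem mk_mem_idealOf_iff (hA : ∀ x, x ∈ A ↔ ∃ a : 𝓞 K, ι a = x)
    (hram : ∀ v : HeightOneSpectrum (𝓞 K), (ℓ : 𝓞 K) ∈ v.asIdeal →
      v.valuation K (ℓ : K) = exp (-1 : ℤ)) (hℓ : ℓ ≠ 0) {y : K}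
    (hy : ι y ∈ locAt A ℓ) :
    (⟨ι y, hy⟩ : locAt A ℓ) ∈ idealOf (locAt A ℓ) ℓ ↔
      ∀ v : HeightOneSpectrum (𝓞 K), (ℓ : 𝓞 K) ∈ v.asIdeal → v.valuation K y < 1 := by
  constructor
  · intro h
    exact (mk_mem_radical_iff hA hℓ hy).mp (Ideal.le_radical h)
  · intro h
    have hm : ι (y / ℓ) ∈ locAt A ℓ :=
      (mem_locAt_iff hA).mpr ⟨_, rfl, fun v hv => valuation_div_natCast_le_one (hram v hv) (h v hv)⟩
    have hlK : (ℓ : K) ≠ 0 := by exact_mod_cast hℓ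
    refine Ideal.mem_span_singleton'.mpr ⟨⟨_, hm⟩, Subtype.ext ?_⟩
    push_cast
    rw [← map_natCast ι, ← map_mul, div_mul_cancel₀ _ hlK]

theorem mem_idealOf_ringOfIntegers_iff
    (hram : ∀ v : HeightOneSpectrum (𝓞 K), (ℓ : 𝓞 K) ∈ v.asIdeal →
      v.valuation K (ℓ : K) = exp (-1 : ℤ)) (hℓ : ℓ ≠ 0) {a : 𝓞 K} :
    a ∈ idealOf (𝓞 K) ℓ ↔
      ∀ v : HeightOneSpectrum (𝓞 K), (ℓ : 𝓞 K) ∈ v.asIdeal → a ∈ v.asIdeal := by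
  have hlK : (ℓ : K) ≠ 0 := by exact_mod_cast hℓ
  constructor
  · intro h v hv
    exact (Ideal.span_singleton_le_iff_mem _).mpr hv h
  · intro h
    obtain ⟨b, hb⟩ := mem_integers_of_valuation_le_one K ((a : K) / ℓ) (fun v => by
      by_cases hv : (ℓ : 𝓞 K) ∈ v.asIdeal
      · exact valuation_div_natCast_le_one (hram v hv)
          ((valuation_lt_one_iff_mem v a).mpr (h v hv))
      · have h1 := (valuation_eq_one_iff_notMem (K := K) v).mpr hv
        have h2 : v.valuation K (ℓ : K) = 1 := by simpa using h1
        rw [map_div₀, h2, div_one]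
        exact valuation_le_one v a)
    refine Ideal.mem_span_singleton'.mpr ⟨b, ?_⟩
    apply NumberField.RingOfIntegers.coe_injective
    rw [map_mul, hb, map_natCast]
    exact div_mul_cancel₀ _ hlK

/-- Simultaneous approximation at finitely many places. -/
theorem exists_sub_mem_pow {S : Set (HeightOneSpectrum (𝓞 K))} (hS : S.Finite) (n : ℕ)
    (c : HeightOneSpectrum (𝓞 K) → 𝓞 K) : ∃ a : 𝓞 K, ∀ v ∈ S, a - c v ∈ v.asIdeal ^ n := by
  obtain ⟨a, ha⟩ := IsDedekindDomain.exists_forall_sub_mem_ideal (s := hS.toFinset)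
    (fun v : HeightOneSpectrum (𝓞 K) => v.asIdeal) (fun _ => n)
    (fun v _ => v.prime) (fun v _ w _ hvw h => hvw (HeightOneSpectrum.ext h))
    (fun v => c v)
  exact ⟨a, fun v hv => ha v (hS.mem_toFinset.mpr hv)⟩

theorem finite_places (hℓ : ℓ ≠ 0) :
    {v : HeightOneSpectrum (𝓞 K) | (ℓ : 𝓞 K) ∈ v.asIdeal}.Finite := by
  have h : Ideal.span {(ℓ : 𝓞 K)} ≠ 0 := by
    rw [Ideal.zero_eq_bot, Ne, Ideal.span_singleton_eq_bot]
    exact_mod_cast hℓ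
  refine (Ideal.finite_factors h).subset fun v hv => ?_
  rw [Set.mem_ofPred_eq, Ideal.dvd_span_singleton]
  exact hv

/-- Elements with prescribed valuations at the places above `ℓ`. -/
theorem exists_log_valuation_eq (hℓ : ℓ ≠ 0) (n : HeightOneSpectrum (𝓞 K) → ℤ) :
    ∃ y : Kˣ, ∀ v : HeightOneSpectrum (𝓞 K), (ℓ : 𝓞 K) ∈ v.asIdeal →
      log (v.valuation K (y : K)) = n v := by
  classical
  have hS := finite_places (K := K) hℓ
  have hunif : ∀ w : HeightOneSpectrum (𝓞 K), ∃ π : Kˣ, (ℓ : 𝓞 K) ∈ w.asIdeal →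
      w.valuation K (π : K) = exp (-1 : ℤ) ∧ ∀ v : HeightOneSpectrum (𝓞 K),
        (ℓ : 𝓞 K) ∈ v.asIdeal → v ≠ w → v.valuation K (π : K) = 1 := by
    intro w
    by_cases hw : (ℓ : 𝓞 K) ∈ w.asIdeal
    swap
    · exact ⟨1, fun h => absurd h hw⟩
    obtain ⟨ϖ, hϖ⟩ := w.intValuation_exists_uniformizer
    -- Approximation modulo squares, so that `a` has the exact valuation of the uniformizer at `w`;
    -- at the other places it is a unit.
    obtain ⟨a, ha⟩ := exists_sub_mem_pow hS 2 (fun v => if v = w then ϖ else 1)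
    have haw : w.intValuation a = exp (-1 : ℤ) := by
      have h1 := ha w hw
      rw [if_pos rfl, ← intValuation_le_pow_iff_mem] at h1
      rw [← hϖ]
      have h2 : w.intValuation (a - ϖ) < w.intValuation ϖ := by
        rw [hϖ]
        refine h1.trans_lt ?_
        rw [exp_lt_exp]
        norm_num
      have h3 := Valuation.map_add_eq_of_lt_right w.intValuation h2
      rwa [sub_add_cancel] at h3
    have ha0 : (a : K) ≠ 0 := by
      intro h0
      rw [NumberField.RingOfIntegers.coe_eq_zero_iff.mp h0, map_zero] at haw
      exact exp_ne_zero haw.symm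
    refine ⟨Units.mk0 (a : K) ha0, fun _ => ⟨?_, fun v hv hvw => ?_⟩⟩
    · rw [← haw]
      exact valuation_of_algebraMap w a
    · refine (valuation_eq_one_iff_notMem v).mpr fun hav => ?_
      have h1 := Ideal.pow_le_self two_ne_zero (ha v hv)
      rw [if_neg hvw] at h1
      refine v.isPrime.ne_top ((Ideal.eq_top_iff_one _).mpr ?_)
      have := sub_mem hav h1
      simpa using this
  choose π hπ using hunif
  -- The sign is there because `log` of the valuation of a uniformizer is `-1`.
  refine ⟨∏ w ∈ hS.toFinset, π w ^ (-n w), fun v hv => ?_⟩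
  rw [Units.coe_prod, map_prod, Finset.prod_eq_single v]
  · rw [Units.val_zpow_eq_zpow_val, map_zpow₀, (hπ v hv).1, log_zpow, log_exp]
    simp
  · intro w hw hwv
    rw [Units.val_zpow_eq_zpow_val, map_zpow₀, (hπ w (hS.mem_toFinset.mp hw)).2 v hv hwv.symm,
      one_zpow]
  · intro h
    exact absurd (hS.mem_toFinset.mpr hv) h

end Localization

end

/-! ### Levels and the fields `F_r` -/

section
open IsDedekindDomain HeightOneSpectrum WithZero

section Levels
variable {F : Type*} [Field F] [NumberField F] {M : ℕ}

theorem one_mem_levels : 1 ∈ levels F M :=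
  ⟨squarefree_one, fun _ hℓ h => absurd (Nat.dvd_one.mp h) hℓ.ne_one⟩

theorem levels_ne_zero {r : ℕ} (hr : r ∈ levels F M) : r ≠ 0 := hr.1.ne_zero

theorem levels_of_dvd {r s : ℕ} (hr : r ∈ levels F M) (hs : s ∣ r) : s ∈ levels F M :=
  ⟨hr.1.squarefree_of_dvd hs, fun ℓ hℓ h => hr.2 ℓ hℓ (h.trans hs)⟩

theorem IsGoodPrime.mem_levels {ℓ : ℕ} (h : IsGoodPrime F M ℓ) : ℓ ∈ levels F M :=
  ⟨h.1.squarefree, fun q hq hd => by rwa [(Nat.prime_dvd_prime_iff_eq hq h.1).mp hd]⟩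

theorem mul_mem_levels {r ℓ : ℕ} (hr : r ∈ levels F M) (hℓ : IsGoodPrime F M ℓ)
    (h : r.Coprime ℓ) : r * ℓ ∈ levels F M := by
  refine ⟨(Nat.squarefree_mul h).mpr ⟨hr.1, hℓ.1.squarefree⟩, fun q hq hd => ?_⟩
  rcases (Nat.Prime.dvd_mul hq).mp hd with h1 | h1
  · exact hr.2 q hq h1
  · rwa [(Nat.prime_dvd_prime_iff_eq hq hℓ.1).mp h1]

theorem lcm_mem_levels {r s : ℕ} (hr : r ∈ levels F M) (hs : s ∈ levels F M) :
    r.lcm s ∈ levels F M := by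
  refine ⟨?_, fun q hq hd => ?_⟩
  · rw [Nat.squarefree_iff_factorization_le_one
      (Nat.lcm_ne_zero (levels_ne_zero hr) (levels_ne_zero hs))]
    intro q
    rw [Nat.factorization_lcm (levels_ne_zero hr) (levels_ne_zero hs)]
    exact sup_le (hr.1.natFactorization_le_one q) (hs.1.natFactorization_le_one q)
  · rcases (Nat.Prime.dvd_lcm hq).mp hd with h1 | h1
    · exact hr.2 q hq h1
    · exact hs.2 q hq h1

theorem coprime_div {r ℓ : ℕ} (hr : r ∈ levels F M) (hℓ : ℓ.Prime) (hd : ℓ ∣ r) :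
    (r / ℓ).Coprime ℓ := by
  obtain ⟨s, rfl⟩ := hd
  rw [Nat.mul_div_cancel_left _ hℓ.pos]
  exact (Nat.coprime_of_squarefree_mul hr.1).symm

theorem div_mem_levels {r ℓ : ℕ} (hr : r ∈ levels F M) (hd : ℓ ∣ r) :
    r / ℓ ∈ levels F M := levels_of_dvd hr (Nat.div_dvd_of_dvd hd)

theorem IsGoodPrime.dvd_sub_one {ℓ : ℕ} (h : IsGoodPrime F M ℓ) : M ∣ ℓ - 1 :=
  (Nat.modEq_iff_dvd' h.1.one_lt.le).mp h.2.2.1.symm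

theorem IsGoodPrime.coprime {ℓ : ℕ} (h : IsGoodPrime F M ℓ) : M.Coprime ℓ := by
  have h1 := Nat.ModEq.gcd_eq h.2.2.1
  rw [Nat.gcd_one_left] at h1
  exact (Nat.coprime_iff_gcd_eq_one.mpr h1).symm

end Levels

section Cyc
variable {F : Type*} [Field F] {L : Type*} [Field L] [Algebra F L]

theorem mem_cyc_of_pow_eq_one {r : ℕ} {ζ : L} (h : ζ ^ r = 1) : ζ ∈ cyc F L r :=
  IntermediateField.subset_adjoin F _ h

theorem cyc_mono {r s : ℕ} (h : s ∣ r) : cyc F L s ≤ cyc F L r := by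
  refine IntermediateField.adjoin.mono F _ _ fun ζ hζ => ?_
  obtain ⟨k, rfl⟩ := h
  change ζ ^ (s * k) = 1
  rw [pow_mul, show ζ ^ s = 1 from hζ, one_pow]

theorem eq_of_pow_eq_pow {K : Type*} [Field K] {a b : K} (hb : b ≠ 0) {m n : ℕ} (h : m.Coprime n)
    (hm : a ^ m = b ^ m) (hn : a ^ n = b ^ n) : a = b := by
  have h1 : (a / b) ^ m = 1 := by rw [div_pow, hm, div_self (pow_ne_zero _ hb)]
  have h2 : (a / b) ^ n = 1 := by rw [div_pow, hn, div_self (pow_ne_zero _ hb)]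
  have h3 : orderOf (a / b) ∣ 1 := by
    rw [← Nat.coprime_iff_gcd_eq_one.mp h]
    exact Nat.dvd_gcd (orderOf_dvd_of_pow_eq_one h1) (orderOf_dvd_of_pow_eq_one h2)
  have h4 := orderOf_eq_one_iff.mp (Nat.dvd_one.mp h3)
  exact (div_eq_one_iff_eq hb).mp h4

theorem algHom_cyc_ext {r : ℕ} {B : Type*} [Field B] [Algebra F B] {f g : cyc F L r →ₐ[F] B}
    (h : ∀ x : cyc F L r, x ^ r = 1 → f x = g x) : f = g := by
  ext ⟨x, hx⟩
  induction hx using IntermediateField.adjoin_induction with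
  | mem x hx =>
    refine h _ ?_
    ext
    exact hx
  | algebraMap x => exact (f.commutes x).trans (g.commutes x).symm
  | add x y hx hy h1 h2 =>
    have : (⟨x + y, add_mem hx hy⟩ : cyc F L r) = ⟨x, hx⟩ + ⟨y, hy⟩ := rfl
    rw [this, map_add, map_add, h1, h2]
  | inv x hx h1 =>
    have : (⟨x⁻¹, inv_mem hx⟩ : cyc F L r) = (⟨x, hx⟩ : cyc F L r)⁻¹ := rfl
    rw [this, map_inv₀, map_inv₀, h1]
  | mul x y hx hy h1 h2 =>
    have : (⟨x * y, mul_mem hx hy⟩ : cyc F L r) = ⟨x, hx⟩ * ⟨y, hy⟩ := rfl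
    rw [this, map_mul, map_mul, h1, h2]

/-- For an `r`-th root of unity `x`, the powers `x ^ m` and `x ^ n` are roots of unity of order
dividing `n` and `m`, and a nonzero element is determined by its powers with coprime exponents. -/
theorem algHom_cyc_mul_ext {m n r : ℕ} (hr : m * n = r) (hr0 : r ≠ 0) (hmn : m.Coprime n)
    {B : Type*} [Field B] [Algebra F B]
    {f g : cyc F L r →ₐ[F] B} (h1 : ∀ x : cyc F L r, x ^ m = 1 → f x = g x)
    (h2 : ∀ x : cyc F L r, x ^ n = 1 → f x = g x) : f = g := by
  refine algHom_cyc_ext fun x hx => ?_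
  have hx0 : x ≠ 0 := by
    rintro rfl
    rw [zero_pow hr0] at hx
    exact zero_ne_one hx
  refine eq_of_pow_eq_pow (by simpa using hx0) hmn ?_ ?_
  · rw [← map_pow, ← map_pow, h2]
    rw [← pow_mul, hr, hx]
  · rw [← map_pow, ← map_pow, h1]
    rw [← pow_mul', hr, hx]

theorem apply_eq_of_mem_cyc {r : ℕ} {τ τ' : Gal(L/F)} (h : ∀ ζ : L, ζ ^ r = 1 → τ ζ = τ' ζ) {x : L}
    (hx : x ∈ cyc F L r) : τ x = τ' x := by
  have := algHom_cyc_ext (F := F) (L := L) (r := r)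
    (f := (τ : L →ₐ[F] L).comp (cyc F L r).val) (g := (τ' : L →ₐ[F] L).comp (cyc F L r).val)
    (fun y hy => h y (by
      have := congrArg (Subtype.val : cyc F L r → L) hy
      simpa using this))
  exact DFunLike.congr_fun this ⟨x, hx⟩

theorem apply_eq_of_mem_cyc_mul {m n r : ℕ} (hr : m * n = r) (hr0 : r ≠ 0) (hmn : m.Coprime n)
    {τ τ' : Gal(L/F)} (h1 : ∀ ζ : L, ζ ^ m = 1 → τ ζ = τ' ζ) (h2 : ∀ ζ : L, ζ ^ n = 1 → τ ζ = τ' ζ)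
    {x : L} (hx : x ∈ cyc F L r) : τ x = τ' x := by
  refine apply_eq_of_mem_cyc (fun ζ hζ => ?_) hx
  have hx0 : ζ ≠ 0 := by
    rintro rfl
    rw [zero_pow hr0] at hζ
    exact zero_ne_one hζ
  refine eq_of_pow_eq_pow (by simpa using hx0) hmn ?_ ?_
  · rw [← map_pow, ← map_pow, h2]
    rw [← pow_mul, hr, hζ]
  · rw [← map_pow, ← map_pow, h1]
    rw [← pow_mul', hr, hζ]

/-- An adjunction of roots of unity is the union of its finite layers. -/
theorem exists_mem_cyc_of_mem_adjoin {T : Set ℕ} (h1 : 1 ∈ T)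
    (hlcm : ∀ m ∈ T, ∀ n ∈ T, m.lcm n ∈ T) {x : L}
    (hx : x ∈ IntermediateField.adjoin F {ζ : L | ∃ n ∈ T, ζ ^ n = 1}) :
    ∃ n ∈ T, x ∈ cyc F L n := by
  induction hx using IntermediateField.adjoin_induction with
  | mem x hx =>
    obtain ⟨n, hn, hx⟩ := hx
    exact ⟨n, hn, mem_cyc_of_pow_eq_one hx⟩
  | algebraMap x => exact ⟨1, h1, (cyc F L 1).algebraMap_mem x⟩
  | add x y hx hy ihx ihy =>
    obtain ⟨m, hm, hxm⟩ := ihx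
    obtain ⟨n, hn, hyn⟩ := ihy
    exact ⟨_, hlcm m hm n hn, add_mem (cyc_mono (Nat.dvd_lcm_left m n) hxm)
      (cyc_mono (Nat.dvd_lcm_right m n) hyn)⟩
  | inv x hx ih =>
    obtain ⟨m, hm, hxm⟩ := ih
    exact ⟨m, hm, inv_mem hxm⟩
  | mul x y hx hy ihx ihy =>
    obtain ⟨m, hm, hxm⟩ := ihx
    obtain ⟨n, hn, hyn⟩ := ihy
    exact ⟨_, hlcm m hm n hn, mul_mem (cyc_mono (Nat.dvd_lcm_left m n) hxm)
      (cyc_mono (Nat.dvd_lcm_right m n) hyn)⟩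

variable [NumberField F] {M : ℕ} [IsCyclotomicExtension (levels F M) F L] {r : ℕ}

theorem exists_primitiveRoot (L : Type*) [Field L] [Algebra F L]
    [IsCyclotomicExtension (levels F M) F L] (hr : r ∈ levels F M) :
    ∃ ζ : L, IsPrimitiveRoot ζ r :=
  IsCyclotomicExtension.exists_isPrimitiveRoot (S := levels F M) F L hr (levels_ne_zero hr)

theorem exists_primitiveRoot_cyc {d : ℕ} (hr : r ∈ levels F M) (hd : d ∣ r) :
    ∃ ζ : cyc F L r, IsPrimitiveRoot ζ d := by
  obtain ⟨ζ, hζ⟩ := exists_primitiveRoot L (levels_of_dvd hr hd)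
  refine ⟨⟨ζ, cyc_mono hd (mem_cyc_of_pow_eq_one hζ.pow_eq_one)⟩, ?_⟩
  exact IsPrimitiveRoot.coe_submonoidClass_iff.mp hζ

theorem isCyclotomicExtension_cyc (hr : r ∈ levels F M) :
    IsCyclotomicExtension {r} F (cyc F L r) := by
  have h := IntermediateField.isCyclotomicExtension_adjoin_of_exists_isPrimitiveRoot {r} F L
    (by rintro n rfl -; exact exists_primitiveRoot (M := M) L hr)
  have he : {b : L | ∃ n ∈ ({r} : Set ℕ), n ≠ 0 ∧ b ^ n = 1} = {ζ : L | ζ ^ r = 1} := by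
    ext b
    simp [levels_ne_zero hr]
  rw [he] at h
  exact h

theorem charZero_of_algebra (F L : Type*) [Field F] [NumberField F] [Field L] [Algebra F L] :
    CharZero L :=
  charZero_of_injective_algebraMap (algebraMap F L).injective

theorem numberField_cyc (hr : r ∈ levels F M) : NumberField (cyc F L r) := by
  have := isCyclotomicExtension_cyc (L := L) hr
  have := charZero_of_algebra F L
  exact IsCyclotomicExtension.numberField {r} F (cyc F L r)

theorem isGalois_cyc (hr : r ∈ levels F M) : IsGalois F (cyc F L r) := by
  have := isCyclotomicExtension_cyc (L := L) hr
  exact IsCyclotomicExtension.isGalois {r} F (cyc F L r)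

theorem isGalois_of_levels (M : ℕ) [IsCyclotomicExtension (levels F M) F L] : IsGalois F L :=
  IsCyclotomicExtension.isGalois (levels F M) F L

theorem gal_mul_comm (M : ℕ) [IsCyclotomicExtension (levels F M) F L] (τ τ' : Gal(L/F)) :
    τ * τ' = τ' * τ :=
  (IsCyclotomicExtension.isMulCommutative (levels F M) F L).is_comm.comm τ τ'

/-- This reduces statements about elements of the possibly infinite extension `L` to number fields.
-/
theorem exists_level (M : ℕ) [IsCyclotomicExtension (levels F M) F L] (x : L) :
    ∃ r ∈ levels F M, x ∈ cyc F L r := by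
  refine exists_mem_cyc_of_mem_adjoin one_mem_levels (fun m hm n hn => lcm_mem_levels hm hn) ?_
  have hx := IsCyclotomicExtension.adjoin_roots (S := levels F M) (A := F) x
  refine (Algebra.adjoin_le (S := (IntermediateField.adjoin F _).toSubalgebra) ?_) hx
  rintro ζ ⟨n, hn, -, hζ⟩
  exact IntermediateField.subset_adjoin F _ ⟨n, hn, hζ⟩

end Cyc

end

/-! ### Ramification in the layers and automorphisms fixing roots of unity of order prime to `ℓ` -/

section
open IsDedekindDomain HeightOneSpectrum WithZero

section Layers
variable {F : Type*} [Field F] {L : Type*} [Field L] [Algebra F L]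

/-- Supplies the hypothesis `hgen` of `total_ramification` for `F_r`. -/
theorem gal_cyc_ext {r s ℓ : ℕ} (hr : s * ℓ = r) (hr0 : r ≠ 0)
    (hs : s.Coprime ℓ) {ζ : cyc F L r} (hζ : IsPrimitiveRoot ζ ℓ) (τ τ' : Gal(cyc F L r/F))
    (h1 : ∀ η : cyc F L r, η ^ s = 1 → τ η = τ' η) (h2 : τ ζ = τ' ζ) : τ = τ' := by
  have hℓ0 : ℓ ≠ 0 := by rintro rfl; exact hr0 (by rw [← hr, mul_zero])
  have : NeZero ℓ := ⟨hℓ0⟩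
  have h : ((cyc F L r).val.comp (τ : cyc F L r →ₐ[F] cyc F L r)) =
      ((cyc F L r).val.comp (τ' : cyc F L r →ₐ[F] cyc F L r)) := by
    refine algHom_cyc_mul_ext hr hr0 hs (fun x hx => congrArg Subtype.val (h1 x hx)) fun x hx => ?_
    obtain ⟨i, -, rfl⟩ := hζ.eq_pow_of_pow_eq_one hx
    change ((τ (ζ ^ i) : cyc F L r) : L) = (τ' (ζ ^ i) : cyc F L r)
    rw [map_pow, map_pow, h2]
  ext x
  exact DFunLike.congr_fun h x

variable [NumberField F] {M : ℕ}

/-- The extension of `F` generated by the roots of unity of good order prime to `ℓ`. -/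
def cycPrimeTo (F : Type*) [Field F] [NumberField F] (M : ℕ) (L : Type*) [Field L] [Algebra F L]
    (ℓ : ℕ) : IntermediateField F L :=
  IntermediateField.adjoin F {ζ : L | ∃ n ∈ {n | n ∈ levels F M ∧ n.Coprime ℓ}, ζ ^ n = 1}

/-- A polynomial has finitely many coefficients, so it is defined over a single layer prime to `ℓ`.
-/
theorem exists_forall_mem_cyc (ℓ : ℕ) (p : Polynomial (cycPrimeTo F M L ℓ)) :
    ∃ s ∈ levels F M, s.Coprime ℓ ∧ ∀ i, (p.coeff i : L) ∈ cyc F L s := by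
  have hlcm : ∀ m ∈ {n | n ∈ levels F M ∧ n.Coprime ℓ}, ∀ n ∈ {n | n ∈ levels F M ∧ n.Coprime ℓ},
      m.lcm n ∈ {n | n ∈ levels F M ∧ n.Coprime ℓ} := fun m hm n hn =>
    ⟨lcm_mem_levels hm.1 hn.1, Nat.Coprime.coprime_dvd_left (Nat.lcm_dvd_mul m n)
      (Nat.Coprime.mul_left hm.2 hn.2)⟩
  induction p using Polynomial.induction_on' with
  | add p q hp hq =>
    obtain ⟨m, hm, hm', hpm⟩ := hp
    obtain ⟨n, hn, hn', hqn⟩ := hq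
    have := hlcm m ⟨hm, hm'⟩ n ⟨hn, hn'⟩
    refine ⟨_, this.1, this.2, fun i => ?_⟩
    rw [Polynomial.coeff_add]
    exact add_mem (cyc_mono (Nat.dvd_lcm_left m n) (hpm i))
      (cyc_mono (Nat.dvd_lcm_right m n) (hqn i))
  | monomial k a =>
    obtain ⟨n, hn, han⟩ := exists_mem_cyc_of_mem_adjoin
      (T := {n | n ∈ levels F M ∧ n.Coprime ℓ}) ⟨one_mem_levels, Nat.coprime_one_left ℓ⟩ hlcm a.2
    refine ⟨n, hn.1, hn.2, fun i => ?_⟩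
    rw [Polynomial.coeff_monomial]
    split_ifs
    · exact han
    · exact zero_mem _

theorem exists_place {K : Type*} [Field K] [NumberField K] {ℓ : ℕ} (hℓ : ℓ.Prime) :
    ∃ v : HeightOneSpectrum (𝓞 K), (ℓ : 𝓞 K) ∈ v.asIdeal := by
  have hne : Ideal.span {(ℓ : 𝓞 K)} ≠ ⊤ := by
    intro h
    rw [Ideal.span_singleton_eq_top] at h
    have h1 := (h.map (Algebra.norm ℤ))
    rw [← map_natCast (algebraMap ℤ (𝓞 K)), Algebra.norm_algebraMap] at h1
    have h2 := (isUnit_pow_iff (Module.finrank_pos (R := ℤ) (M := 𝓞 K)).ne').mp h1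
    exact (Nat.prime_iff_prime_int.mp hℓ).not_isUnit h2
  obtain ⟨m, hm, hle⟩ := Ideal.exists_le_maximal _ hne
  have hlm : (ℓ : 𝓞 K) ∈ m := hle (Ideal.mem_span_singleton_self _)
  exact ⟨⟨m, hm.isPrime, fun h => by
    rw [h, Ideal.mem_bot] at hlm
    exact hℓ.ne_zero (by exact_mod_cast hlm)⟩, hlm⟩

end Layers

section LayerRamification
variable {F : Type*} [Field F] [NumberField F] [IsGalois ℚ F] {M : ℕ}
  {L : Type*} [Field L] [Algebra F L] [IsCyclotomicExtension (levels F M) F L]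

/-- The ramification of `ℓ` in `F_r / F` for `ℓ ∣ r`. -/
theorem cyc_ramification {r ℓ : ℕ} (hr : r ∈ levels F M) (hℓ : ℓ.Prime) (hd : ℓ ∣ r)
    [NumberField (cyc F L r)] {v : HeightOneSpectrum (𝓞 (cyc F L r))}
    (hv : (ℓ : 𝓞 (cyc F L r)) ∈ v.asIdeal) {ζ : cyc F L r} (hζ : IsPrimitiveRoot ζ ℓ) :
    (v.under (𝓞 F)).asIdeal.ramificationIdx' v.asIdeal = ℓ - 1 ∧
    v.valuation (cyc F L r) (1 - ζ) = exp (-1 : ℤ) ∧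
    (∀ μ : cyc F L r, IsPrimitiveRoot μ ℓ → ∃ τ : Gal(cyc F L r/F),
      (∀ η : cyc F L r, η ^ (r / ℓ) = 1 → τ η = η) ∧ τ ζ = μ) ∧
    ∀ τ : Gal(cyc F L r/F), (∀ η : cyc F L r, η ^ (r / ℓ) = 1 → τ η = η) →
      τ ∈ v.asIdeal.inertia Gal(cyc F L r/F) := by
  have := isGalois_cyc (L := L) hr
  have hgood := hr.2 ℓ hℓ hd
  have hr0 := levels_ne_zero hr
  have hs := coprime_div hr hℓ hd
  have hs0 : r / ℓ ≠ 0 := levels_ne_zero (div_mem_levels hr hd)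
  have hgen := gal_cyc_ext (F := F) (L := L) (Nat.div_mul_cancel hd) hr0 hs hζ
  obtain ⟨h1, h2, h3⟩ := total_ramification (F := F) hℓ hgood.2.2.2 hv hζ hs hs0 hgen
  refine ⟨h1, h2, fun μ hμ => ?_, fun τ hτ =>
    mem_inertia_of_forall_apply_eq hℓ hgood.2.2.2 hv hζ hs hs0 hgen hτ⟩
  obtain ⟨τ, hτ, hτμ⟩ := h3 μ hμ
  exact ⟨τ, fun η hη => apply_eq_of_mem_inertia hτ hv hs hs0 hη, hτμ⟩

/-- The exponents of `ℓ`-th roots of unity can be changed freely by an automorphism which is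
trivial on a layer in which `ℓ` is unramified. -/
theorem exists_gal_fixing_cyc {s ℓ : ℕ} (hs : s ∈ levels F M) (hℓ : IsGoodPrime F M ℓ)
    (hsℓ : s.Coprime ℓ) {ζ μ : L} (hζ : IsPrimitiveRoot ζ ℓ) (hμ : IsPrimitiveRoot μ ℓ) :
    ∃ τ : Gal(L/F), (∀ x ∈ cyc F L s, τ x = x) ∧ τ ζ = μ := by
  have hr := mul_mem_levels hs hℓ hsℓ
  have := numberField_cyc (L := L) hr
  have := isGalois_cyc (L := L) hr
  have := isGalois_of_levels (F := F) (L := L) M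
  have hd : ℓ ∣ s * ℓ := dvd_mul_left ℓ s
  have hdiv : s * ℓ / ℓ = s := Nat.mul_div_cancel _ hℓ.1.pos
  obtain ⟨v, hv⟩ := exists_place (K := cyc F L (s * ℓ)) hℓ.1
  set ζ' : cyc F L (s * ℓ) := ⟨ζ, cyc_mono hd (mem_cyc_of_pow_eq_one hζ.pow_eq_one)⟩
  set μ' : cyc F L (s * ℓ) := ⟨μ, cyc_mono hd (mem_cyc_of_pow_eq_one hμ.pow_eq_one)⟩
  have hζ' : IsPrimitiveRoot ζ' ℓ := IsPrimitiveRoot.coe_submonoidClass_iff.mp hζ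
  have hμ' : IsPrimitiveRoot μ' ℓ := IsPrimitiveRoot.coe_submonoidClass_iff.mp hμ
  obtain ⟨τ, hτ, hτζ⟩ := (cyc_ramification hr hℓ.1 hd hv hζ').2.2.1 μ' hμ'
  rw [hdiv] at hτ
  obtain ⟨σ, rfl⟩ := AlgEquiv.restrictNormalHom_surjective (F := F) (K₁ := cyc F L (s * ℓ)) L τ
  have hσ : ∀ x : cyc F L (s * ℓ), ((AlgEquiv.restrictNormalHom (cyc F L (s * ℓ)) σ x :
      cyc F L (s * ℓ)) : L) = σ x := fun x => AlgEquiv.restrictNormal_commutes σ _ x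
  refine ⟨σ, fun x hx => ?_, ?_⟩
  · refine apply_eq_of_mem_cyc (τ' := 1) (fun η hη => ?_) hx
    have h1 := hτ ⟨η, cyc_mono (dvd_mul_right s ℓ) (mem_cyc_of_pow_eq_one hη)⟩ (by ext; exact hη)
    exact (hσ _).symm.trans (congrArg Subtype.val h1)
  · exact (hσ _).symm.trans (congrArg Subtype.val hτζ)

/-- The minimal polynomial is defined over some `F_s` with `s` prime to `ℓ`. Automorphisms fixing
`F_s` carry `ζ` to every primitive `ℓ`-th root of unity, so all of these are roots. -/
theorem minpoly_cycPrimeTo {ℓ : ℕ} (hℓ : IsGoodPrime F M ℓ) {ζ : L} (hζ : IsPrimitiveRoot ζ ℓ) :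
    minpoly (cycPrimeTo F M L ℓ) ζ = Polynomial.cyclotomic ℓ (cycPrimeTo F M L ℓ) := by
  classical
  have : Fact ℓ.Prime := ⟨hℓ.1⟩
  have := charZero_of_algebra F L
  have : CharZero (cycPrimeTo F M L ℓ) := charZero_of_algebra F _
  have := isGalois_of_levels (F := F) (L := L) M
  have hint : IsIntegral (cycPrimeTo F M L ℓ) ζ :=
    IsIntegral.of_pow hℓ.1.pos (by rw [hζ.pow_eq_one]; exact isIntegral_one)
  have haev : Polynomial.aeval ζ (Polynomial.cyclotomic ℓ (cycPrimeTo F M L ℓ)) = 0 := by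
    rw [Polynomial.aeval_def, Polynomial.eval₂_eq_eval_map, Polynomial.map_cyclotomic]
    exact hζ.isRoot_cyclotomic hℓ.1.pos
  have hdvd := minpoly.dvd _ ζ haev
  set p := minpoly (cycPrimeTo F M L ℓ) ζ with hp
  refine (Polynomial.eq_of_monic_of_dvd_of_natDegree_le (minpoly.monic hint)
    (Polynomial.cyclotomic.monic ℓ _) hdvd ?_).symm
  rw [Polynomial.natDegree_cyclotomic, ← hζ.card_primitiveRoots]
  obtain ⟨s, hs, hsℓ, hcoeff⟩ := exists_forall_mem_cyc ℓ p
  set q := p.map (algebraMap (cycPrimeTo F M L ℓ) L) with hq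
  have hq0 : q ≠ 0 := ((minpoly.monic hint).map _).ne_zero
  have hsub : primitiveRoots ℓ L ⊆ q.roots.toFinset := by
    intro μ hμ
    rw [Multiset.mem_toFinset, Polynomial.mem_roots hq0]
    obtain ⟨τ, hτ, hτζ⟩ := exists_gal_fixing_cyc hs hℓ hsℓ hζ ((mem_primitiveRoots hℓ.1.pos).mp hμ)
    have hmap : q.map (τ : L →+* L) = q := by
      ext i
      rw [Polynomial.coeff_map, hq, Polynomial.coeff_map]
      exact hτ _ (hcoeff i)
    have h0 : q.eval ζ = 0 := by
      rw [hq, ← Polynomial.eval₂_eq_eval_map]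
      exact minpoly.aeval _ ζ
    rw [Polynomial.IsRoot, ← hτζ, ← hmap]
    have := Polynomial.eval_map_apply (p := q) (τ : L →+* L) ζ
    rw [h0, map_zero] at this
    exact this
  calc (primitiveRoots ℓ L).card ≤ q.roots.toFinset.card := Finset.card_le_card hsub
    _ ≤ q.roots.card := Multiset.toFinset_card_le _
    _ ≤ q.natDegree := Polynomial.card_roots' q
    _ ≤ p.natDegree := Polynomial.natDegree_map_le

/-- Unlike `exists_gal_fixing_cyc`, one automorphism works for all levels prime to `ℓ` at once, as
is needed to obtain an element of the inertia group at a place of `L`. -/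
theorem exists_gal_fixing {ℓ : ℕ} (hℓ : IsGoodPrime F M ℓ) {ζ μ : L}
    (hζ : IsPrimitiveRoot ζ ℓ) (hμ : IsPrimitiveRoot μ ℓ) :
    ∃ τ : Gal(L/F), (∀ n ∈ levels F M, n.Coprime ℓ → ∀ η : L, η ^ n = 1 → τ η = η) ∧ τ ζ = μ := by
  have := isGalois_of_levels (F := F) (L := L) M
  have : Normal (cycPrimeTo F M L ℓ) L := Normal.tower_top_of_normal F _ L
  have hconj : IsConjRoot (cycPrimeTo F M L ℓ) μ ζ := by
    rw [IsConjRoot, minpoly_cycPrimeTo hℓ hζ, minpoly_cycPrimeTo hℓ hμ]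
  obtain ⟨τ, hτ⟩ := isConjRoot_iff_exists_algEquiv.mp hconj
  refine ⟨τ.restrictScalars F, fun n hn hnℓ η hη => ?_, hτ⟩
  exact τ.commutes ⟨η, IntermediateField.subset_adjoin F _ ⟨n, ⟨hn, hnℓ⟩, hη⟩⟩

end LayerRamification

end

/-! ### The action of `σ_ℓ` and `Frob_ℓ` on roots of unity -/

section
open IsDedekindDomain HeightOneSpectrum WithZero

theorem pow_eq_pow_of_natCast_eq {K : Type*} [Monoid K] {ℓ a b : ℕ} {η : K} (hη : η ^ ℓ = 1)
    (h : (a : ZMod ℓ) = b) : η ^ a = η ^ b := by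
  have h3 := (ZMod.natCast_eq_natCast_iff' _ _ _).mp h
  rw [← Nat.div_add_mod a ℓ, ← Nat.div_add_mod b ℓ, h3, pow_add, pow_mul, hη, one_pow, pow_add,
    pow_mul, hη, one_pow]

namespace LocalData
variable {F : Type*} [Field F] [NumberField F] {M : ℕ} {L : Type*} [Field L] [Algebra F L]
  (D : LocalData F L M) {ℓ : ℕ}

theorem gen_pow_apply {ℓ : ℕ} {u : (ZMod ℓ)ˣ}
    (hu : ∀ η : L, η ^ ℓ = 1 → D.gen ℓ η = η ^ (u : ZMod ℓ).val) (k : ℕ) {η : L} (hη : η ^ ℓ = 1) :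
    (D.gen ℓ ^ k) η = η ^ ((u : ZMod ℓ).val ^ k) := by
  induction k generalizing η with
  | zero => simp
  | succ k ih => rw [pow_succ, AlgEquiv.mul_apply, hu η hη, map_pow, ih hη, ← pow_mul, pow_succ]

variable (hℓ : IsGoodPrime F M ℓ)
include hℓ

theorem gen_mem_inertia : D.gen ℓ ∈ (D.place ℓ).inertia Gal(L/F) := by
  rw [← D.zpowers_gen ℓ hℓ]
  exact Subgroup.mem_zpowers _

theorem gen_apply {n : ℕ} (hn : n.Coprime ℓ) (hn0 : n ≠ 0) {η : L} (hη : η ^ n = 1) :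
    D.gen ℓ η = η := by
  have := D.place_isPrime ℓ hℓ
  have hint : IsIntegral ℤ η := IsIntegral.of_pow (Nat.pos_of_ne_zero hn0) (by
    rw [hη]; exact isIntegral_one)
  set a : 𝓞 L := ⟨η, hint⟩
  have ha : a ^ n = 1 := by ext; exact hη
  have hτa : (D.gen ℓ • a) ^ n = 1 := by rw [← smul_pow', ha, smul_one]
  have := eq_of_pow_eq_one_of_sub_mem (D.place ℓ) hτa ha
    (notMem_of_coprime _ (D.mem_place ℓ hℓ) hn) (D.gen_mem_inertia hℓ a)
  exact congrArg (fun x : 𝓞 L => (x : L)) this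

theorem frob_apply [IsGalois ℚ F] {n : ℕ} (hn : n.Coprime ℓ) (hn0 : n ≠ 0) {η : L}
    (hη : η ^ n = 1) : D.frob ℓ η = η ^ ℓ := by
  have := D.place_isPrime ℓ hℓ
  have hint : IsIntegral ℤ η := IsIntegral.of_pow (Nat.pos_of_ne_zero hn0) (by
    rw [hη]; exact isIntegral_one)
  set a : 𝓞 L := ⟨η, hint⟩
  have ha : a ^ n = 1 := by ext; exact hη
  have hτa : (D.frob ℓ • a) ^ n = 1 := by rw [← smul_pow', ha, smul_one]
  have hc : Nat.card (𝓞 F ⧸ (D.place ℓ).under (𝓞 F)) = ℓ := by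
    refine hℓ.2.2.2.card_quotient hℓ.1 _ ?_
    rw [Ideal.mem_comap, map_natCast]
    exact D.mem_place ℓ hℓ
  have h1 := D.frob_spec ℓ hℓ a
  rw [hc] at h1
  have := eq_of_pow_eq_one_of_sub_mem (D.place ℓ) hτa
    (by rw [← pow_mul, mul_comm, pow_mul, ha, one_pow])
    (notMem_of_coprime _ (D.mem_place ℓ hℓ) hn) h1
  exact congrArg (fun x : 𝓞 L => (x : L)) this

theorem gen_apply_of_mem_cyc {s : ℕ} (hs : s ∈ levels F M) (hsℓ : s.Coprime ℓ) {x : L}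
    (hx : x ∈ cyc F L s) : D.gen ℓ x = x :=
  apply_eq_of_mem_cyc (τ' := 1)
    (fun _ hη => D.gen_apply hℓ hsℓ (levels_ne_zero hs) hη) hx

theorem gen_pow_apply_of_mem_cyc {s : ℕ} (hs : s ∈ levels F M)
    (hsℓ : s.Coprime ℓ) (k : ℕ) {x : L} (hx : x ∈ cyc F L s) : (D.gen ℓ ^ k) x = x := by
  induction k with
  | zero => rfl
  | succ k ih => rw [pow_succ, AlgEquiv.mul_apply, D.gen_apply_of_mem_cyc hℓ hs hsℓ hx, ih]

variable [IsGalois ℚ F] [IsCyclotomicExtension (levels F M) F L]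

/-- The inertia condition is tested on one integer `x` at a time. Each `x` lies in a number field
`F_r`, to which the place contracts and where ramification theory is available. -/
theorem mem_inertia_place {τ : Gal(L/F)}
    (hτ : ∀ n ∈ levels F M, n.Coprime ℓ → ∀ η : L, η ^ n = 1 → τ η = η) :
    τ ∈ (D.place ℓ).inertia Gal(L/F) := by
  have hP := D.place_isPrime ℓ hℓ
  intro x
  obtain ⟨n, hn, hxn⟩ := exists_level (F := F) M (x : L)
  -- The level is enlarged so that `ℓ` divides it and `F_r` contains the `ℓ`-th roots of unity.
  have hr := lcm_mem_levels hn hℓ.mem_levels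
  set r := n.lcm ℓ with hrdef
  have hd : ℓ ∣ r := Nat.dvd_lcm_right n ℓ
  have hxr : (x : L) ∈ cyc F L r := cyc_mono (Nat.dvd_lcm_left n ℓ) hxn
  have := numberField_cyc (L := L) hr
  have := isGalois_cyc (L := L) hr
  let j : 𝓞 (cyc F L r) →+* 𝓞 L := NumberField.RingOfIntegers.mapRingHom (cyc F L r).val
  have hlv : (ℓ : 𝓞 (cyc F L r)) ∈ (D.place ℓ).comap j := by
    rw [Ideal.mem_comap, map_natCast]
    exact D.mem_place ℓ hℓ
  let v : HeightOneSpectrum (𝓞 (cyc F L r)) := ⟨(D.place ℓ).comap j, Ideal.comap_isPrime _ _,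
    fun h => by
      rw [h, Ideal.mem_bot] at hlv
      exact hℓ.1.ne_zero (by exact_mod_cast hlv)⟩
  obtain ⟨ζ, hζ⟩ := exists_primitiveRoot_cyc (L := L) hr hd
  have hres : ∀ y : cyc F L r, ((AlgEquiv.restrictNormalHom (cyc F L r) τ y :
      cyc F L r) : L) = τ y := fun y => AlgEquiv.restrictNormal_commutes τ _ y
  have hin := (cyc_ramification (M := M) hr hℓ.1 hd (v := v) hlv hζ).2.2.2
    (AlgEquiv.restrictNormalHom (cyc F L r) τ) (fun η hη => by
      apply Subtype.ext
      rw [hres]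
      refine hτ _ (div_mem_levels hr hd) (coprime_div hr hℓ.1 hd) _ ?_
      have := congrArg (Subtype.val : cyc F L r → L) hη
      simpa using this)
  have hx' : IsIntegral ℤ (⟨x, hxr⟩ : cyc F L r) := by
    have := x.2
    rw [mem_integralClosure_iff] at this
    exact (isIntegral_algHom_iff ((cyc F L r).val.restrictScalars ℤ)
      (cyc F L r).val.injective).mp this
  obtain ⟨a, ha⟩ : ∃ a : 𝓞 (cyc F L r), (a : cyc F L r) = ⟨x, hxr⟩ := ⟨⟨_, hx'⟩, rfl⟩
  have h1 := hin a
  have h2 : j (AlgEquiv.restrictNormalHom (cyc F L r) τ • a - a) = τ • x - x := by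
    rw [map_sub]
    congr 1
    · ext
      change ((AlgEquiv.restrictNormalHom (cyc F L r) τ (a : cyc F L r) : cyc F L r) : L) = τ x
      rw [hres, ha]
    · ext
      exact congrArg (Subtype.val : cyc F L r → L) ha
  change j _ ∈ D.place ℓ at h1
  rwa [h2] at h1

/-- The generator `σ_ℓ` acts on `ℓ`-th roots of unity through a primitive root modulo `ℓ`. -/
theorem exists_primitive_exponent : ∃ u : (ZMod ℓ)ˣ, Subgroup.zpowers u = ⊤ ∧
    ∀ η : L, η ^ ℓ = 1 → D.gen ℓ η = η ^ (u : ZMod ℓ).val := by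
  have : Fact ℓ.Prime := ⟨hℓ.1⟩
  obtain ⟨ζ, hζ⟩ := exists_primitiveRoot L hℓ.mem_levels
  let χ : Gal(L/F) →* (ZMod ℓ)ˣ := hζ.autToPow F
  have hχ : ∀ τ : Gal(L/F), ζ ^ ((χ τ : (ZMod ℓ)ˣ) : ZMod ℓ).val = τ ζ := hζ.autToPow_spec F
  refine ⟨χ (D.gen ℓ), ?_, fun η hη => ?_⟩
  · rw [eq_top_iff]
    intro c _
    have hcop : Nat.Coprime (c : ZMod ℓ).val ℓ := ZMod.val_coe_unit_coprime c
    -- Every class `c` modulo `ℓ` is the exponent of an automorphism in the inertia group, hence of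
    -- a power of `σ_ℓ`; so the exponent of `σ_ℓ` generates.
    obtain ⟨τ, hτ, hτζ⟩ := exists_gal_fixing hℓ hζ (hζ.pow_of_coprime _ hcop)
    have hmem := D.mem_inertia_place hℓ hτ
    rw [← D.zpowers_gen ℓ hℓ] at hmem
    obtain ⟨i, hi⟩ := hmem
    refine ⟨i, ?_⟩
    have h1 : χ τ = c := by
      apply Units.ext
      apply ZMod.val_injective
      refine hζ.pow_inj (ZMod.val_lt _) (ZMod.val_lt _) ?_
      rw [hχ, hτζ]
    rw [← h1, ← hi]
    exact (map_zpow χ _ _).symm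
  · obtain ⟨i, -, rfl⟩ := hζ.eq_pow_of_pow_eq_one hη
    rw [map_pow, ← hχ, ← pow_mul, ← pow_mul, mul_comm]

/-- `σ_ℓ` fixes the roots of unity of good order prime to `ℓ`, and on `ℓ`-th roots of unity Fermat's
little theorem applies to the exponent. -/
theorem gen_pow_sub_one : D.gen ℓ ^ (ℓ - 1) = 1 := by
  have : Fact ℓ.Prime := ⟨hℓ.1⟩
  obtain ⟨u, -, hu⟩ := D.exists_primitive_exponent hℓ
  ext x
  obtain ⟨n, hn, hxn⟩ := exists_level (F := F) M x
  have hr := lcm_mem_levels hn hℓ.mem_levels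
  have hd : ℓ ∣ n.lcm ℓ := Nat.dvd_lcm_right n ℓ
  refine apply_eq_of_mem_cyc_mul (τ' := 1) (Nat.div_mul_cancel hd) (levels_ne_zero hr)
    (coprime_div hr hℓ.1 hd) (fun η hη => ?_) (fun η hη => ?_)
    (cyc_mono (Nat.dvd_lcm_left n ℓ) hxn)
  · exact D.gen_pow_apply_of_mem_cyc hℓ (div_mem_levels hr hd) (coprime_div hr hℓ.1 hd) _
      (mem_cyc_of_pow_eq_one hη)
  · rw [D.gen_pow_apply hu _ hη, AlgEquiv.one_apply]
    conv_rhs => rw [← pow_one η]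
    refine pow_eq_pow_of_natCast_eq hη ?_
    push_cast
    rw [ZMod.natCast_zmod_val, ZMod.pow_card_sub_one_eq_one u.ne_zero]

end LocalData

end

/-! ### Exponentiation by the group ring and Kolyvagin's identity -/

section GroupRing
variable {F : Type*} [Field F] {L : Type*} [Field L] [Algebra F L]
  (u w : Lˣ) (θ θ' : MonoidAlgebra ℤ Gal(L/F))

theorem gpow_zero : gpow u (0 : MonoidAlgebra ℤ Gal(L/F)) = 1 := by
  simp [gpow]

theorem gpow_add : gpow u (θ + θ') = gpow u θ * gpow u θ' := by
  classical
  rw [gpow, MonoidAlgebra.coeff_add, Finsupp.prod_add_index']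
  · rfl
  · simp
  · intro g m n
    exact zpow_add _ _ _

theorem gpow_single (g : Gal(L/F)) (n : ℤ) :
    gpow u (MonoidAlgebra.single g n) = (g • u) ^ n := by
  rw [gpow, MonoidAlgebra.coeff_single, Finsupp.prod_single_index (zpow_zero _)]

theorem gpow_of (g : Gal(L/F)) : gpow u (MonoidAlgebra.of ℤ _ g) = g • u := by
  rw [MonoidAlgebra.of_apply, gpow_single, zpow_one]

theorem gpow_natCast (n : ℕ) : gpow u ((n : ℕ) : MonoidAlgebra ℤ Gal(L/F)) = u ^ n := by
  rw [MonoidAlgebra.natCast_def, gpow_single]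
  simp

theorem gpow_one : gpow u (1 : MonoidAlgebra ℤ Gal(L/F)) = u := by
  rw [← map_one (MonoidAlgebra.of ℤ Gal(L/F)), gpow_of, one_smul]

theorem gpow_neg : gpow u (-θ) = (gpow u θ)⁻¹ := by
  rw [eq_inv_iff_mul_eq_one, ← gpow_add, neg_add_cancel, gpow_zero]

theorem gpow_sub : gpow u (θ - θ') = gpow u θ / gpow u θ' := by
  rw [sub_eq_add_neg, gpow_add, gpow_neg, div_eq_mul_inv]

theorem gpow_sum {ι : Type*} (s : Finset ι) (f : ι → MonoidAlgebra ℤ Gal(L/F)) :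
    gpow u (∑ i ∈ s, f i) = ∏ i ∈ s, gpow u (f i) := by
  classical
  induction s using Finset.induction_on with
  | empty => simp [gpow_zero]
  | insert i s hi ih => rw [Finset.sum_insert hi, Finset.prod_insert hi, gpow_add, ih]

theorem gpow_mul_units : gpow (u * w) θ = gpow u θ * gpow w θ := by
  rw [gpow, gpow, gpow, ← Finsupp.prod_mul]
  refine Finsupp.prod_congr fun g _ => ?_
  rw [smul_mul', mul_zpow]

theorem gpow_one_units : gpow (1 : Lˣ) θ = 1 := by
  have := gpow_mul_units 1 1 θ
  rw [mul_one] at this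
  exact left_eq_mul.mp this

theorem gpow_inv_units : gpow (u⁻¹) θ = (gpow u θ)⁻¹ := by
  rw [eq_inv_iff_mul_eq_one, ← gpow_mul_units, inv_mul_cancel, gpow_one_units]

theorem gpow_div_units : gpow (u / w) θ = gpow u θ / gpow w θ := by
  rw [div_eq_mul_inv, gpow_mul_units, gpow_inv_units, div_eq_mul_inv]

theorem gpow_pow_units (n : ℕ) : gpow (u ^ n) θ = gpow u θ ^ n := by
  induction n with
  | zero => simp [gpow_one_units]
  | succ n ih => rw [pow_succ, gpow_mul_units, ih, pow_succ]

theorem gpow_mul : gpow u (θ * θ') = gpow (gpow u θ') θ := by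
  induction θ using MonoidAlgebra.induction_linear with
  | zero => rw [zero_mul, gpow_zero, gpow_zero]
  | add a b ha hb => rw [add_mul, gpow_add, gpow_add, ha, hb]
  | single g n =>
    induction θ' using MonoidAlgebra.induction_linear with
    | zero => rw [mul_zero, gpow_zero, gpow_one_units]
    | add a b ha hb => rw [mul_add, gpow_add, gpow_add, gpow_mul_units, ha, hb]
    | single h m =>
      have : g • ((h • u) ^ m) = (g • h • u) ^ m :=
        map_zpow (MulDistribMulAction.toMonoidHom Lˣ g) _ m
      rw [MonoidAlgebra.single_mul_single, gpow_single, gpow_single, gpow_single, mul_smul,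
        this, ← zpow_mul, mul_comm m n]

theorem groupRing_mul_comm [NumberField F] (M : ℕ) [IsCyclotomicExtension (levels F M) F L] :
    θ * θ' = θ' * θ := by
  induction θ using MonoidAlgebra.induction_linear with
  | zero => rw [zero_mul, mul_zero]
  | add a b ha hb => rw [add_mul, mul_add, ha, hb]
  | single g n =>
    induction θ' using MonoidAlgebra.induction_linear with
    | zero => rw [zero_mul, mul_zero]
    | add a b ha hb => rw [add_mul, mul_add, ha, hb]
    | single h m =>
      rw [MonoidAlgebra.single_mul_single, MonoidAlgebra.single_mul_single, gal_mul_comm M g h,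
        mul_comm n m]

theorem gpow_mem_cyc {r : ℕ} (hN : Normal F (cyc F L r)) (hu : (u : L) ∈ cyc F L r) :
    ((gpow u θ : Lˣ) : L) ∈ cyc F L r := by
  induction θ using MonoidAlgebra.induction_linear with
  | zero => rw [gpow_zero]; exact one_mem _
  | add a b ha hb => rw [gpow_add, Units.val_mul]; exact mul_mem ha hb
  | single g n =>
    rw [gpow_single, Units.val_zpow_eq_zpow_val]
    refine zpow_mem ?_ n
    have h1 : ((AlgEquiv.restrictNormal g (cyc F L r) ⟨u, hu⟩ : cyc F L r) : L) = g u :=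
      AlgEquiv.restrictNormal_commutes g (cyc F L r) ⟨u, hu⟩
    change g (u : L) ∈ _
    rw [← h1]
    exact Subtype.mem _

end GroupRing

namespace LocalData
variable {F : Type*} [Field F] [NumberField F] {M : ℕ} {L : Type*} [Field L] [Algebra F L]
  (D : LocalData F L M)

variable [IsCyclotomicExtension (levels F M) F L]

theorem Nr'_eq {r ℓ : ℕ} (hr : r ≠ 0) (hℓ : ℓ.Prime) (hd : ℓ ∣ r) :
    D.Nr' r = D.N' ℓ * D.Nr' (r / ℓ) := by
  have hperm : r.primeFactorsList.Perm (ℓ :: (r / ℓ).primeFactorsList) := by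
    obtain ⟨s, rfl⟩ := hd
    have hs : s ≠ 0 := right_ne_zero_of_mul hr
    rw [Nat.mul_div_cancel_left _ hℓ.pos]
    have := Nat.perm_primeFactorsList_mul hℓ.ne_zero hs
    rwa [Nat.primeFactorsList_prime hℓ, List.singleton_append] at this
  rw [Nr', Nr', (hperm.map D.N').prod_eq', List.map_cons, List.prod_cons]
  exact List.pairwise_of_forall fun a b => groupRing_mul_comm a b M

variable {ℓ : ℕ} (hℓ : IsGoodPrime F M ℓ)
include hℓ

theorem N'_mul_sub_one [IsGalois ℚ F] :
    D.N' ℓ * (D.sig ℓ - 1) = ((ℓ - 1 : ℕ) : MonoidAlgebra ℤ Gal(L/F)) - D.N ℓ := by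
  have hpow : D.sig ℓ ^ (ℓ - 1) = 1 := by
    rw [sig, ← map_pow, D.gen_pow_sub_one hℓ, map_one]
  -- Summation by parts, valid without any relation on `σ_ℓ`. For `n = ℓ - 2`, the relation `σ_ℓ ^
  -- (ℓ - 1) = 1` makes the last term of the sum cancel the `+ 1`.
  have key : ∀ n : ℕ, (∑ i ∈ Finset.Icc 1 n, (i : MonoidAlgebra ℤ Gal(L/F)) * D.sig ℓ ^ i) *
      (D.sig ℓ - 1) = (n + 1 : ℕ) * D.sig ℓ ^ (n + 1) - ∑ i ∈ Finset.range (n + 2), D.sig ℓ ^ i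
        + 1 := by
    intro n
    induction n with
    | zero => simp [Finset.sum_range_succ]
    | succ n ih =>
      rw [Finset.sum_Icc_succ_top (by omega), add_mul, ih, Finset.sum_range_succ _ (n + 2)]
      push_cast
      rw [mul_sub, mul_assoc, ← pow_succ]
      noncomm_ring
  obtain ⟨n, hn⟩ : ∃ n, ℓ = n + 2 := ⟨ℓ - 2, by have := hℓ.1.two_le; omega⟩
  have h1 : ℓ - 2 = n := by omega
  have h2 : ℓ - 1 = n + 1 := by omega
  rw [N', N, h1, h2, key, ← h2, hpow, h2, Finset.sum_range_succ, ← h2, hpow, h2]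
  push_cast
  noncomm_ring

end LocalData

/-! ### Hilbert 90 and uniqueness of `M`-th roots -/

section HilbertNinety
variable {F E : Type*} [Field F] [Field E] [Algebra F E] [FiniteDimensional F E] [IsGalois F E]
  {M : ℕ}

theorem units_eq_of_pow_eq (htors : ∀ x : E, x ^ M = 1 → x = 1) {x y : Eˣ} (h : x ^ M = y ^ M) :
    x = y := by
  rw [← div_eq_one]
  apply Units.ext
  apply htors
  rw [← Units.val_pow_eq_pow_val, div_pow, h, div_self', Units.val_one]

/-- If `E` has no nontrivial `M`-th roots of unity, then the Galois invariants of `Eˣ / Eˣ ^ M`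
come from `Fˣ`. -/
theorem exists_eq_map_mul_pow (htors : ∀ x : E, x ^ M = 1 → x = 1) (u : Eˣ)
    (h : ∀ τ : Gal(E/F), ∃ β : Eˣ, (τ • u) / u = β ^ M) :
    ∃ (a : Fˣ) (b : Eˣ), u = Units.map (algebraMap F E : F →* E) a * b ^ M := by
  choose f hf using h
  have hpow : ∀ (τ : Gal(E/F)) (x : Eˣ), τ • (x ^ M) = (τ • x) ^ M := fun τ x => smul_pow' τ x M
  have hdiv : ∀ (τ : Gal(E/F)) (x y : Eˣ), τ • (x / y) = (τ • x) / (τ • y) :=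
    fun τ x y => smul_div' τ x y
  -- The `M`-th powers of the `f τ` form a coboundary; uniqueness of `M`-th roots makes `f` itself a
  -- cocycle, which Hilbert 90 then splits.
  have hcoc : groupCohomology.IsMulCocycle₁ f := by
    intro g k
    apply units_eq_of_pow_eq htors
    rw [mul_pow, ← hpow, ← hf, ← hf, ← hf, hdiv, mul_smul]
    simp
  obtain ⟨b, hb⟩ := groupCohomology.isMulCoboundary₁_of_isMulCocycle₁_of_aut_to_units f hcoc
  have hfix : ∀ τ : Gal(E/F), τ • (u / b ^ M) = u / b ^ M := by
    intro τ
    rw [hdiv, hpow, div_eq_div_iff_div_eq_div, hf, ← div_pow, hb]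
  have hmem : ((u / b ^ M : Eˣ) : E) ∈ (⊥ : IntermediateField F E) :=
    (IsGalois.mem_bot_iff_fixed _).mpr fun τ => congrArg Units.val (hfix τ)
  obtain ⟨a, ha⟩ := IntermediateField.mem_bot.mp hmem
  have ha0 : a ≠ 0 := by
    rintro rfl
    rw [map_zero] at ha
    exact (Units.ne_zero _) ha.symm
  refine ⟨Units.mk0 a ha0, b, ?_⟩
  rw [← div_eq_iff_eq_mul]
  apply Units.ext
  exact ha.symm

/-- The `M`-th power of `b' / b` lies in `F`. As `M`-th roots are unique, `b' / b` is itself Galois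
invariant. -/
theorem exists_eq_mul_pow_of_map_mul_pow_eq (htors : ∀ x : E, x ^ M = 1 → x = 1) {a a' : Fˣ}
    {b b' : Eˣ} (h : Units.map (algebraMap F E : F →* E) a * b ^ M =
      Units.map (algebraMap F E : F →* E) a' * b' ^ M) : ∃ c : Fˣ, a = a' * c ^ M := by
  have hw : (b' / b) ^ M = Units.map (algebraMap F E : F →* E) (a / a') := by
    rw [div_pow, map_div, div_eq_div_iff_mul_eq_mul, mul_comm, mul_comm _ (b ^ M), mul_comm (b ^ M), h]
  have hfix : ∀ τ : Gal(E/F), τ • (b' / b) = b' / b := by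
    intro τ
    apply units_eq_of_pow_eq htors
    rw [← smul_pow', hw]
    apply Units.ext
    exact τ.commutes _
  have hmem : ((b' / b : Eˣ) : E) ∈ (⊥ : IntermediateField F E) :=
    (IsGalois.mem_bot_iff_fixed _).mpr fun τ => congrArg Units.val (hfix τ)
  obtain ⟨c, hc⟩ := IntermediateField.mem_bot.mp hmem
  have hc0 : c ≠ 0 := by
    rintro rfl
    rw [map_zero] at hc
    exact (Units.ne_zero _) hc.symm
  refine ⟨Units.mk0 c hc0, ?_⟩
  rw [← div_eq_iff_eq_mul']
  apply Units.map_injective (f := (algebraMap F E : F →* E)) (algebraMap F E).injective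
  rw [← hw, map_pow]
  congr 1
  apply Units.ext
  exact hc.symm

end HilbertNinety

/-- A real embedding reduces this to the injectivity of odd powers on `ℝ`. -/
theorem eq_one_of_pow_eq_one_of_isTotallyReal {F : Type*} [Field F] [NumberField F]
    [NumberField.IsTotallyReal F] {M : ℕ} (hM : Odd M) {y : F} (h : y ^ M = 1) : y = 1 := by
  obtain ⟨w⟩ : Nonempty (NumberField.InfinitePlace F) := inferInstance
  let φ := NumberField.InfinitePlace.embedding_of_isReal (NumberField.IsTotallyReal.isReal w)
  apply φ.injective
  apply hM.pow_injective
  simp only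
  rw [← map_pow, h, map_one, one_pow]

namespace LocalData
variable {F : Type*} [Field F] [NumberField F] [IsGalois ℚ F] {M : ℕ} {L : Type*} [Field L]
  [Algebra F L] (D : LocalData F L M) [IsCyclotomicExtension (levels F M) F L]

/-- The group `Gal(F_r / F)` is generated by the `σ_ℓ` with `ℓ ∣ r`. -/
theorem exists_mem_subgroup_eq_on_cyc {r : ℕ} (hr : r ∈ levels F M) (H : Subgroup Gal(L/F))
    (hH : ∀ ℓ : ℕ, ℓ.Prime → ℓ ∣ r → D.gen ℓ ∈ H) (τ : Gal(L/F)) :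
    ∃ τ' ∈ H, ∀ x ∈ cyc F L r, τ x = τ' x := by
  induction r using Nat.strong_induction_on with
  | _ r ih =>
    by_cases hr1 : r = 1
    · subst hr1
      refine ⟨1, one_mem _, fun x hx => apply_eq_of_mem_cyc (fun ζ hζ => ?_) hx⟩
      rw [pow_one] at hζ
      rw [hζ, map_one, map_one]
    set ℓ := r.minFac
    have hp : ℓ.Prime := Nat.minFac_prime hr1
    have hd : ℓ ∣ r := Nat.minFac_dvd r
    have hℓ := hr.2 ℓ hp hd
    have : Fact ℓ.Prime := ⟨hp⟩
    have hs := div_mem_levels hr hd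
    have hsℓ := coprime_div hr hp hd
    obtain ⟨τ₁, hτ₁, h1⟩ := ih (r / ℓ)
      (Nat.div_lt_self (Nat.pos_of_ne_zero (levels_ne_zero hr)) hp.one_lt) hs
      fun q hq hqd => hH q hq (hqd.trans (Nat.div_dvd_of_dvd hd))
    obtain ⟨ζ, hζ⟩ := exists_primitiveRoot L (levels_of_dvd hr hd)
    obtain ⟨u, hu, hgen⟩ := D.exists_primitive_exponent hℓ
    -- By induction `τ₁` agrees with `τ` on `F_{r/ℓ}`. The remaining discrepancy on `ℓ`-th roots of
    -- unity is corrected by a power of `σ_ℓ`, which does not affect `F_{r/ℓ}`.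
    let c := hζ.autToPow F (τ₁⁻¹ * τ)
    have hc : ζ ^ (c : ZMod ℓ).val = (τ₁⁻¹ * τ) ζ := hζ.autToPow_spec F _
    have hcu : c ∈ Subgroup.zpowers u := by rw [hu]; trivial
    obtain ⟨k, hk⟩ := (mem_powers_iff_mem_zpowers).mpr hcu
    refine ⟨τ₁ * D.gen ℓ ^ k, mul_mem hτ₁ (pow_mem (hH ℓ hp hd) k), fun x hx => ?_⟩
    refine apply_eq_of_mem_cyc_mul (Nat.div_mul_cancel hd) (levels_ne_zero hr) hsℓ
      (fun η hη => ?_) (fun η hη => ?_) hx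
    · have hm := mem_cyc_of_pow_eq_one (F := F) hη
      rw [AlgEquiv.mul_apply, D.gen_pow_apply_of_mem_cyc hℓ hs hsℓ k hm]
      exact h1 η hm
    · obtain ⟨i, -, rfl⟩ := hζ.eq_pow_of_pow_eq_one hη
      rw [map_pow, map_pow]
      congr 1
      rw [AlgEquiv.mul_apply, D.gen_pow_apply hgen k hζ.pow_eq_one]
      have h2 : ζ ^ (u : ZMod ℓ).val ^ k = ζ ^ (c : ZMod ℓ).val := by
        refine pow_eq_pow_of_natCast_eq hζ.pow_eq_one ?_
        push_cast
        rw [ZMod.natCast_zmod_val, ZMod.natCast_zmod_val, ← hk]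
        simp
      rw [h2, hc, AlgEquiv.mul_apply, ← AlgEquiv.mul_apply, mul_inv_cancel, AlgEquiv.one_apply]

variable [NumberField.IsTotallyReal F]

include D in
-- Good primes are prime to `M`, so every `σ_ℓ` fixes the `M`-th roots of unity. Hence those in
-- `F_r` lie in `F`, which is totally real.
theorem eq_one_of_pow_eq_one (hM : Odd M) {r : ℕ} (hr : r ∈ levels F M) {x : L}
    (hx : x ∈ cyc F L r) (h : x ^ M = 1) : x = 1 := by
  have := isGalois_of_levels (F := F) (L := L) M
  have hM0 : M ≠ 0 := by rintro rfl; exact absurd hM (by decide)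
  have hfix : ∀ τ : Gal(L/F), τ x = x := by
    intro τ
    obtain ⟨τ', hτ', h1⟩ := D.exists_mem_subgroup_eq_on_cyc hr (MulAction.stabilizer Gal(L/F) x)
      (fun ℓ hℓ hd => D.gen_apply (hr.2 ℓ hℓ hd) (hr.2 ℓ hℓ hd).coprime hM0 h) τ
    rw [h1 x hx]
    exact hτ'
  obtain ⟨y, rfl⟩ := IntermediateField.mem_bot.mp ((InfiniteGalois.mem_bot_iff_fixed x).mpr hfix)
  rw [← map_pow] at h
  have hy : y ^ M = 1 := (algebraMap F L).injective (by rw [h, map_one])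
  rw [eq_one_of_pow_eq_one_of_isTotallyReal hM hy, map_one]

end LocalData

theorem exists_units_eq_of_le {R : Type*} [Ring R] {A B : Subring R} (h : A ≤ B) (u : Aˣ) :
    ∃ w : Bˣ, ((w : B) : R) = ((u : A) : R) :=
  ⟨Units.map (Subring.inclusion h : A →* B) u, rfl⟩

/-! ### Units of `𝓞_r` and the Galois action -/

section IntRing
variable {F : Type*} [Field F] {L : Type*} [Field L] [Algebra F L] {r : ℕ}

theorem intRing_mono {s : ℕ} (h : s ∣ r) : intRing F L s ≤ intRing F L r :=
  fun _ hx => ⟨cyc_mono h hx.1, hx.2⟩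

theorem intUnit_injective : Function.Injective (intUnit F L r) :=
  Units.map_injective Subtype.val_injective

theorem intUnit_mul (u w : (intRing F L r)ˣ) :
    intUnit F L r (u * w) = intUnit F L r u * intUnit F L r w := map_mul (Units.map _) u w

theorem intUnit_inv (u : (intRing F L r)ˣ) : intUnit F L r u⁻¹ = (intUnit F L r u)⁻¹ :=
  map_inv (Units.map _) u

theorem intUnit_zpow (u : (intRing F L r)ˣ) (n : ℤ) :
    intUnit F L r (u ^ n) = intUnit F L r u ^ n := map_zpow (Units.map _) u n

theorem intUnit_mem_cyc (u : (intRing F L r)ˣ) : ((intUnit F L r u : Lˣ) : L) ∈ cyc F L r :=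
  (u : intRing F L r).2.1

theorem exists_intUnit_eq_of_dvd {s : ℕ} (h : s ∣ r) (u : (intRing F L s)ˣ) :
    ∃ w : (intRing F L r)ˣ, intUnit F L r w = intUnit F L s u := by
  obtain ⟨w, hw⟩ := exists_units_eq_of_le (intRing_mono h) u
  exact ⟨w, Units.ext hw⟩

/-- A root of an integral unit is integral, and so is its inverse. -/
theorem exists_intUnit_eq_of_pow {n : ℕ} (hn : n ≠ 0) {β : Lˣ} (hβ : (β : L) ∈ cyc F L r)
    {u : (intRing F L r)ˣ} (h : β ^ n = intUnit F L r u) : ∃ ρ, intUnit F L r ρ = β := by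
  have h1 : IsIntegral ℤ (β : L) := by
    refine IsIntegral.of_pow (Nat.pos_of_ne_zero hn) ?_
    rw [← Units.val_pow_eq_pow_val, h]
    exact (u : intRing F L r).2.2
  have h2 : IsIntegral ℤ ((β⁻¹ : Lˣ) : L) := by
    refine IsIntegral.of_pow (Nat.pos_of_ne_zero hn) ?_
    rw [← Units.val_pow_eq_pow_val, inv_pow, h, ← intUnit_inv]
    exact ((u⁻¹ : (intRing F L r)ˣ) : intRing F L r).2.2
  refine ⟨⟨⟨β, hβ, h1⟩, ⟨(β⁻¹ : Lˣ), ?_, h2⟩, ?_, ?_⟩, ?_⟩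
  · change ((β⁻¹ : Lˣ) : L) ∈ cyc F L r
    rw [Units.val_inv_eq_inv_val]
    exact inv_mem hβ
  · apply Subtype.ext; exact β.mul_inv
  · apply Subtype.ext; exact β.inv_mul
  · exact Units.ext rfl

theorem gal_apply_mem_cyc (hN : Normal F (cyc F L r)) (g : Gal(L/F)) {x : L}
    (hx : x ∈ cyc F L r) : g x ∈ cyc F L r := by
  have h1 : ((AlgEquiv.restrictNormal g (cyc F L r) ⟨x, hx⟩ : cyc F L r) : L) = g x :=
    AlgEquiv.restrictNormal_commutes g (cyc F L r) ⟨x, hx⟩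
  rw [← h1]
  exact Subtype.mem _

/-- The action of the Galois group on `𝓞_r`. -/
def intRingMap (hN : Normal F (cyc F L r)) (g : Gal(L/F)) : intRing F L r →+* intRing F L r :=
  ((g : L →+* L).comp (intRing F L r).subtype).codRestrict (intRing F L r) fun x =>
    ⟨gal_apply_mem_cyc hN g x.2.1, (show IsIntegral ℤ (x : L) from x.2.2).map
      ((g : L →+* L).toIntAlgHom)⟩

theorem intUnit_map_intRingMap (hN : Normal F (cyc F L r)) (g : Gal(L/F))
    (u : (intRing F L r)ˣ) :
    intUnit F L r (Units.map (intRingMap hN g : intRing F L r →* intRing F L r) u) =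
      g • intUnit F L r u := Units.ext rfl

/-- A Galois-stable subgroup of `𝓞_rˣ` is stable under the group ring. -/
theorem exists_mem_intUnit_eq_gpow (hN : Normal F (cyc F L r)) (H : Subgroup (intRing F L r)ˣ)
    (hH : ∀ (g : Gal(L/F)), ∀ u ∈ H,
      Units.map (intRingMap hN g : intRing F L r →* intRing F L r) u ∈ H)
    {u : (intRing F L r)ˣ} (hu : u ∈ H) (θ : MonoidAlgebra ℤ Gal(L/F)) :
    ∃ w ∈ H, intUnit F L r w = gpow (intUnit F L r u) θ := by
  induction θ using MonoidAlgebra.induction_linear with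
  | zero => exact ⟨1, one_mem _, by rw [gpow_zero]; exact map_one (Units.map _)⟩
  | add a b ha hb =>
    obtain ⟨x, hx, hxa⟩ := ha
    obtain ⟨y, hy, hyb⟩ := hb
    exact ⟨x * y, mul_mem hx hy, by rw [intUnit_mul, gpow_add, hxa, hyb]⟩
  | single g n =>
    exact ⟨_, zpow_mem (hH g u hu) n, by
      rw [intUnit_zpow, intUnit_map_intRingMap, gpow_single]⟩

theorem exists_intUnit_eq_gpow (hN : Normal F (cyc F L r)) (u : (intRing F L r)ˣ)
    (θ : MonoidAlgebra ℤ Gal(L/F)) : ∃ w, intUnit F L r w = gpow (intUnit F L r u) θ := by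
  obtain ⟨w, -, hw⟩ := exists_mem_intUnit_eq_gpow hN ⊤ (fun _ _ _ => trivial)
    (Subgroup.mem_top u) θ
  exact ⟨w, hw⟩

end IntRing

theorem smul_units_div {F L : Type*} [Field F] [Field L] [Algebra F L] (τ : Gal(L/F)) (x y : Lˣ) :
    τ • (x / y) = (τ • x) / (τ • y) := smul_div' τ x y

theorem smul_units_pow {F L : Type*} [Field F] [Field L] [Algebra F L] (τ : Gal(L/F)) (x : Lˣ)
    (n : ℕ) : τ • (x ^ n) = (τ • x) ^ n := smul_pow' τ x n

/-! ### Derivatives of the Euler system and the Kolyvagin classes -/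

namespace LocalData
variable {F : Type*} [Field F] [NumberField F] {M : ℕ} {L : Type*} [Field L]
  [Algebra F L] (D : LocalData F L M) (ξ : ∀ r : ℕ, (intRing F L r)ˣ)

/-- The derivative `ξ_r ^ N'_r`. -/
def derived (r : ℕ) : Lˣ := gpow (intUnit F L r (ξ r)) (D.Nr' r)

variable [IsCyclotomicExtension (levels F M) F L] {r : ℕ} (hr : r ∈ levels F M)
include hr

theorem derived_mem_cyc : ((D.derived ξ r : Lˣ) : L) ∈ cyc F L r :=
  gpow_mem_cyc _ _ (isGalois_cyc hr).to_normal (intUnit_mem_cyc _)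

variable {ℓ : ℕ} (hℓ : ℓ.Prime) (hd : ℓ ∣ r)

omit hr in
theorem gpow_Nr'_mul_sub_one :
    gpow (intUnit F L r (ξ r)) (D.Nr' r * (D.sig ℓ - 1)) =
      (D.gen ℓ • D.derived ξ r) / D.derived ξ r := by
  rw [groupRing_mul_comm _ _ M, gpow_mul, gpow_sub, gpow_one, sig, gpow_of]
  rfl

omit hr in
-- Writing `ℓ - Frob_ℓ` as `(ℓ - 1) - (Frob_ℓ - 1)` isolates a factor whose exponent is divisible by
-- `M` at good primes.
theorem gpow_Nr'_mul_sub_frob (hℓ : ℓ ≠ 0) :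
    gpow (intUnit F L r (ξ r)) (D.Nr' r * ((ℓ : MonoidAlgebra ℤ Gal(L/F)) - D.Fr ℓ)) =
      D.derived ξ r ^ (ℓ - 1) / ((D.frob ℓ • D.derived ξ r) / D.derived ξ r) := by
  rw [groupRing_mul_comm _ _ M, gpow_mul, gpow_sub, gpow_natCast, Fr, gpow_of]
  change D.derived ξ r ^ ℓ / (D.frob ℓ • D.derived ξ r) = _
  rw [div_div_eq_mul_div, ← pow_succ, Nat.sub_add_cancel (Nat.pos_of_ne_zero hℓ)]

variable {ξ} (hξ : D.IsEulerSystem ξ) [IsGalois ℚ F]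
include hξ hℓ hd

/-- Split off `N'_ℓ`, apply `N'_ℓ (σ_ℓ - 1) = (ℓ - 1) - N_ℓ`, and replace `ξ_r ^ N_ℓ` by the norm
relation. This formula gives both the Galois invariance of the derivative modulo `M`-th powers and
the comparison of the two roots. -/
theorem gen_smul_derived_div :
    (D.gen ℓ • D.derived ξ r) / D.derived ξ r =
      gpow (intUnit F L r (ξ r)) (D.Nr' (r / ℓ)) ^ (ℓ - 1) /
        ((D.frob ℓ • D.derived ξ (r / ℓ)) / D.derived ξ (r / ℓ)) := by
  have hgood := hr.2 ℓ hℓ hd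
  rw [← D.gpow_Nr'_mul_sub_one ξ, D.Nr'_eq (levels_ne_zero hr) hℓ hd,
    groupRing_mul_comm (D.N' ℓ) _ M, mul_assoc, D.N'_mul_sub_one hgood, gpow_mul, gpow_sub,
    gpow_natCast, hξ.norm_rel r hr ℓ hℓ hd, gpow_div_units, gpow_pow_units, ← gpow_mul,
    groupRing_mul_comm _ (D.Fr ℓ - 1) M, gpow_mul, gpow_sub, gpow_one, Fr, gpow_of]
  rfl

omit hℓ hd in
theorem exists_pow_eq_smul_derived_div (τ : Gal(L/F)) :
    ∃ β : Lˣ, (β : L) ∈ cyc F L r ∧ (τ • D.derived ξ r) / D.derived ξ r = β ^ M := by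
  induction r using Nat.strong_induction_on generalizing τ with
  | _ r ih =>
    have hN := (isGalois_cyc (L := L) hr).to_normal
    -- The automorphisms with the required property form a subgroup, so it is enough to treat the
    -- generators `σ_ℓ` with `ℓ ∣ r`.
    let H : Subgroup Gal(L/F) :=
      { carrier := {τ | ∃ β : Lˣ, (β : L) ∈ cyc F L r ∧
          (τ • D.derived ξ r) / D.derived ξ r = β ^ M}
        mul_mem' := by
          rintro σ τ ⟨β, hβ, hσ⟩ ⟨γ, hγ, hτ⟩
          refine ⟨(σ • γ) * β, ?_, ?_⟩
          · rw [Units.val_mul]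
            exact mul_mem (gal_apply_mem_cyc hN σ hγ) hβ
          · rw [mul_pow, ← smul_units_pow, ← hτ, ← hσ, smul_units_div, mul_smul]
            simp
        one_mem' := ⟨1, one_mem _, by simp⟩
        inv_mem' := by
          rintro τ ⟨β, hβ, hτ⟩
          refine ⟨(τ⁻¹ • β)⁻¹, ?_, ?_⟩
          · rw [Units.val_inv_eq_inv_val]
            exact inv_mem (gal_apply_mem_cyc hN τ⁻¹ hβ)
          · rw [inv_pow, ← smul_units_pow, ← hτ, smul_units_div, inv_smul_smul, inv_div] }
    obtain ⟨τ', ⟨β, hβ, hτ'⟩, heq⟩ := D.exists_mem_subgroup_eq_on_cyc hr H (fun ℓ hℓ hd => by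
      have hs := div_mem_levels hr hd
      obtain ⟨β, hβ, h1⟩ := ih (r / ℓ)
        (Nat.div_lt_self (Nat.pos_of_ne_zero (levels_ne_zero hr)) hℓ.one_lt) hs (D.frob ℓ)
      obtain ⟨k, hk⟩ := (hr.2 ℓ hℓ hd).dvd_sub_one
      -- Here `ℓ - 1 = M * k`, and `β` comes from level `r / ℓ` and the automorphism `Frob_ℓ`; this
      -- is why the induction is over all automorphisms.
      refine ⟨gpow (intUnit F L r (ξ r)) (D.Nr' (r / ℓ)) ^ k / β, ?_, ?_⟩
      · rw [Units.val_div_eq_div_val, Units.val_pow_eq_pow_val]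
        exact div_mem (pow_mem (gpow_mem_cyc _ _ hN (intUnit_mem_cyc _)) k)
          (cyc_mono (Nat.div_dvd_of_dvd hd) hβ)
      · rw [D.gen_smul_derived_div hr hℓ hd hξ, h1, hk, div_pow, ← pow_mul, mul_comm k]) τ
    refine ⟨β, hβ, ?_⟩
    rw [← hτ']
    congr 1
    exact Units.ext (heq _ (D.derived_mem_cyc ξ hr))

end LocalData

theorem exists_units_cyc_eq {F : Type*} [Field F] {L : Type*} [Field L] [Algebra F L] {r : ℕ}
    {u : Lˣ} (hu : (u : L) ∈ cyc F L r) : ∃ w : (cyc F L r)ˣ, ((w : cyc F L r) : L) = u :=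
  ⟨Units.mk0 ⟨u, hu⟩ fun h => u.ne_zero (congrArg Subtype.val h), rfl⟩

namespace LocalData
variable {F : Type*} [Field F] [NumberField F] [IsGalois ℚ F] [NumberField.IsTotallyReal F] {M : ℕ}
  {L : Type*} [Field L] [Algebra F L] (D : LocalData F L M) (ξ : ∀ r : ℕ, (intRing F L r)ˣ)
  [IsCyclotomicExtension (levels F M) F L] (hM : Odd M) {r : ℕ} (hr : r ∈ levels F M)
include hM hr D

theorem units_eq_of_pow_eq {x y : Lˣ} (hx : (x : L) ∈ cyc F L r) (hy : (y : L) ∈ cyc F L r)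
    (h : x ^ M = y ^ M) : x = y := by
  rw [← div_eq_one]
  apply Units.ext
  apply D.eq_one_of_pow_eq_one hM hr
  · rw [Units.val_div_eq_div_val]
    exact div_mem hx hy
  · rw [← Units.val_pow_eq_pow_val, div_pow, h, div_self', Units.val_one]

theorem cyc_eq_one_of_pow_eq_one (x : cyc F L r) (h : x ^ M = 1) : x = 1 :=
  Subtype.ext (D.eq_one_of_pow_eq_one hM hr x.2 (by
    rw [← IntermediateField.coe_pow, h, IntermediateField.coe_one]))

theorem exists_derived_eq (hξ : D.IsEulerSystem ξ) :
    ∃ (a : Fˣ) (b : Lˣ), (b : L) ∈ cyc F L r ∧ D.derived ξ r = baseUnit F L a * b ^ M := by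
  have := isGalois_cyc (L := L) hr
  have := numberField_cyc (L := L) hr
  have := isGalois_of_levels (F := F) (L := L) M
  have : FiniteDimensional F (cyc F L r) := Module.Finite.of_restrictScalars_finite ℚ _ _
  obtain ⟨u, hu⟩ := exists_units_cyc_eq (D.derived_mem_cyc ξ hr)
  obtain ⟨a, b, hab⟩ := exists_eq_map_mul_pow (F := F) (D.cyc_eq_one_of_pow_eq_one hM hr) u
    (fun τ => by
      obtain ⟨τ', rfl⟩ := AlgEquiv.restrictNormalHom_surjective (F := F) (K₁ := cyc F L r) L τ
      obtain ⟨β, hβ, h⟩ := D.exists_pow_eq_smul_derived_div hr hξ τ'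
      obtain ⟨w, hw⟩ := exists_units_cyc_eq hβ
      refine ⟨w, Units.ext (Subtype.ext ?_)⟩
      have h1 := congrArg Units.val h
      rw [Units.val_div_eq_div_val, Units.val_pow_eq_pow_val] at h1 ⊢
      rw [IntermediateField.coe_div, IntermediateField.coe_pow, hw, hu, ← h1]
      congr 1
      change ((AlgEquiv.restrictNormal τ' (cyc F L r) (u : cyc F L r) : cyc F L r) : L) = τ' _
      rw [← hu]
      exact AlgEquiv.restrictNormal_commutes τ' (cyc F L r) u)
  refine ⟨a, Units.map (algebraMap (cyc F L r) L : cyc F L r →* L) b, Subtype.mem (b : cyc F L r), ?_⟩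
  apply Units.ext
  have h1 := congrArg (fun z : (cyc F L r)ˣ => ((z : cyc F L r) : L)) hab
  simp only [hu] at h1
  rw [h1]
  simp only [Units.val_mul, Units.val_pow_eq_pow_val]
  rfl

theorem exists_eq_mul_pow_of_baseUnit {a a' : Fˣ} {b b' : Lˣ} (hb : (b : L) ∈ cyc F L r)
    (hb' : (b' : L) ∈ cyc F L r) (h : baseUnit F L a * b ^ M = baseUnit F L a' * b' ^ M) :
    ∃ c : Fˣ, a = a' * c ^ M := by
  have := isGalois_cyc (L := L) hr
  have := numberField_cyc (L := L) hr
  have : FiniteDimensional F (cyc F L r) := Module.Finite.of_restrictScalars_finite ℚ _ _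
  obtain ⟨w, hw⟩ := exists_units_cyc_eq hb
  obtain ⟨w', hw'⟩ := exists_units_cyc_eq hb'
  refine exists_eq_mul_pow_of_map_mul_pow_eq (D.cyc_eq_one_of_pow_eq_one hM hr) (b := w) (b' := w') ?_
  apply Units.ext
  apply Subtype.ext
  have h1 := congrArg Units.val h
  simp only [Units.val_mul, Units.val_pow_eq_pow_val] at h1 ⊢
  rw [← hw, ← hw'] at h1
  exact h1

theorem existsUnique_isKolyvaginClass (hξ : D.IsEulerSystem ξ) :
    ∃! κ : ModPow Fˣ M, D.IsKolyvaginClass ξ r κ := by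
  obtain ⟨a, b, hb, hab⟩ := D.exists_derived_eq ξ hM hr hξ
  refine ⟨QuotientGroup.mk a, ⟨a, rfl, b, hb, hab⟩, ?_⟩
  rintro _ ⟨a', rfl, b', hb', hab'⟩
  rw [QuotientGroup.eq]
  obtain ⟨c, hc⟩ := D.exists_eq_mul_pow_of_baseUnit hM hr hb hb' (hab.symm.trans hab')
  exact ⟨c, by rw [hc]; simp⟩

theorem isKolyvaginClass_kolyvaginClass (hξ : D.IsEulerSystem ξ) :
    D.IsKolyvaginClass ξ r (D.kolyvaginClass ξ r) :=
  Classical.epsilon_spec (D.existsUnique_isKolyvaginClass ξ hM hr hξ).exists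

theorem kolyvaginClass_eq (hξ : D.IsEulerSystem ξ) {a : Fˣ} {b : Lˣ} (hb : (b : L) ∈ cyc F L r)
    (h : D.derived ξ r = baseUnit F L a * b ^ M) : D.kolyvaginClass ξ r = QuotientGroup.mk a :=
  (D.existsUnique_isKolyvaginClass ξ hM hr hξ).unique
    (D.isKolyvaginClass_kolyvaginClass ξ hM hr hξ) ⟨a, rfl, b, hb, h⟩

/-- A root in the field `F_r` of a unit of `𝓞_r` is automatically a unit of `𝓞_r`; uniqueness holds
because `F_r` has no nontrivial `M`-th roots of unity. -/
theorem existsUnique_intUnit_pow_eq {x : Lˣ} (u : (intRing F L r)ˣ) (hu : intUnit F L r u = x)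
    (hx : ∃ β : Lˣ, (β : L) ∈ cyc F L r ∧ β ^ M = x) :
    ∃! ρ : (intRing F L r)ˣ, intUnit F L r ρ ^ M = x := by
  obtain ⟨β, hβ, h⟩ := hx
  have hM0 : M ≠ 0 := by rintro rfl; exact absurd hM (by decide)
  obtain ⟨ρ, hρ⟩ := exists_intUnit_eq_of_pow hM0 hβ (h.trans hu.symm)
  have h' : intUnit F L r ρ ^ M = x := by rw [hρ, h]
  refine ⟨ρ, h', fun ρ' hρ' => intUnit_injective ?_⟩
  exact D.units_eq_of_pow_eq hM hr (intUnit_mem_cyc _) (intUnit_mem_cyc _)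
    (hρ'.trans h'.symm)

variable {ℓ : ℕ} (hℓ : ℓ.Prime) (hd : ℓ ∣ r) (hξ : D.IsEulerSystem ξ)
include hξ

theorem existsUnique_root_gen :
    ∃! ρ₁ : (intRing F L r)ˣ, intUnit F L r ρ₁ ^ M =
      gpow (intUnit F L r (ξ r)) (D.Nr' r * (D.sig ℓ - 1)) := by
  obtain ⟨u, hu⟩ := exists_intUnit_eq_gpow (isGalois_cyc hr).to_normal (ξ r)
    (D.Nr' r * (D.sig ℓ - 1))
  refine D.existsUnique_intUnit_pow_eq hM hr u hu ?_
  obtain ⟨β, hβ, h⟩ := D.exists_pow_eq_smul_derived_div hr hξ (D.gen ℓ)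
  exact ⟨β, hβ, by rw [D.gpow_Nr'_mul_sub_one, h]⟩

include hℓ hd

theorem existsUnique_root_frob :
    ∃! ρ₂ : (intRing F L r)ˣ, intUnit F L r ρ₂ ^ M =
      gpow (intUnit F L (r / ℓ) (ξ (r / ℓ)))
        (D.Nr' (r / ℓ) * ((ℓ : MonoidAlgebra ℤ Gal(L/F)) - D.Fr ℓ)) := by
  have hs := div_mem_levels hr hd
  have hsr := Nat.div_dvd_of_dvd hd
  obtain ⟨u, hu⟩ := exists_intUnit_eq_gpow (isGalois_cyc hs).to_normal (ξ (r / ℓ))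
    (D.Nr' (r / ℓ) * ((ℓ : MonoidAlgebra ℤ Gal(L/F)) - D.Fr ℓ))
  obtain ⟨w, hw⟩ := exists_intUnit_eq_of_dvd hsr u
  refine D.existsUnique_intUnit_pow_eq hM hr w (hw.trans hu) ?_
  obtain ⟨β, hβ, h⟩ := D.exists_pow_eq_smul_derived_div hs hξ (D.frob ℓ)
  obtain ⟨k, hk⟩ := (hr.2 ℓ hℓ hd).dvd_sub_one
  refine ⟨D.derived ξ (r / ℓ) ^ k / β, ?_, ?_⟩
  · rw [Units.val_div_eq_div_val, Units.val_pow_eq_pow_val]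
    exact div_mem (pow_mem (cyc_mono hsr (D.derived_mem_cyc ξ hs)) k) (cyc_mono hsr hβ)
  · rw [D.gpow_Nr'_mul_sub_frob ξ hℓ.ne_zero, h, hk, div_pow, ← pow_mul, mul_comm k]

end LocalData

/-! ### Residue fields with `ℓ` elements and powers of a primitive root -/

section
open IsDedekindDomain HeightOneSpectrum WithZero

section ResidueField
variable {K : Type*} [Field K] [NumberField K] {v : HeightOneSpectrum (𝓞 K)} {ℓ : ℕ}

theorem valuation_algebraMap_lt_one_iff {a : 𝓞 K} :
    v.valuation K (algebraMap (𝓞 K) K a) < 1 ↔ a ∈ v.asIdeal := valuation_lt_one_iff_mem v a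

theorem valuation_sub_comm (x y : K) : v.valuation K (x - y) = v.valuation K (y - x) :=
  Valuation.map_sub_swap _ _ _

theorem valuation_sub_lt_one_trans {x y z : K} (h : v.valuation K (x - y) < 1)
    (h' : v.valuation K (y - z) < 1) : v.valuation K (x - z) < 1 := by
  have := Valuation.map_add_lt (v.valuation K) h h'
  rwa [sub_add_sub_cancel] at this

theorem valuation_mul_sub_lt_one {x x' y y' : K} (hx' : v.valuation K x' ≤ 1)
    (hy : v.valuation K y ≤ 1) (h : v.valuation K (x - x') < 1) (h' : v.valuation K (y - y') < 1) :
    v.valuation K (x * y - x' * y') < 1 := by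
  have h1 : x * y - x' * y' = (x - x') * y + x' * (y - y') := by ring
  rw [h1]
  refine Valuation.map_add_lt (v.valuation K) ?_ ?_
  · rw [map_mul]
    exact (mul_le_of_le_one_right' hy).trans_lt h
  · rw [map_mul]
    exact (mul_le_of_le_one_left' hx').trans_lt h'

variable (hℓ : ℓ.Prime) (hv : (ℓ : 𝓞 K) ∈ v.asIdeal)
include hℓ hv

theorem valuation_natCast_sub_lt_one_iff {a b : ℕ} :
    v.valuation K ((a : K) - b) < 1 ↔ (a : ZMod ℓ) = b := by
  have h1 : v.valuation K ((a : K) - b) < 1 ↔ (((a : ℤ) - b : ℤ) : 𝓞 K) ∈ v.asIdeal := by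
    rw [← valuation_lt_one_iff_mem (K := K)]
    simp
  have h2 : (a : ZMod ℓ) = b ↔ (ℓ : ℤ) ∣ (a : ℤ) - b := by
    rw [← ZMod.intCast_zmod_eq_zero_iff_dvd, ← sub_eq_zero]
    push_cast
    rfl
  rw [h1, h2]
  constructor
  · intro h
    by_contra hnd
    obtain ⟨c, d, hcd⟩ := ((Prime.coprime_iff_not_dvd (Nat.prime_iff_prime_int.mp hℓ)).mpr hnd)
    apply v.isPrime.ne_top
    rw [Ideal.eq_top_iff_one]
    have := congrArg (Int.cast : ℤ → 𝓞 K) hcd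
    rw [Int.cast_add, Int.cast_mul, Int.cast_mul, Int.cast_natCast, Int.cast_one] at this
    rw [← this]
    exact add_mem (Ideal.mul_mem_left _ _ hv) (Ideal.mul_mem_left _ _ h)
  · rintro ⟨c, hc⟩
    rw [hc, Int.cast_mul, Int.cast_natCast]
    exact Ideal.mul_mem_right _ _ hv

variable {u : (ZMod ℓ)ˣ} (hu : Subgroup.zpowers u = ⊤) {gU : Kˣ}
  (hgU : (gU : K) = ((u : ZMod ℓ).val : ℕ))
include hgU

omit hℓ in
theorem valuation_primitive_eq_one : v.valuation K (gU : K) = 1 := by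
  rw [hgU]
  exact valuation_natCast_eq_one hv (ZMod.val_coe_unit_coprime u)

include hu

/-- A primitive root modulo `ℓ` has order exactly `ℓ - 1` modulo principal units. This converts
congruences at `v` into divisibilities of valuations. -/
theorem zpow_mem_principalUnits_iff (n : ℤ) :
    gU ^ n ∈ principalUnits v ↔ ((ℓ - 1 : ℕ) : ℤ) ∣ n := by
  have := Fact.mk hℓ
  have hord : orderOf u = ℓ - 1 := by
    rw [← Nat.card_zpowers, hu, Subgroup.card_top, Nat.card_eq_fintype_card, ZMod.card_units]
  have key : ∀ k : ℕ, gU ^ k ∈ principalUnits v ↔ ℓ - 1 ∣ k := by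
    intro k
    rw [← hord, orderOf_dvd_iff_pow_eq_one, mem_principalUnits, Units.val_pow_eq_pow_val, hgU]
    have h1 := valuation_natCast_sub_lt_one_iff (K := K) hℓ hv (a := (u : ZMod ℓ).val ^ k) (b := 1)
    push_cast at h1
    rw [h1, ZMod.natCast_zmod_val, ← Units.val_pow_eq_pow_val, ← Units.val_one, Units.val_inj]
  have hord' : orderOf (gU : Kˣ ⧸ principalUnits v) = ℓ - 1 := by
    have h : ∀ k : ℕ, orderOf (gU : Kˣ ⧸ principalUnits v) ∣ k ↔ ℓ - 1 ∣ k := by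
      intro k
      rw [orderOf_dvd_iff_pow_eq_one, ← QuotientGroup.mk_pow, QuotientGroup.eq_one_iff, key]
    exact Nat.dvd_antisymm ((h _).mpr dvd_rfl) ((h _).mp dvd_rfl)
  rw [← hord', orderOf_dvd_iff_zpow_eq_one, ← QuotientGroup.mk_zpow, QuotientGroup.eq_one_iff]

omit hv hgU hu in
theorem exists_natCast_sub_lt_one (hcard : Nat.card (𝓞 K ⧸ v.asIdeal) = ℓ) {x : K}
    (hx : v.valuation K x ≤ 1) : ∃ n : ℕ, v.valuation K (x - n) < 1 := by
  have := Fact.mk hℓ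
  have := v.isMaximal
  obtain ⟨a, s, hs, rfl⟩ := exists_eq_div_of_valuation_le_one hx
  obtain ⟨t, ht⟩ := Ideal.Quotient.exists_inv (I := v.asIdeal) (a := Ideal.Quotient.mk _ s)
    (by rwa [Ne, Ideal.Quotient.eq_zero_iff_mem])
  obtain ⟨t, rfl⟩ := Ideal.Quotient.mk_surjective t
  have hfin : Finite (𝓞 K ⧸ v.asIdeal) := Nat.finite_of_card_ne_zero (hcard ▸ hℓ.ne_zero)
  have := Fintype.ofFinite (𝓞 K ⧸ v.asIdeal)
  let e := ZMod.ringEquivOfPrime (𝓞 K ⧸ v.asIdeal) hℓ (by rw [← Nat.card_eq_fintype_card, hcard])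
  obtain ⟨z, hz⟩ := e.surjective (Ideal.Quotient.mk _ (a * t))
  have hsK : v.valuation K (s : K) = 1 := (valuation_eq_one_iff_notMem v).mpr hs
  have hs0 : (s : K) ≠ 0 := fun h => by simp [h] at hsK
  refine ⟨z.val, ?_⟩
  have h1 : a * t - (z.val : 𝓞 K) ∈ v.asIdeal := by
    rw [← Ideal.Quotient.eq, ← hz, map_natCast, ← map_natCast e, ZMod.natCast_zmod_val]
  have h2 : s * t - 1 ∈ v.asIdeal := by
    rw [← Ideal.Quotient.eq, map_mul, ht, map_one]
  rw [← valuation_algebraMap_lt_one_iff (K := K)] at h1 h2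
  -- With `t` inverse to `s` modulo `v`, the integer `a * t` represents `a / s` in the residue
  -- field.
  have h3 : (a : K) / s - z.val = -(a / s * ((s : K) * t - 1)) + (a * t - z.val) := by
    field_simp
    ring
  rw [h3]
  rw [map_sub, map_mul, map_natCast] at h1
  refine Valuation.map_add_lt (v.valuation K) ?_ h1
  rw [Valuation.map_neg, map_mul]
  exact (mul_le_of_le_one_left' hx).trans_lt (by simpa using h2)

theorem exists_div_pow_mem_principalUnits (hcard : Nat.card (𝓞 K ⧸ v.asIdeal) = ℓ) {x : Kˣ}
    (hx : v.valuation K (x : K) = 1) : ∃ m : ℕ, x / gU ^ m ∈ principalUnits v := by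
  have := Fact.mk hℓ
  obtain ⟨n, hn⟩ := exists_natCast_sub_lt_one hℓ hcard hx.le
  have hn0 : (n : ZMod ℓ) ≠ 0 := by
    intro h0
    rw [← Nat.cast_zero, ← valuation_natCast_sub_lt_one_iff (K := K) hℓ hv] at h0
    have h1 := valuation_sub_lt_one_trans hn h0
    rw [Nat.cast_zero, sub_zero, hx] at h1
    exact lt_irrefl _ h1
  have hm : Units.mk0 (n : ZMod ℓ) hn0 ∈ Subgroup.zpowers u := by rw [hu]; trivial
  obtain ⟨m, hm⟩ := mem_powers_iff_mem_zpowers.mpr hm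
  have hm' : (u : ZMod ℓ) ^ m = n := congrArg Units.val hm
  refine ⟨m, ?_⟩
  rw [div_mem_principalUnits (by
    rw [Units.val_pow_eq_pow_val, map_pow, valuation_primitive_eq_one hv hgU, one_pow])]
  refine valuation_sub_lt_one_trans hn ?_
  rw [Units.val_pow_eq_pow_val, hgU, ← Nat.cast_pow, valuation_natCast_sub_lt_one_iff hℓ hv]
  push_cast
  rw [ZMod.natCast_zmod_val, hm']

theorem pow_sub_one_mem_principalUnits (hcard : Nat.card (𝓞 K ⧸ v.asIdeal) = ℓ) {x : Kˣ}
    (hx : v.valuation K (x : K) = 1) : x ^ (ℓ - 1) ∈ principalUnits v := by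
  obtain ⟨m, hm⟩ := exists_div_pow_mem_principalUnits hℓ hv hu hgU hcard hx
  have h1 : gU ^ (m * (ℓ - 1)) ∈ principalUnits v := by
    rw [← zpow_natCast, zpow_mem_principalUnits_iff hℓ hv hu hgU]
    push_cast
    exact Dvd.intro_left _ rfl
  have h2 := mul_mem (pow_mem hm (ℓ - 1)) h1
  rwa [div_pow, ← pow_mul, div_mul_cancel] at h2

end ResidueField

end

/-! ### The residue ring `𝓞/ℓ` place by place, and `ν_ℓ` -/

section
open IsDedekindDomain HeightOneSpectrum WithZero

section Reduction
variable {F : Type*} [Field F] [NumberField F] {ℓ : ℕ}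

/-- The residue class `t` modulo `ℓ` is congruent to `x` at the place `w`. -/
def Red (w : HeightOneSpectrum (𝓞 F)) (t : ResidueRing F ℓ) (x : F) : Prop :=
  ∃ c : 𝓞 F, Ideal.Quotient.mk _ c = t ∧ w.valuation F ((c : F) - x) < 1

section Place
variable {w : HeightOneSpectrum (𝓞 F)} {t t' : ResidueRing F ℓ} {x y : F}

theorem Red.valuation_le_one (h : Red w t x) : w.valuation F x ≤ 1 := by
  obtain ⟨c, -, hc⟩ := h
  rw [← sub_sub_cancel (c : F) x]
  exact (Valuation.map_sub _ _ _).trans (max_le (HeightOneSpectrum.valuation_le_one w c) hc.le)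

theorem Red.congr (h : Red w t x) (hxy : w.valuation F (x - y) < 1) : Red w t y := by
  obtain ⟨c, hct, hc⟩ := h
  exact ⟨c, hct, valuation_sub_lt_one_trans hc hxy⟩

theorem Red.one : Red w (1 : ResidueRing F ℓ) 1 := ⟨1, map_one _, by simp⟩

theorem Red.mul (h : Red w t x) (h' : Red w t' y) : Red w (t * t') (x * y) := by
  have hx := h.valuation_le_one
  obtain ⟨c, rfl, hc⟩ := h
  obtain ⟨d, rfl, hd⟩ := h'
  refine ⟨c * d, map_mul _ _ _, ?_⟩
  rw [show ((c * d : 𝓞 F) : F) = c * d from map_mul (algebraMap (𝓞 F) F) c d]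
  exact valuation_mul_sub_lt_one hx (HeightOneSpectrum.valuation_le_one w d) hc hd

theorem Red.pow (h : Red w t x) (n : ℕ) : Red w (t ^ n) (x ^ n) := by
  induction n with
  | zero => simpa using Red.one
  | succ n ih => rw [pow_succ, pow_succ]; exact ih.mul h

variable (hw : (ℓ : 𝓞 F) ∈ w.asIdeal)
include hw

theorem Red.valuation_sub_lt_one {c : 𝓞 F} (h : Red w (Ideal.Quotient.mk (idealOf (𝓞 F) ℓ) c) x) :
    w.valuation F ((c : F) - x) < 1 := by
  obtain ⟨d, hd, hdx⟩ := h
  rw [Ideal.Quotient.eq] at hd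
  have h1 : c - d ∈ w.asIdeal := by
    rw [← neg_sub]
    exact neg_mem ((Ideal.span_singleton_le_iff_mem _).mpr hw hd)
  rw [← valuation_algebraMap_lt_one_iff (K := F), map_sub] at h1
  exact valuation_sub_lt_one_trans h1 hdx

theorem Red.unique (h : Red w t x) (h' : Red w t y) : w.valuation F (x - y) < 1 := by
  obtain ⟨c, rfl, hc⟩ := h
  rw [valuation_sub_comm] at hc
  exact valuation_sub_lt_one_trans hc (h'.valuation_sub_lt_one hw)

end Place

variable (hℓ : ℓ.Prime) (hs : SplitsCompletely F ℓ) [IsGalois ℚ F]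
include hℓ hs

/-- As `ℓ` is unramified in `F`, the ring `𝓞/ℓ` embeds into the product of the residue fields at the
places above `ℓ`. -/
theorem Red.ext {t t' : ResidueRing F ℓ} (h : ∀ w : HeightOneSpectrum (𝓞 F),
    (ℓ : 𝓞 F) ∈ w.asIdeal → ∃ x, Red w t x ∧ Red w t' x) : t = t' := by
  obtain ⟨c, rfl⟩ := Ideal.Quotient.mk_surjective t
  obtain ⟨c', rfl⟩ := Ideal.Quotient.mk_surjective t'
  rw [Ideal.Quotient.eq, mem_idealOf_ringOfIntegers_iff (hs.valuation_eq hℓ) hℓ.ne_zero]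
  intro w hw
  obtain ⟨x, hx, hx'⟩ := h w hw
  have h1 := hx.valuation_sub_lt_one hw
  have h2 := hx'.valuation_sub_lt_one hw
  rw [valuation_sub_comm] at h2
  rw [← valuation_algebraMap_lt_one_iff (K := F), map_sub]
  exact valuation_sub_lt_one_trans h1 h2

/-- At each place the residue is represented by a natural number; the Chinese remainder theorem
glues these. -/
theorem exists_red (x : HeightOneSpectrum (𝓞 F) → F)
    (hx : ∀ w : HeightOneSpectrum (𝓞 F), (ℓ : 𝓞 F) ∈ w.asIdeal → w.valuation F (x w) ≤ 1) :
    ∃ t : ResidueRing F ℓ, ∀ w : HeightOneSpectrum (𝓞 F), (ℓ : 𝓞 F) ∈ w.asIdeal → Red w t (x w) := by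
  have h1 : ∀ w : HeightOneSpectrum (𝓞 F), ∃ n : ℕ, (ℓ : 𝓞 F) ∈ w.asIdeal →
      w.valuation F (x w - n) < 1 := by
    intro w
    by_cases hw : (ℓ : 𝓞 F) ∈ w.asIdeal
    · have := w.isPrime
      obtain ⟨n, hn⟩ := exists_natCast_sub_lt_one hℓ (hs.card_quotient hℓ w.asIdeal hw) (hx w hw)
      exact ⟨n, fun _ => hn⟩
    · exact ⟨0, fun h => absurd h hw⟩
  choose n hn using h1
  obtain ⟨c, hc⟩ := exists_sub_mem_pow (finite_places (K := F) hℓ.ne_zero) 1 fun w => (n w : 𝓞 F)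
  refine ⟨Ideal.Quotient.mk _ c, fun w hw => ⟨c, rfl, ?_⟩⟩
  have h2 := hc w hw
  rw [pow_one, ← valuation_algebraMap_lt_one_iff (K := F), map_sub, map_natCast] at h2
  have h3 := hn w hw
  rw [valuation_sub_comm] at h3
  exact valuation_sub_lt_one_trans h2 h3

theorem exists_residueTorsion_red {M : ℕ} (hM : M ≠ 0) (x : HeightOneSpectrum (𝓞 F) → Fˣ)
    (hx : ∀ w : HeightOneSpectrum (𝓞 F), (ℓ : 𝓞 F) ∈ w.asIdeal → x w ^ M ∈ principalUnits w) :
    ∃ t : ResidueTorsion F M ℓ, ∀ w : HeightOneSpectrum (𝓞 F), (ℓ : 𝓞 F) ∈ w.asIdeal →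
      Red w ((t : (ResidueRing F ℓ)ˣ) : ResidueRing F ℓ) (x w : F) := by
  have := NeZero.mk hM
  obtain ⟨t, ht⟩ := exists_red hℓ hs (fun w => (x w : F)) (fun w hw => by
    have h1 := valuation_eq_one_of_mem_principalUnits (hx w hw)
    rw [Units.val_pow_eq_pow_val, map_pow] at h1
    exact ((pow_eq_one_iff.mp h1).resolve_right hM).le)
  have htM : t ^ M = 1 := Red.ext hℓ hs fun w hw =>
    ⟨1, ((ht w hw).pow M).congr (hx w hw), Red.one⟩
  exact ⟨rootsOfUnity.mkOfPowEq t htM, fun w hw => by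
    rw [rootsOfUnity.coe_mkOfPowEq]; exact ht w hw⟩

/-- Homomorphisms to the `M`-torsion of `(𝓞 / ℓ)ˣ` can be given at the places above `ℓ`. -/
theorem exists_monoidHom_red {M : ℕ} (hM : M ≠ 0) {A : Type*} [Group A]
    (f : HeightOneSpectrum (𝓞 F) → A →* Fˣ)
    (hf : ∀ w : HeightOneSpectrum (𝓞 F), (ℓ : 𝓞 F) ∈ w.asIdeal → ∀ a, f w a ^ M ∈ principalUnits w) :
    ∃ h : A →* ResidueTorsion F M ℓ, ∀ a, ∀ w : HeightOneSpectrum (𝓞 F), (ℓ : 𝓞 F) ∈ w.asIdeal →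
      Red w ((h a : (ResidueRing F ℓ)ˣ) : ResidueRing F ℓ) (f w a : F) := by
  choose h hh using fun a =>
    exists_residueTorsion_red hℓ hs hM (fun w => f w a) (fun w hw => hf w hw a)
  refine ⟨MonoidHom.mk' h fun a b => Subtype.ext (Units.ext (Red.ext hℓ hs fun w hw => ?_)), hh⟩
  refine ⟨_, hh (a * b) w hw, ?_⟩
  rw [map_mul]
  exact (hh a w hw).mul (hh b w hw)

end Reduction

/-- A homomorphism from `A` to the `M`-torsion of `(𝓞 / ℓ)ˣ` factors through `A / A ^ M`. -/
theorem exists_modPow_lift {F : Type*} [Field F] {ℓ M : ℕ} {A : Type*} [CommGroup A]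
    (h : A →* ResidueTorsion F M ℓ) :
    ∃ h' : ModPow A M →* ResidueTorsion F M ℓ, ∀ a, h' (QuotientGroup.mk a) = h a := by
  refine ⟨QuotientGroup.lift _ h ?_, fun a => rfl⟩
  rintro _ ⟨a, rfl⟩
  rw [MonoidHom.mem_ker, powMonoidHom_apply, map_pow]
  exact Subtype.ext ((mem_rootsOfUnity _ _).mp (h a).2)

section BaseLoc
variable {F : Type*} [Field F] {ℓ : ℕ}

theorem mem_integralClosure_toSubring_iff {x : F} :
    x ∈ (integralClosure ℤ F).toSubring ↔ ∃ a : 𝓞 F, RingHom.id F a = x :=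
  ⟨fun h => ⟨⟨x, h⟩, rfl⟩, by rintro ⟨a, rfl⟩; exact a.2⟩

variable [NumberField F]

theorem mem_baseLoc_iff {x : F} : x ∈ baseLoc F ℓ ↔
    ∀ w : HeightOneSpectrum (𝓞 F), (ℓ : 𝓞 F) ∈ w.asIdeal → w.valuation F x ≤ 1 := by
  rw [baseLoc, mem_locAt_iff (fun x => mem_integralClosure_toSubring_iff)]
  exact ⟨by rintro ⟨y, rfl, h⟩; exact h, fun h => ⟨x, rfl, h⟩⟩

theorem valuation_unit_baseLoc (u : (baseLoc F ℓ)ˣ) {w : HeightOneSpectrum (𝓞 F)}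
    (hw : (ℓ : 𝓞 F) ∈ w.asIdeal) : w.valuation F ((u : baseLoc F ℓ) : F) = 1 := by
  have h1 := mem_baseLoc_iff.mp (Subtype.mem (u : baseLoc F ℓ)) w hw
  have h2 := mem_baseLoc_iff.mp (Subtype.mem ((u⁻¹ : (baseLoc F ℓ)ˣ) : baseLoc F ℓ)) w hw
  have h3 : w.valuation F ((u : baseLoc F ℓ) : F) *
      w.valuation F (((u⁻¹ : (baseLoc F ℓ)ˣ) : baseLoc F ℓ) : F) = 1 := by
    rw [← map_mul, ← Subring.coe_mul, Units.mul_inv, Subring.coe_one, map_one]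
  refine le_antisymm h1 ?_
  rw [← h3]
  exact mul_le_of_le_one_right' h2

theorem exists_baseLoc_unit (y : Fˣ) (h : ∀ w : HeightOneSpectrum (𝓞 F), (ℓ : 𝓞 F) ∈ w.asIdeal →
    w.valuation F (y : F) = 1) :
    ∃ u : (baseLoc F ℓ)ˣ, Units.map ((baseLoc F ℓ).subtype : baseLoc F ℓ →* F) u = y := by
  refine ⟨⟨⟨y, mem_baseLoc_iff.mpr fun w hw => (h w hw).le⟩,
    ⟨(y⁻¹ : Fˣ), mem_baseLoc_iff.mpr fun w hw => ?_⟩, Subtype.ext y.mul_inv, Subtype.ext y.inv_mul⟩,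
    Units.ext rfl⟩
  rw [Units.val_inv_eq_inv_val, map_inv₀, h w hw, inv_one]

theorem residueToBaseLoc_eq_mk_iff [IsGalois ℚ F] (hℓ : ℓ.Prime) (hs : SplitsCompletely F ℓ)
    {t : ResidueRing F ℓ} {x : baseLoc F ℓ} : residueToBaseLoc F ℓ t = Ideal.Quotient.mk _ x ↔
      ∀ w : HeightOneSpectrum (𝓞 F), (ℓ : 𝓞 F) ∈ w.asIdeal → Red w t x := by
  obtain ⟨c, rfl⟩ := Ideal.Quotient.mk_surjective t
  have h1 : residueToBaseLoc F ℓ (Ideal.Quotient.mk _ c) = Ideal.Quotient.mk _ x ↔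
      intToBaseLoc F ℓ c - x ∈ idealOf (baseLoc F ℓ) ℓ := by
    rw [← Ideal.Quotient.eq]
    rfl
  have hmem : RingHom.id F ((c : F) - x) ∈ baseLoc F ℓ := (intToBaseLoc F ℓ c - x).2
  have h2 := mk_mem_idealOf_iff (ℓ := ℓ) (fun x => mem_integralClosure_toSubring_iff)
    (hs.valuation_eq hℓ) hℓ.ne_zero hmem
  rw [h1]
  refine Iff.trans h2 ?_
  exact ⟨fun h w hw => ⟨c, rfl, h w hw⟩, fun h w hw => (h w hw).valuation_sub_lt_one hw⟩

end BaseLoc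

section Nu
variable {F : Type*} [Field F] [NumberField F] [IsGalois ℚ F] {ℓ M : ℕ}

theorem isNu_iff (hℓ : IsGoodPrime F M ℓ) (n : ModPow (baseLoc F ℓ)ˣ M →* ResidueTorsion F M ℓ) :
    IsNu F M ℓ n ↔ ∀ u : (baseLoc F ℓ)ˣ, ∀ w : HeightOneSpectrum (𝓞 F), (ℓ : 𝓞 F) ∈ w.asIdeal →
      Red w ((n (QuotientGroup.mk u) : (ResidueRing F ℓ)ˣ) : ResidueRing F ℓ)
        (((u : baseLoc F ℓ) : F) ^ ((ℓ - 1) / M)) := by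
  refine forall_congr' fun u => ?_
  rw [residueToBaseLoc_eq_mk_iff hℓ.1 hℓ.2.2.2]
  rfl

/-- By Fermat's little theorem in the residue fields, `x ^ ((ℓ - 1) / M)` is killed by `M` at each
place above `ℓ`. The local values glue to a homomorphism and determine it. -/
theorem existsUnique_isNu (hM : M ≠ 0) (hℓ : IsGoodPrime F M ℓ) : ∃! n, IsNu F M ℓ n := by
  have := Fact.mk hℓ.1
  obtain ⟨u, hu⟩ := IsCyclic.exists_generator (α := (ZMod ℓ)ˣ)
  obtain ⟨h, hh⟩ := exists_monoidHom_red hℓ.1 hℓ.2.2.2 hM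
    (fun _ => (powMonoidHom ((ℓ - 1) / M)).comp
      (Units.map ((baseLoc F ℓ).subtype : baseLoc F ℓ →* F))) (fun w hw a => by
        have := w.isPrime
        have hg0 : (((u : ZMod ℓ).val : ℕ) : F) ≠ 0 := by
          have := (ZMod.val_ne_zero (u : ZMod ℓ)).mpr u.ne_zero
          exact_mod_cast this
        rw [MonoidHom.comp_apply, powMonoidHom_apply, ← pow_mul, Nat.div_mul_cancel hℓ.dvd_sub_one]
        exact pow_sub_one_mem_principalUnits hℓ.1 hw (u := u) (Subgroup.eq_top_iff' _ |>.mpr hu)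
          (gU := Units.mk0 _ hg0) rfl (hℓ.2.2.2.card_quotient hℓ.1 _ hw)
          (valuation_unit_baseLoc a hw))
  obtain ⟨h', hh'⟩ := exists_modPow_lift h
  refine ⟨h', (isNu_iff hℓ h').mpr fun a w hw => ?_, fun n hn => ?_⟩
  · rw [hh']
    exact hh a w hw
  · refine MonoidHom.ext fun k => ?_
    obtain ⟨a, rfl⟩ := QuotientGroup.mk_surjective k
    refine Subtype.ext (Units.ext (Red.ext hℓ.1 hℓ.2.2.2 fun w hw =>
      ⟨_, (isNu_iff hℓ n).mp hn a w hw, ?_⟩))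
    rw [hh']
    exact hh a w hw

theorem red_nu (hM : M ≠ 0) (hℓ : IsGoodPrime F M ℓ) (u : (baseLoc F ℓ)ˣ)
    {w : HeightOneSpectrum (𝓞 F)} (hw : (ℓ : 𝓞 F) ∈ w.asIdeal) :
    Red w ((nu F M ℓ (QuotientGroup.mk u) : (ResidueRing F ℓ)ˣ) : ResidueRing F ℓ)
      (((u : baseLoc F ℓ) : F) ^ ((ℓ - 1) / M)) :=
  (isNu_iff hℓ _).mp (Classical.epsilon_spec (existsUnique_isNu hM hℓ).exists) u w hw

end Nu

end

/-! ### Fractional ideals of `𝓞_(ℓ)` and the explicit form of `exp_ℓ` -/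

section
open IsDedekindDomain HeightOneSpectrum WithZero

section PrincipalIdeals
variable {F : Type*} [Field F] [NumberField F] {ℓ : ℕ}

theorem valuation_eq_one_iff_log {w : HeightOneSpectrum (𝓞 F)} (y : Fˣ) :
    w.valuation F (y : F) = 1 ↔ log (w.valuation F (y : F)) = 0 := by
  constructor
  · intro h
    rw [h, log_one]
  · intro h
    rw [← exp_log (valuation_units_ne_zero y), h, exp_zero]

/-- Otherwise `I` contains an element `1 - y * ℓ`, which is a unit at all places above `ℓ` and hence
a unit of `𝓞_(ℓ)`. -/
theorem natCast_mem_of_isMaximal_baseLoc (hℓ : ℓ.Prime) {I : Ideal (baseLoc F ℓ)}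
    (hI : I.IsMaximal) : (ℓ : baseLoc F ℓ) ∈ I := by
  by_contra h
  obtain ⟨y, i, hi, hyi⟩ := hI.exists_inv h
  have hyi' : (i : F) = 1 - y * ℓ := by
    rw [eq_sub_iff_add_eq, add_comm]
    exact congrArg Subtype.val hyi
  have h1 : ∀ w : HeightOneSpectrum (𝓞 F), (ℓ : 𝓞 F) ∈ w.asIdeal → w.valuation F (i : F) = 1 := by
    intro w hw
    rw [hyi']
    refine Valuation.map_one_sub_of_lt _ ?_
    rw [map_mul]
    exact (mul_le_of_le_one_left' (mem_baseLoc_iff.mp y.2 w hw)).trans_lt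
      (valuation_natCast_lt_one hw)
  have hi0 : (i : F) ≠ 0 := by
    obtain ⟨w, hw⟩ := exists_place (K := F) hℓ
    intro h0
    have := h1 w hw
    rw [h0, map_zero] at this
    exact zero_ne_one this
  obtain ⟨u, hu⟩ := exists_baseLoc_unit (Units.mk0 (i : F) hi0) h1
  have hui : (u : baseLoc F ℓ) = i := Subtype.ext (congrArg Units.val hu)
  exact hI.ne_top (Ideal.eq_top_of_isUnit_mem _ hi (hui ▸ u.isUnit))

/-- Maximal ideals contract to places above `ℓ`, injectively because the denominators are prime to
`ℓ`. -/
theorem finite_maximals_baseLoc (hℓ : ℓ.Prime) :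
    {I : Ideal (baseLoc F ℓ) | I.IsMaximal}.Finite := by
  have hle : ∀ I I' : Ideal (baseLoc F ℓ), I.IsMaximal → I'.IsMaximal →
      I.comap (intToBaseLoc F ℓ) = I'.comap (intToBaseLoc F ℓ) → I ≤ I' := by
    intro I I' hI hI' h x hx
    obtain ⟨a, s, hs0, ⟨b, c, hbc⟩, hxe⟩ := exists_coprime_eq_div (mem_baseLoc_iff.mp x.2)
    have hsK : (s : F) ≠ 0 := by simpa using hs0
    have hmul : x * intToBaseLoc F ℓ s = intToBaseLoc F ℓ a := by
      apply Subtype.ext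
      change (x : F) * s = a
      rw [hxe, div_mul_cancel₀ _ hsK]
    have ha : a ∈ I.comap (intToBaseLoc F ℓ) := by
      rw [Ideal.mem_comap, ← hmul]
      exact Ideal.mul_mem_right _ _ hx
    rw [h, Ideal.mem_comap, ← hmul] at ha
    refine (hI'.isPrime.mem_or_mem ha).resolve_right fun hs => hI'.ne_top ?_
    rw [Ideal.eq_top_iff_one, ← map_one (intToBaseLoc F ℓ), ← hbc, map_add, map_mul, map_mul,
      map_natCast]
    exact add_mem (Ideal.mul_mem_left _ _ hs)
      (Ideal.mul_mem_left _ _ (natCast_mem_of_isMaximal_baseLoc hℓ hI'))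
  refine Set.Finite.of_injOn (f := Ideal.comap (intToBaseLoc F ℓ)) ?_
    (fun I hI I' hI' h => hI.eq_of_le hI'.ne_top (hle I I' hI hI' h))
    ((finite_places (K := F) hℓ.ne_zero).image HeightOneSpectrum.asIdeal)
  intro I hI
  have hp : I.IsPrime := Ideal.IsMaximal.isPrime hI
  have hmem : (ℓ : 𝓞 F) ∈ I.comap (intToBaseLoc F ℓ) := by
    rw [Ideal.mem_comap, map_natCast]
    exact natCast_mem_of_isMaximal_baseLoc hℓ hI
  exact ⟨⟨I.comap (intToBaseLoc F ℓ), Ideal.comap_isPrime _ _, fun h0 => by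
    rw [h0, Ideal.mem_bot] at hmem
    exact hℓ.ne_zero (by exact_mod_cast hmem)⟩, hmem, rfl⟩

theorem toPrincipalIdeal_eq_one_iff (y : Fˣ) : toPrincipalIdeal (baseLoc F ℓ) F y = 1 ↔
    ∀ w : HeightOneSpectrum (𝓞 F), (ℓ : 𝓞 F) ∈ w.asIdeal → w.valuation F (y : F) = 1 := by
  rw [toPrincipalIdeal_eq_iff, Units.val_one]
  constructor
  · intro h
    obtain ⟨a, ha⟩ := (FractionalIdeal.mem_one_iff _).mp
      (h ▸ FractionalIdeal.mem_spanSingleton_self (baseLoc F ℓ)⁰ (y : F))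
    obtain ⟨b, hb⟩ := (FractionalIdeal.mem_spanSingleton _).mp
      (h.symm ▸ FractionalIdeal.one_mem_one (baseLoc F ℓ)⁰)
    intro w hw
    have h1 : w.valuation F (y : F) ≤ 1 := by rw [← ha]; exact mem_baseLoc_iff.mp a.2 w hw
    have h2 : w.valuation F (b : F) ≤ 1 := mem_baseLoc_iff.mp b.2 w hw
    have h3 : (b : F) * y = 1 := hb
    refine le_antisymm h1 ?_
    rw [← map_one (w.valuation F), ← h3, map_mul]
    exact mul_le_of_le_one_left' h2
  · intro h
    obtain ⟨u, rfl⟩ := exists_baseLoc_unit y h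
    refine le_antisymm (FractionalIdeal.spanSingleton_le_iff_mem.mpr
      ((FractionalIdeal.mem_one_iff _).mpr ⟨u, rfl⟩)) ?_
    rw [← FractionalIdeal.spanSingleton_one, FractionalIdeal.spanSingleton_le_iff_mem,
      FractionalIdeal.mem_spanSingleton]
    exact ⟨((u⁻¹ : (baseLoc F ℓ)ˣ) : baseLoc F ℓ), congrArg Subtype.val u.inv_mul⟩

/-- Invertible ideals of a semilocal domain are principal. -/
theorem toPrincipalIdeal_surjective (hℓ : ℓ.Prime) :
    Function.Surjective (toPrincipalIdeal (baseLoc F ℓ) F) := by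
  intro I
  have h := FractionalIdeal.isPrincipal.of_finite_maximals_of_inv le_rfl
    (finite_maximals_baseLoc (F := F) hℓ) (I : FractionalIdeal (baseLoc F ℓ)⁰ F) _ I.mul_inv
  obtain ⟨x, hx⟩ := h.principal
  have hx' : FractionalIdeal.spanSingleton (baseLoc F ℓ)⁰ x = I := by
    rw [← FractionalIdeal.coeToSubmodule_inj, FractionalIdeal.coe_spanSingleton, hx]
  have hx0 : x ≠ 0 := by
    rintro rfl
    rw [FractionalIdeal.spanSingleton_zero] at hx'
    exact I.ne_zero hx'.symm
  exact ⟨Units.mk0 x hx0, toPrincipalIdeal_eq_iff.mpr hx'⟩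

end PrincipalIdeals

section Exp
variable {F : Type*} [Field F] [NumberField F] [IsGalois ℚ F] {ℓ M : ℕ}

/-- The isomorphism from the group of ideals modulo `M`-th powers to the `M`-torsion of the
residue ring that is defined by a primitive root modulo `ℓ`. -/
theorem exists_exp (hM : M ≠ 0) (hℓ : IsGoodPrime F M ℓ) {u : (ZMod ℓ)ˣ}
    (hu : Subgroup.zpowers u = ⊤) {gU : Fˣ} (hgU : (gU : F) = ((u : ZMod ℓ).val : ℕ)) :
    ∃ e : ModPow (FracIdeals F ℓ) M →* ResidueTorsion F M ℓ, Function.Bijective e ∧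
      ∀ (y : Fˣ) (w : HeightOneSpectrum (𝓞 F)), (ℓ : 𝓞 F) ∈ w.asIdeal →
        Red w ((e (QuotientGroup.mk (toPrincipalIdeal (baseLoc F ℓ) F y)) : (ResidueRing F ℓ)ˣ) :
          ResidueRing F ℓ) ((gU ^ (log (w.valuation F (y : F)) * ((ℓ - 1) / M : ℕ)) : Fˣ) : F) := by
  obtain ⟨k, hk⟩ := hℓ.dvd_sub_one
  have hk0 : k ≠ 0 := by
    rintro rfl
    have := hℓ.1.two_le
    omega
  have hkM : (ℓ - 1) / M = k := by rw [hk, Nat.mul_div_cancel_left _ (Nat.pos_of_ne_zero hM)]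
  rw [hkM]
  have hdvd : ∀ n : ℤ, ((ℓ - 1 : ℕ) : ℤ) ∣ n * k ↔ (M : ℤ) ∣ n := by
    intro n
    rw [hk, Nat.cast_mul]
    exact mul_dvd_mul_iff_right (by exact_mod_cast hk0)
  -- At the place `w` the map is `y ↦ g ^ (-ord_w y * (ℓ - 1) / M)`, where `g` is the primitive
  -- root. It kills the elements that are units above `ℓ`, so it descends to ideals.
  obtain ⟨h, hh⟩ := exists_monoidHom_red hℓ.1 hℓ.2.2.2 hM
    (fun w => MonoidHom.mk' (fun y : Fˣ => gU ^ (log (w.valuation F (y : F)) * k)) (fun a b => by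
      rw [Units.val_mul, map_mul, log_mul (valuation_units_ne_zero a) (valuation_units_ne_zero b),
        add_mul, zpow_add]))
    (fun w hw a => by
      change (gU ^ (log (w.valuation F (a : F)) * k)) ^ M ∈ principalUnits w
      rw [← zpow_natCast, ← zpow_mul, zpow_mem_principalUnits_iff hℓ.1 hw hu hgU, hk]
      exact ⟨log (w.valuation F (a : F)), by push_cast; ring⟩)
  have hker : (toPrincipalIdeal (baseLoc F ℓ) F).ker ≤ h.ker := by
    intro y hy
    rw [MonoidHom.mem_ker, toPrincipalIdeal_eq_one_iff] at hy
    refine Subtype.ext (Units.ext (Red.ext hℓ.1 hℓ.2.2.2 fun w hw => ⟨_, hh y w hw, ?_⟩))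
    change Red w 1 ((gU ^ (log (w.valuation F (y : F)) * k) : Fˣ) : F)
    rw [hy w hw, log_one, zero_mul, zpow_zero]
    exact Red.one
  let φ := (toPrincipalIdeal (baseLoc F ℓ) F).liftOfSurjective
    (toPrincipalIdeal_surjective hℓ.1) ⟨h, hker⟩
  have hφ : ∀ y, φ (toPrincipalIdeal (baseLoc F ℓ) F y) = h y := fun y =>
    MonoidHom.liftOfRightInverse_comp_apply _ _ _ _ y
  obtain ⟨e, he⟩ := exists_modPow_lift φ
  have hred : ∀ (y : Fˣ) (w : HeightOneSpectrum (𝓞 F)), (ℓ : 𝓞 F) ∈ w.asIdeal →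
      Red w ((e (QuotientGroup.mk (toPrincipalIdeal (baseLoc F ℓ) F y)) : (ResidueRing F ℓ)ˣ) :
        ResidueRing F ℓ) ((gU ^ (log (w.valuation F (y : F)) * k) : Fˣ) : F) := by
    intro y w hw
    rw [he, hφ]
    exact hh y w hw
  refine ⟨e, ⟨?_, ?_⟩, hred⟩
  · rw [injective_iff_map_eq_one]
    intro κ hκ
    obtain ⟨I, rfl⟩ := QuotientGroup.mk_surjective κ
    obtain ⟨y, rfl⟩ := toPrincipalIdeal_surjective hℓ.1 I
    have hdiv : ∀ w : HeightOneSpectrum (𝓞 F), (ℓ : 𝓞 F) ∈ w.asIdeal →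
        (M : ℤ) ∣ log (w.valuation F (y : F)) := by
      intro w hw
      have h1 := hred y w hw
      rw [hκ] at h1
      have h2 := h1.unique hw Red.one
      rw [← hdvd, ← zpow_mem_principalUnits_iff hℓ.1 hw hu hgU]
      exact h2
    -- In the kernel, all orders at places above `ℓ` are divisible by `M`; `z` has the quotients as
    -- its orders, so `(y) = (z) ^ M`.
    obtain ⟨z, hz⟩ := exists_log_valuation_eq (K := F) hℓ.1.ne_zero
      fun w => log (w.valuation F (y : F)) / M
    have h1 : toPrincipalIdeal (baseLoc F ℓ) F (y / z ^ M) = 1 := by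
      rw [toPrincipalIdeal_eq_one_iff]
      intro w hw
      rw [valuation_eq_one_iff_log, Units.val_div_eq_div_val, map_div₀,
        log_div (valuation_units_ne_zero _) (valuation_units_ne_zero _),
        Units.val_pow_eq_pow_val, map_pow, log_pow, hz w hw, nsmul_eq_mul,
        Int.mul_ediv_cancel' (hdiv w hw), sub_self]
    rw [map_div, div_eq_one] at h1
    rw [h1, QuotientGroup.eq_one_iff]
    exact ⟨toPrincipalIdeal (baseLoc F ℓ) F z, by rw [powMonoidHom_apply, map_pow]⟩
  · intro t
    obtain ⟨c, hc⟩ := Ideal.Quotient.mk_surjective ((t : (ResidueRing F ℓ)ˣ) : ResidueRing F ℓ)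
    have htM : ((t : (ResidueRing F ℓ)ˣ) : ResidueRing F ℓ) ^ M = 1 := by
      rw [← Units.val_pow_eq_pow_val, (mem_rootsOfUnity _ _).mp t.2, Units.val_one]
    have hcn : ∀ w : HeightOneSpectrum (𝓞 F), ∃ n : ℤ, (ℓ : 𝓞 F) ∈ w.asIdeal →
        Red w ((t : (ResidueRing F ℓ)ˣ) : ResidueRing F ℓ) ((gU ^ (n * k) : Fˣ) : F) := by
      intro w
      by_cases hw : (ℓ : 𝓞 F) ∈ w.asIdeal
      swap
      · exact ⟨0, fun h => absurd h hw⟩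
      have := w.isPrime
      have hct : Red w ((t : (ResidueRing F ℓ)ˣ) : ResidueRing F ℓ) (c : F) :=
        ⟨c, hc, by simp⟩
      have h1 := hct.pow M
      rw [htM] at h1
      have h2 := h1.unique hw Red.one
      have hc0 : (c : F) ≠ 0 := by
        intro h0
        rw [h0, zero_pow hM] at h2
        simp at h2
      have h3 : Units.mk0 (c : F) hc0 ^ M ∈ principalUnits w := h2
      have h4 := valuation_eq_one_of_mem_principalUnits h3
      rw [Units.val_pow_eq_pow_val, map_pow] at h4
      have hv1 := (pow_eq_one_iff.mp h4).resolve_right hM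
      obtain ⟨m, hm⟩ := exists_div_pow_mem_principalUnits hℓ.1 hw hu hgU
        (hℓ.2.2.2.card_quotient hℓ.1 w.asIdeal hw) hv1
      -- If `c ≡ g ^ m` and `c ^ M ≡ 1`, then `ℓ - 1 = M * k` divides `m * M`, so `k` divides `m`,
      -- and `c` is of the form taken by the map.
      have h5 := div_mem h3 (pow_mem hm M)
      rw [div_pow, div_div_cancel, ← pow_mul, ← zpow_natCast,
        zpow_mem_principalUnits_iff hℓ.1 hw hu hgU, hk, Int.natCast_dvd_natCast, mul_comm] at h5
      obtain ⟨n, rfl⟩ := Nat.dvd_of_mul_dvd_mul_right (Nat.pos_of_ne_zero hM) h5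
      refine ⟨n, fun _ => hct.congr ?_⟩
      have h6 := (div_mem_principalUnits (by
        rw [Units.val_pow_eq_pow_val, map_pow, valuation_primitive_eq_one hw hgU, one_pow])).mp hm
      rw [mul_comm (n : ℤ), ← Nat.cast_mul, zpow_natCast]
      exact h6
    choose n hn using hcn
    obtain ⟨y, hy⟩ := exists_log_valuation_eq (K := F) hℓ.1.ne_zero n
    refine ⟨QuotientGroup.mk (toPrincipalIdeal (baseLoc F ℓ) F y),
      Subtype.ext (Units.ext (Red.ext hℓ.1 hℓ.2.2.2 fun w hw => ⟨_, ?_, hn w hw⟩))⟩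
    rw [← hy w hw]
    exact hred y w hw

end Exp

end

/-! ### Comparison of places of `F` and of `F_r` -/

section
open IsDedekindDomain HeightOneSpectrum WithZero

section Under
variable {F E : Type*} [Field F] [Field E] [Algebra F E] [NumberField F] [NumberField E] {ℓ : ℕ}

theorem ramificationIdx_under_ne_zero {v : HeightOneSpectrum (𝓞 E)}
    (hv : (ℓ : 𝓞 E) ∈ v.asIdeal) :
    (v.under (𝓞 F)).asIdeal.ramificationIdx' v.asIdeal ≠ 0 := by
  intro h
  have h1 := valuation_under (v := v) (ℓ : F)
  rw [h, pow_zero, map_natCast] at h1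
  exact (valuation_natCast_lt_one hv).ne h1.symm

theorem valuation_under_lt_one_iff {v : HeightOneSpectrum (𝓞 E)}
    (hv : (ℓ : 𝓞 E) ∈ v.asIdeal) (y : F) :
    v.valuation E (algebraMap F E y) < 1 ↔ (v.under (𝓞 F)).valuation F y < 1 := by
  rw [← valuation_under, pow_lt_one_iff (ramificationIdx_under_ne_zero hv)]

theorem map_mem_principalUnits {v : HeightOneSpectrum (𝓞 E)}
    (hv : (ℓ : 𝓞 E) ∈ v.asIdeal) {y : Fˣ} :
    Units.map (algebraMap F E : F →* E) y ∈ principalUnits v ↔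
      y ∈ principalUnits (v.under (𝓞 F)) := by
  rw [mem_principalUnits, mem_principalUnits, ← valuation_under_lt_one_iff hv,
    map_sub (algebraMap F E), map_one]
  rfl

omit [NumberField E] in
/-- Places can be extended. -/
theorem exists_under_eq (w : HeightOneSpectrum (𝓞 F)) (hw : (ℓ : 𝓞 F) ∈ w.asIdeal) :
    ∃ v : HeightOneSpectrum (𝓞 E), (ℓ : 𝓞 E) ∈ v.asIdeal ∧ v.under (𝓞 F) = w := by
  have := w.isMaximal
  obtain ⟨Q, hQ, ⟨h⟩⟩ :=
    Ideal.exists_maximal_ideal_liesOver_of_isIntegral (S := 𝓞 E) w.asIdeal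
  have hne : Q ≠ ⊥ := by
    rintro rfl
    exact w.ne_bot (h.trans (Ideal.under_bot _ _))
  refine ⟨⟨Q, hQ.isPrime, hne⟩, ?_, HeightOneSpectrum.ext h.symm⟩
  rw [h] at hw
  simpa [Ideal.mem_comap] using hw

end Under

section IntLoc
variable {F : Type*} [Field F] {L : Type*} [Field L] [Algebra F L] {r ℓ : ℕ}

theorem mem_intRing_iff {x : L} : x ∈ intRing F L r ↔
    ∃ a : 𝓞 (cyc F L r), algebraMap (cyc F L r) L (a : cyc F L r) = x := by
  constructor
  · rintro ⟨h1, h2⟩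
    exact ⟨⟨⟨x, h1⟩, (isIntegral_algHom_iff ((cyc F L r).val.restrictScalars ℤ)
      Subtype.val_injective).mp h2⟩, rfl⟩
  · rintro ⟨a, rfl⟩
    exact ⟨Subtype.mem (a : cyc F L r), a.2.map ((cyc F L r).val.restrictScalars ℤ)⟩

variable [NumberField (cyc F L r)]

theorem mem_intLoc_iff {y : cyc F L r} : (y : L) ∈ intLoc F L r ℓ ↔
    ∀ v : HeightOneSpectrum (𝓞 (cyc F L r)), (ℓ : 𝓞 (cyc F L r)) ∈ v.asIdeal →
      v.valuation (cyc F L r) y ≤ 1 := by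
  rw [intLoc, mem_locAt_iff (ι := algebraMap (cyc F L r) L) (fun x => mem_intRing_iff)]
  constructor
  · rintro ⟨z, hz, h⟩
    rwa [← Subtype.ext hz]
  · exact fun h => ⟨y, rfl, h⟩

variable (hℓ : ℓ ≠ 0)
include hℓ

theorem radQuot_mk_eq_mk_iff {x y : cyc F L r} (hx : (x : L) ∈ intLoc F L r ℓ)
    (hy : (y : L) ∈ intLoc F L r ℓ) :
    (Ideal.Quotient.mk _ ⟨x, hx⟩ : RadQuot F L r ℓ) = Ideal.Quotient.mk _ ⟨y, hy⟩ ↔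
      ∀ v : HeightOneSpectrum (𝓞 (cyc F L r)), (ℓ : 𝓞 (cyc F L r)) ∈ v.asIdeal →
        v.valuation (cyc F L r) (x - y) < 1 := by
  rw [Ideal.Quotient.eq]
  exact mk_mem_radical_iff (ι := algebraMap (cyc F L r) L) (fun x => mem_intRing_iff) hℓ
    (y := x - y) (sub_mem hx hy)

theorem residueToRadQuot_mk_eq_mk_iff [NumberField F] {c : 𝓞 F} {y : cyc F L r}
    (hy : (y : L) ∈ intLoc F L r ℓ) :
    residueToRadQuot F L r ℓ (Ideal.Quotient.mk _ c) = Ideal.Quotient.mk _ ⟨y, hy⟩ ↔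
      ∀ v : HeightOneSpectrum (𝓞 (cyc F L r)), (ℓ : 𝓞 (cyc F L r)) ∈ v.asIdeal →
        v.valuation (cyc F L r) (algebraMap F (cyc F L r) c - y) < 1 :=
  radQuot_mk_eq_mk_iff hℓ (x := algebraMap F (cyc F L r) c)
    (le_locAt (intRing F L r) ℓ (baseToInt F L r c).2) hy

variable [NumberField F]

omit hℓ in
theorem residueToRadQuot_eq_mk_of_red (hℓ : ℓ.Prime) {t : ResidueRing F ℓ} {y : cyc F L r}
    (hy : (y : L) ∈ intLoc F L r ℓ)
    (h : ∀ v : HeightOneSpectrum (𝓞 (cyc F L r)), (ℓ : 𝓞 (cyc F L r)) ∈ v.asIdeal →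
      ∃ x : F, Red (v.under (𝓞 F)) t x ∧
        v.valuation (cyc F L r) (algebraMap F (cyc F L r) x - y) < 1) :
    residueToRadQuot F L r ℓ t = Ideal.Quotient.mk _ ⟨y, hy⟩ := by
  obtain ⟨c, rfl⟩ := Ideal.Quotient.mk_surjective t
  rw [residueToRadQuot_mk_eq_mk_iff hℓ.ne_zero]
  intro v hv
  obtain ⟨x, hx, hxy⟩ := h v hv
  have h1 := hx.valuation_sub_lt_one (natCast_mem_under hv)
  rw [← valuation_under_lt_one_iff hv, map_sub] at h1
  exact valuation_sub_lt_one_trans h1 hxy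

omit hℓ in
-- Every place of `F` above `ℓ` extends to `F_r`, and these places detect zero in `𝓞/ℓ` because `ℓ`
-- is unramified in `F`.
theorem residueToRadQuot_injective [IsGalois ℚ F] (hℓ : ℓ.Prime) (hs : SplitsCompletely F ℓ) :
    Function.Injective (residueToRadQuot F L r ℓ) := by
  rw [injective_iff_map_eq_zero]
  intro t ht
  obtain ⟨c, rfl⟩ := Ideal.Quotient.mk_surjective t
  have h0 : ((0 : cyc F L r) : L) ∈ intLoc F L r ℓ := zero_mem _
  have h1 := (residueToRadQuot_mk_eq_mk_iff hℓ.ne_zero h0).mp (ht.trans (map_zero _).symm)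
  rw [Ideal.Quotient.eq_zero_iff_mem,
    mem_idealOf_ringOfIntegers_iff (hs.valuation_eq hℓ) hℓ.ne_zero]
  intro w hw
  obtain ⟨v, hv, rfl⟩ := exists_under_eq (E := cyc F L r) w hw
  have h2 := h1 v hv
  rw [sub_zero, valuation_under_lt_one_iff hv] at h2
  exact valuation_algebraMap_lt_one_iff.mp h2

end IntLoc

section CycUnits
variable {F : Type*} [Field F] {L : Type*} [Field L] [Algebra F L] {r : ℕ}

/-- The units of `F_r` as units of `L`. -/
def cycUnit (F L : Type*) [Field F] [Field L] [Algebra F L] (r : ℕ) : (cyc F L r)ˣ →* Lˣ :=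
  Units.map (algebraMap (cyc F L r) L : cyc F L r →* L)

theorem cycUnit_injective : Function.Injective (cycUnit F L r) :=
  Units.map_injective (algebraMap (cyc F L r) L).injective

theorem exists_cycUnit_eq {x : Lˣ} (hx : (x : L) ∈ cyc F L r) : ∃ w, cycUnit F L r w = x := by
  obtain ⟨w, hw⟩ := exists_units_cyc_eq hx
  exact ⟨w, Units.ext hw⟩

theorem cycUnit_mem (w : (cyc F L r)ˣ) : ((cycUnit F L r w : Lˣ) : L) ∈ cyc F L r :=
  Subtype.mem (w : cyc F L r)

theorem cycUnit_map (a : Fˣ) :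
    cycUnit F L r (Units.map (algebraMap F (cyc F L r) : F →* cyc F L r) a) = baseUnit F L a :=
  Units.ext rfl

/-- The units of `L` that come from principal units at the place `v` of `F_r`. -/
def congrOne (v : HeightOneSpectrum (𝓞 (cyc F L r))) [NumberField (cyc F L r)] : Subgroup Lˣ :=
  (principalUnits v).map (cycUnit F L r)

theorem map_restrictNormalHom_smul {E : Type*} [Field E] [Algebra F E] [Algebra E L]
    [IsScalarTower F E L] [Normal F E] (τ : Gal(L/F)) (w : Eˣ) :
    Units.map (algebraMap E L : E →* L) (AlgEquiv.restrictNormalHom E τ • w) =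
      τ • Units.map (algebraMap E L : E →* L) w :=
  Units.ext (AlgEquiv.restrictNormal_commutes τ E w)

variable [NumberField (cyc F L r)] {v : HeightOneSpectrum (𝓞 (cyc F L r))}

theorem cycUnit_mem_congrOne {w : (cyc F L r)ˣ} :
    cycUnit F L r w ∈ congrOne v ↔ w ∈ principalUnits v :=
  Subgroup.mem_map_iff_mem cycUnit_injective

variable [NumberField F] {ℓ : ℕ}

theorem baseUnit_mem_congrOne (hv : (ℓ : 𝓞 (cyc F L r)) ∈ v.asIdeal) {a : Fˣ} :
    baseUnit F L a ∈ congrOne v ↔ a ∈ principalUnits (v.under (𝓞 F)) := by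
  rw [← cycUnit_map (r := r), cycUnit_mem_congrOne, map_mem_principalUnits hv]

theorem residueToRadQuot_eq_mk_of_div_mem (hℓ : ℓ.Prime) {t : ResidueRing F ℓ} {w : (cyc F L r)ˣ}
    (hy : ((cycUnit F L r w : Lˣ) : L) ∈ intLoc F L r ℓ)
    (h : ∀ v : HeightOneSpectrum (𝓞 (cyc F L r)), (ℓ : 𝓞 (cyc F L r)) ∈ v.asIdeal →
      ∃ x : Fˣ, Red (v.under (𝓞 F)) t (x : F) ∧ baseUnit F L x / cycUnit F L r w ∈ congrOne v) :
    residueToRadQuot F L r ℓ t = Ideal.Quotient.mk _ ⟨cycUnit F L r w, hy⟩ := by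
  refine residueToRadQuot_eq_mk_of_red hℓ (y := (w : cyc F L r)) hy fun v hv => ?_
  obtain ⟨x, hx, hxw⟩ := h v hv
  refine ⟨x, hx, ?_⟩
  rw [← cycUnit_map (r := r), ← map_div, cycUnit_mem_congrOne, mem_principalUnits] at hxw
  have h1 : v.valuation (cyc F L r) (w : cyc F L r) ≤ 1 := mem_intLoc_iff.mp hy v hv
  have h2 : algebraMap F (cyc F L r) x - w = (w : cyc F L r) *
      (((Units.map (algebraMap F (cyc F L r) : F →* cyc F L r) x / w : (cyc F L r)ˣ) :
        cyc F L r) - 1) := by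
    rw [mul_sub, Units.val_div_eq_div_val, mul_div_cancel₀ _ w.ne_zero, mul_one]
    rfl
  rw [h2, map_mul]
  exact (mul_le_of_le_one_left' h1).trans_lt hxw

end CycUnits

end

/-! ### The action of `σ_ℓ` and `Frob_ℓ` at the places of `F_r` above `ℓ` -/

section
open IsDedekindDomain HeightOneSpectrum WithZero

namespace LocalData
variable {F : Type*} [Field F] [NumberField F] [IsGalois ℚ F] {M : ℕ} {L : Type*} [Field L]
  [Algebra F L] [IsCyclotomicExtension (levels F M) F L] (D : LocalData F L M)
  {r ℓ : ℕ} (hr : r ∈ levels F M) (hℓ : ℓ.Prime) (hd : ℓ ∣ r) [NumberField (cyc F L r)]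
  {v : HeightOneSpectrum (𝓞 (cyc F L r))} (hv : (ℓ : 𝓞 (cyc F L r)) ∈ v.asIdeal)
include hr hℓ hd hv

omit D in
theorem log_valuation_of_cycUnit_eq {w : (cyc F L r)ˣ} {a : Fˣ}
    (h : cycUnit F L r w = baseUnit F L a) :
    log (v.valuation (cyc F L r) (w : cyc F L r)) =
      ((ℓ - 1 : ℕ) : ℤ) * log ((v.under (𝓞 F)).valuation F (a : F)) := by
  obtain ⟨ζ, hζ⟩ := exists_primitiveRoot_cyc (F := F) (L := L) hr hd
  rw [← log_valuation_algebraMap (cyc_ramification hr hℓ hd hv hζ).1]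
  rw [← cycUnit_map (r := r)] at h
  rw [cycUnit_injective h]
  rfl

/-- The action of `σ_ℓ` at the places above `ℓ`. -/
theorem gen_smul_cycUnit_div_mul_mem {u : (ZMod ℓ)ˣ}
    (hu : ∀ η : L, η ^ ℓ = 1 → D.gen ℓ η = η ^ (u : ZMod ℓ).val) {gU : Fˣ}
    (hgU : (gU : F) = ((u : ZMod ℓ).val : ℕ)) (w : (cyc F L r)ˣ) :
    (D.gen ℓ • cycUnit F L r w) / cycUnit F L r w *
      baseUnit F L gU ^ log (v.valuation (cyc F L r) (w : cyc F L r)) ∈ congrOne v := by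
  have := (isGalois_cyc (L := L) hr).to_normal
  obtain ⟨ζ, hζ⟩ := exists_primitiveRoot_cyc (F := F) (L := L) hr hd
  obtain ⟨-, hπ, -, hin⟩ := cyc_ramification hr hℓ hd hv hζ
  have hgood := hr.2 ℓ hℓ hd
  have hs := div_mem_levels hr hd
  have hcoe : ∀ x : cyc F L r, ((AlgEquiv.restrictNormalHom (cyc F L r) (D.gen ℓ) x :
      cyc F L r) : L) = D.gen ℓ x := fun x => AlgEquiv.restrictNormal_commutes (D.gen ℓ) _ x
  refine ⟨_, tame_character hℓ hv hζ hπ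
    (hin (AlgEquiv.restrictNormalHom (cyc F L r) (D.gen ℓ)) fun η hη => Subtype.ext ?_)
    (ZMod.val_coe_unit_coprime u) (Subtype.ext ?_)
    (Units.map (algebraMap F (cyc F L r) : F →* cyc F L r) gU) ?_ w, ?_⟩
  · rw [hcoe]
    exact D.gen_apply hgood (coprime_div hr hℓ hd) (levels_ne_zero hs) (congrArg Subtype.val hη)
  · rw [hcoe]
    exact hu ζ (congrArg Subtype.val hζ.pow_eq_one)
  · rw [Units.coe_map, hgU]
    exact map_natCast (algebraMap F (cyc F L r)) _
  · rw [map_mul, map_div, map_zpow, cycUnit_map]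
    congr 2
    exact map_restrictNormalHom_smul (D.gen ℓ) w

/-- The place used to choose `Frob_ℓ` need not lie above `v`. On `F_{r/ℓ}` this is harmless:
`Frob_ℓ` and a Frobenius at `v` both raise the `(r/ℓ)`-th roots of unity to the power `ℓ`. -/
theorem frob_smul_cycUnit_div_pow_mem {w : (cyc F L r)ˣ}
    (hw : ((cycUnit F L r w : Lˣ) : L) ∈ cyc F L (r / ℓ))
    (hw1 : v.valuation (cyc F L r) (w : cyc F L r) = 1) :
    (D.frob ℓ • cycUnit F L r w) / cycUnit F L r w ^ ℓ ∈ congrOne v := by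
  have := isGalois_cyc (L := L) hr
  have := isGalois_of_levels (F := F) (L := L) M
  have hgood := hr.2 ℓ hℓ hd
  have hs := div_mem_levels hr hd
  obtain ⟨φ, hφ, hφη⟩ := exists_frobenius (F := F) hℓ hgood.2.2.2 hv
  refine ⟨_, smul_div_pow_mem_principalUnits hφ hw1, ?_⟩
  rw [map_div, map_pow]
  congr 1
  obtain ⟨τ, rfl⟩ := AlgEquiv.restrictNormalHom_surjective (F := F) (K₁ := cyc F L r) L φ
  refine (map_restrictNormalHom_smul τ w).trans (Units.ext ?_)
  refine apply_eq_of_mem_cyc (fun η hη => ?_) hw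
  have hsr := Nat.div_dvd_of_dvd hd
  rw [D.frob_apply hgood (coprime_div hr hℓ hd) (levels_ne_zero hs) hη]
  have h1 := hφη (r / ℓ) (coprime_div hr hℓ hd) (levels_ne_zero hs)
    ⟨η, cyc_mono hsr (mem_cyc_of_pow_eq_one hη)⟩ (Subtype.ext hη)
  have h2 := AlgEquiv.restrictNormal_commutes τ (cyc F L r)
    ⟨η, cyc_mono hsr (mem_cyc_of_pow_eq_one hη)⟩
  exact h2.symm.trans (congrArg Subtype.val h1)

end LocalData

end

/-! ### Norms from `F_ℓ` and the characterization of `exp_ℓ` -/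

section
open IsDedekindDomain HeightOneSpectrum WithZero

namespace LocalData
variable {F : Type*} [Field F] [NumberField F] [IsGalois ℚ F] {M : ℕ} {L : Type*} [Field L]
  [Algebra F L] [IsCyclotomicExtension (levels F M) F L] (D : LocalData F L M)

section Level
variable {r ℓ : ℕ} (hr : r ∈ levels F M) (hℓ : ℓ.Prime) (hd : ℓ ∣ r) [NumberField (cyc F L r)]
  {v : HeightOneSpectrum (𝓞 (cyc F L r))} (hv : (ℓ : 𝓞 (cyc F L r)) ∈ v.asIdeal)
include hr hℓ hd hv

/-- By the tame character formula `σ_ℓ x / x` is congruent to a power of an integer prime to `ℓ`,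
hence is a `v`-unit. -/
theorem valuation_eq_of_cycUnit_eq_gen_smul {w w' : (cyc F L r)ˣ}
    (h : cycUnit F L r w' = D.gen ℓ • cycUnit F L r w) :
    v.valuation (cyc F L r) (w' : cyc F L r) = v.valuation (cyc F L r) (w : cyc F L r) := by
  have := Fact.mk hℓ
  obtain ⟨u, -, hu⟩ := D.exists_primitive_exponent (hr.2 ℓ hℓ hd)
  have hg0 : (((u : ZMod ℓ).val : ℕ) : F) ≠ 0 := by
    exact_mod_cast (ZMod.val_ne_zero (u : ZMod ℓ)).mpr u.ne_zero
  have h1 := D.gen_smul_cycUnit_div_mul_mem hr hℓ hd hv hu (gU := Units.mk0 _ hg0) rfl w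
  rw [← h, ← cycUnit_map (r := r), ← map_zpow, ← map_div, ← map_mul, cycUnit_mem_congrOne] at h1
  have h2 := valuation_eq_one_of_mem_principalUnits h1
  have h3 : v.valuation (cyc F L r) (algebraMap F (cyc F L r) ((u : ZMod ℓ).val : ℕ)) = 1 := by
    rw [map_natCast]
    exact valuation_natCast_eq_one hv (ZMod.val_coe_unit_coprime u)
  rw [Units.val_mul, Units.val_zpow_eq_zpow_val, Units.val_div_eq_div_val, map_mul, map_zpow₀,
    Units.coe_map, Units.val_mk0] at h2
  rw [show v.valuation (cyc F L r) ((algebraMap F (cyc F L r) : F →* cyc F L r)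
    ((u : ZMod ℓ).val : ℕ)) = 1 from h3, one_zpow, mul_one, map_div₀] at h2
  exact eq_of_div_eq_one h2

end Level

section Norm
variable {ℓ : ℕ} (hℓ : IsGoodPrime F M ℓ)
include hℓ

theorem gen_smul_gpow_N (x : Lˣ) : D.gen ℓ • gpow x (D.N ℓ) = gpow x (D.N ℓ) := by
  have h1 : (D.sig ℓ - 1) * D.N ℓ = 0 := by
    rw [N, mul_geom_sum, sig, ← map_pow, D.gen_pow_sub_one hℓ, map_one, sub_self]
  rw [sub_mul, one_mul, sub_eq_zero] at h1
  rw [← gpow_of, ← gpow_mul]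
  exact congrArg (gpow x) h1

/-- `x ^ N_ℓ` is fixed by `σ_ℓ`, which generates `Gal(F_ℓ/F)`. -/
theorem exists_baseUnit_eq_gpow_N {x : Lˣ} (hx : (x : L) ∈ cyc F L ℓ) :
    ∃ y : Fˣ, baseUnit F L y = gpow x (D.N ℓ) := by
  have hr := hℓ.mem_levels
  have := isGalois_of_levels (F := F) (L := L) M
  have hmem := gpow_mem_cyc x (D.N ℓ) (isGalois_cyc hr).to_normal hx
  have hfix : ∀ τ : Gal(L/F), τ (gpow x (D.N ℓ) : L) = gpow x (D.N ℓ) := by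
    intro τ
    obtain ⟨τ', hτ', h⟩ := D.exists_mem_subgroup_eq_on_cyc hr
      (MulAction.stabilizer Gal(L/F) (gpow x (D.N ℓ))) (fun q hq hqd => by
        rw [(Nat.prime_dvd_prime_iff_eq hq hℓ.1).mp hqd]
        exact D.gen_smul_gpow_N hℓ x) τ
    rw [h _ hmem]
    exact congrArg Units.val hτ'
  obtain ⟨y, hy⟩ := IntermediateField.mem_bot.mp ((InfiniteGalois.mem_bot_iff_fixed _).mpr hfix)
  have hy0 : y ≠ 0 := by
    rintro rfl
    rw [map_zero] at hy
    exact (Units.ne_zero _) hy.symm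
  exact ⟨Units.mk0 y hy0, Units.ext hy⟩

/-- The norm is a product of `ℓ - 1` conjugates of equal valuation, and this factor cancels against
the ramification index `ℓ - 1`. -/
theorem log_valuation_gpow_N [NumberField (cyc F L ℓ)] {w : (cyc F L ℓ)ˣ} {y : Fˣ}
    (hy : baseUnit F L y = gpow (cycUnit F L ℓ w) (D.N ℓ))
    {v : HeightOneSpectrum (𝓞 (cyc F L ℓ))} (hv : (ℓ : 𝓞 (cyc F L ℓ)) ∈ v.asIdeal) :
    log ((v.under (𝓞 F)).valuation F (y : F)) =
      log (v.valuation (cyc F L ℓ) (w : cyc F L ℓ)) := by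
  have hr := hℓ.mem_levels
  have hN := (isGalois_cyc (L := L) hr).to_normal
  have h1 : ∀ i : ℕ, ∃ w' : (cyc F L ℓ)ˣ,
      cycUnit F L ℓ w' = gpow (cycUnit F L ℓ w) (D.sig ℓ ^ i) ∧
      v.valuation (cyc F L ℓ) (w' : cyc F L ℓ) = v.valuation (cyc F L ℓ) (w : cyc F L ℓ) := by
    intro i
    induction i with
    | zero => exact ⟨w, by rw [pow_zero, gpow_one], rfl⟩
    | succ i ih =>
      obtain ⟨w', h, hval⟩ := ih
      obtain ⟨w'', h''⟩ := exists_cycUnit_eq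
        (gpow_mem_cyc (cycUnit F L ℓ w) (D.sig ℓ ^ (i + 1)) hN (cycUnit_mem w))
      refine ⟨w'', h'', ?_⟩
      rw [← hval]
      refine D.valuation_eq_of_cycUnit_eq_gen_smul hr hℓ.1 dvd_rfl hv ?_
      rw [h'', h, pow_succ', gpow_mul, sig, gpow_of]
  choose w' hw' hval using h1
  have h2 : cycUnit F L ℓ (∏ i ∈ Finset.range (ℓ - 1), w' i) = baseUnit F L y := by
    rw [hy, N, gpow_sum, map_prod]
    exact Finset.prod_congr rfl fun i _ => hw' i
  have h3 := log_valuation_of_cycUnit_eq hr hℓ.1 dvd_rfl hv h2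
  rw [Units.coe_prod, map_prod, Finset.prod_congr rfl fun i _ => hval i, Finset.prod_const,
    Finset.card_range, log_pow, nsmul_eq_mul] at h3
  have := hℓ.1.two_le
  exact (mul_left_cancel₀ (by exact_mod_cast (by omega : ℓ - 1 ≠ 0)) h3).symm

end Norm

section Exp
variable {ℓ : ℕ} (hM : M ≠ 0) (hℓ : IsGoodPrime F M ℓ)
include hM hℓ

omit hM in
-- The tame character formula gives `x ^ (1 - σ_ℓ) ≡ g ^ (-ord_v x)`, and `ord_v x` is the order of
-- `x ^ N_ℓ` at the place below.
theorem isExp_of_red {u : (ZMod ℓ)ˣ}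
    (hu : ∀ η : L, η ^ ℓ = 1 → D.gen ℓ η = η ^ (u : ZMod ℓ).val) {gU : Fˣ}
    (hgU : (gU : F) = ((u : ZMod ℓ).val : ℕ))
    {e : ModPow (FracIdeals F ℓ) M →* ResidueTorsion F M ℓ} (he : Function.Bijective e)
    (hred : ∀ (y : Fˣ) (w : HeightOneSpectrum (𝓞 F)), (ℓ : 𝓞 F) ∈ w.asIdeal →
      Red w ((e (QuotientGroup.mk (toPrincipalIdeal (baseLoc F ℓ) F y)) : (ResidueRing F ℓ)ˣ) :
        ResidueRing F ℓ) ((gU ^ (log (w.valuation F (y : F)) * ((ℓ - 1) / M : ℕ)) : Fˣ) : F)) :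
    D.IsExp ℓ e := by
  refine ⟨he, fun x hx => ?_⟩
  have hr := hℓ.mem_levels
  have := numberField_cyc (L := L) hr
  have hN := (isGalois_cyc (L := L) hr).to_normal
  obtain ⟨y, hy⟩ := D.exists_baseUnit_eq_gpow_N hℓ hx
  obtain ⟨w, rfl⟩ := exists_cycUnit_eq hx
  obtain ⟨z, hz⟩ := exists_cycUnit_eq (x := gpow (cycUnit F L ℓ w) (1 - D.sig ℓ) ^ ((ℓ - 1) / M)) (by
    rw [Units.val_pow_eq_pow_val]
    exact pow_mem (gpow_mem_cyc _ _ hN hx) _)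
  have hcong : ∀ v : HeightOneSpectrum (𝓞 (cyc F L ℓ)), (ℓ : 𝓞 (cyc F L ℓ)) ∈ v.asIdeal →
      baseUnit F L (gU ^ (log ((v.under (𝓞 F)).valuation F (y : F)) * ((ℓ - 1) / M : ℕ))) /
        cycUnit F L ℓ z ∈ congrOne v := by
    intro v hv
    have h1 := pow_mem (D.gen_smul_cycUnit_div_mul_mem hr hℓ.1 dvd_rfl hv hu hgU w) ((ℓ - 1) / M)
    rw [hz, D.log_valuation_gpow_N hℓ hy hv, gpow_sub, gpow_one, sig, gpow_of]
    convert h1 using 1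
    rw [mul_pow, ← zpow_natCast (baseUnit F L gU ^ _), ← zpow_mul, div_eq_mul_inv, mul_comm,
      ← inv_pow, inv_div]
    congr 1
    exact map_zpow (Units.map (algebraMap F L : F →* L)) gU _
  have hzl : ((cycUnit F L ℓ z : Lˣ) : L) ∈ intLoc F L ℓ ℓ := by
    refine mem_intLoc_iff.mpr fun v hv => ?_
    have h1 := hcong v hv
    rw [← cycUnit_map (r := ℓ), ← map_div, cycUnit_mem_congrOne] at h1
    have h2 := valuation_eq_one_of_mem_principalUnits h1
    rw [Units.val_div_eq_div_val, map_div₀] at h2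
    rw [← eq_of_div_eq_one h2, map_zpow, Units.val_zpow_eq_zpow_val, map_zpow₀]
    have h3 : v.valuation (cyc F L ℓ) (algebraMap F (cyc F L ℓ) gU) = 1 := by
      rw [hgU, map_natCast]
      exact valuation_natCast_eq_one hv (ZMod.val_coe_unit_coprime u)
    rw [show v.valuation (cyc F L ℓ) ((Units.map (algebraMap F (cyc F L ℓ) : F →* cyc F L ℓ) gU :
      (cyc F L ℓ)ˣ) : cyc F L ℓ) = 1 from h3, one_zpow]
  refine ⟨y, ⟨_, hzl⟩, hy, congrArg Units.val hz, ?_⟩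
  exact residueToRadQuot_eq_mk_of_div_mem hℓ.1 hzl fun v hv =>
    ⟨_, hred y _ (natCast_mem_under hv), hcong v hv⟩

omit hM in
theorem isExp_unique {e e' : ModPow (FracIdeals F ℓ) M →* ResidueTorsion F M ℓ}
    (he : D.IsExp ℓ e) (he' : D.IsExp ℓ e') : e = e' := by
  have hr := hℓ.mem_levels
  have := numberField_cyc (L := L) hr
  refine MonoidHom.ext fun κ => ?_
  obtain ⟨I, rfl⟩ := QuotientGroup.mk_surjective κ
  obtain ⟨y, rfl⟩ := toPrincipalIdeal_surjective hℓ.1 I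
  -- Every ideal of `𝓞_(ℓ)` is generated by some `x ^ N_ℓ`: it suffices to give `x` at each `v` the
  -- order of `y` at the place below. So the formula determines the map on all classes.
  obtain ⟨w, hw⟩ := exists_log_valuation_eq (K := cyc F L ℓ) hℓ.1.ne_zero
    fun v => log ((v.under (𝓞 F)).valuation F (y : F))
  obtain ⟨y₁, z, hy₁, hz, h⟩ := he.2 (cycUnit F L ℓ w) (cycUnit_mem w)
  obtain ⟨y₂, z', hy₂, hz', h'⟩ := he'.2 (cycUnit F L ℓ w) (cycUnit_mem w)
  obtain rfl : y₁ = y₂ := Units.map_injective (f := (algebraMap F L : F →* L))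
    (algebraMap F L).injective (hy₁.trans hy₂.symm)
  obtain rfl : z = z' := Subtype.ext (hz.trans hz'.symm)
  have h1 : toPrincipalIdeal (baseLoc F ℓ) F y = toPrincipalIdeal (baseLoc F ℓ) F y₁ := by
    rw [← div_eq_one, ← map_div, toPrincipalIdeal_eq_one_iff]
    intro q hq
    obtain ⟨v, hv, rfl⟩ := exists_under_eq (E := cyc F L ℓ) q hq
    rw [valuation_eq_one_iff_log, Units.val_div_eq_div_val, map_div₀,
      log_div (valuation_units_ne_zero _) (valuation_units_ne_zero _),
      D.log_valuation_gpow_N hℓ hy₁ hv, hw v hv, sub_self]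
  rw [h1]
  exact Subtype.ext (Units.ext (residueToRadQuot_injective (L := L) (r := ℓ) hℓ.1 hℓ.2.2.2
    (h.trans h'.symm)))

theorem existsUnique_isExp : ∃! e, D.IsExp ℓ e := by
  have := Fact.mk hℓ.1
  obtain ⟨u, htop, hu⟩ := D.exists_primitive_exponent hℓ
  have hg0 : (((u : ZMod ℓ).val : ℕ) : F) ≠ 0 := by
    exact_mod_cast (ZMod.val_ne_zero (u : ZMod ℓ)).mpr u.ne_zero
  obtain ⟨e, he, hred⟩ := exists_exp hM hℓ htop (gU := Units.mk0 _ hg0) rfl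
  exact ⟨e, D.isExp_of_red hℓ hu rfl he hred,
    fun e' he' => D.isExp_unique hℓ he' (D.isExp_of_red hℓ hu rfl he hred)⟩

theorem red_exp {u : (ZMod ℓ)ˣ} (htop : Subgroup.zpowers u = ⊤)
    (hu : ∀ η : L, η ^ ℓ = 1 → D.gen ℓ η = η ^ (u : ZMod ℓ).val) {gU : Fˣ}
    (hgU : (gU : F) = ((u : ZMod ℓ).val : ℕ)) (y : Fˣ) {w : HeightOneSpectrum (𝓞 F)}
    (hw : (ℓ : 𝓞 F) ∈ w.asIdeal) :
    Red w ((D.exp ℓ (QuotientGroup.mk (toPrincipalIdeal (baseLoc F ℓ) F y)) :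
        (ResidueRing F ℓ)ˣ) : ResidueRing F ℓ)
      ((gU ^ (log (w.valuation F (y : F)) * ((ℓ - 1) / M : ℕ)) : Fˣ) : F) := by
  obtain ⟨e, he, hred⟩ := exists_exp hM hℓ htop hgU
  have h : D.IsExp ℓ (D.exp ℓ) := Classical.epsilon_spec (D.existsUnique_isExp hM hℓ).exists
  rw [D.isExp_unique hℓ h (D.isExp_of_red hℓ hu hgU he hred)]
  exact hred y w hw

end Exp
end LocalData

end

/-! ### Integrality of the class at level `r/ℓ` and the three congruences -/

section
open IsDedekindDomain HeightOneSpectrum WithZero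

section BaseUnit
variable {F : Type*} [Field F] {L : Type*} [Field L] [Algebra F L]

theorem baseUnit_mul (a b : Fˣ) : baseUnit F L (a * b) = baseUnit F L a * baseUnit F L b :=
  map_mul (Units.map _) a b

theorem baseUnit_pow (a : Fˣ) (n : ℕ) : baseUnit F L (a ^ n) = baseUnit F L a ^ n :=
  map_pow (Units.map _) a n

theorem baseUnit_zpow (a : Fˣ) (n : ℤ) : baseUnit F L (a ^ n) = baseUnit F L a ^ n :=
  map_zpow (Units.map _) a n

theorem smul_baseUnit (τ : Gal(L/F)) (a : Fˣ) : τ • baseUnit F L a = baseUnit F L a :=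
  Units.ext (τ.commutes a)

theorem baseUnit_mem_cyc (r : ℕ) (a : Fˣ) : ((baseUnit F L a : Lˣ) : L) ∈ cyc F L r :=
  (cyc F L r).algebraMap_mem a

end BaseUnit

section UnitClass
variable {F : Type*} [Field F] [NumberField F] {ℓ M : ℕ}

/-- An `M`-th root in `F` of a unit of `𝓞_(ℓ)` is again such a unit. -/
theorem unitClassToField_injective (hM : M ≠ 0) :
    Function.Injective (unitClassToField F M ℓ) := by
  rw [injective_iff_map_eq_one]
  intro k hk
  obtain ⟨x, rfl⟩ := QuotientGroup.mk_surjective k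
  have h1 : (QuotientGroup.mk (Units.map ((baseLoc F ℓ).subtype : baseLoc F ℓ →* F) x) :
    ModPow Fˣ M) = 1 := hk
  rw [QuotientGroup.eq_one_iff] at h1
  obtain ⟨y, hy⟩ := h1
  obtain ⟨y', rfl⟩ := exists_baseLoc_unit (ℓ := ℓ) y fun w hw => by
    have h2 := valuation_unit_baseLoc x hw
    have h3 : ((y ^ M : Fˣ) : F) = (x : baseLoc F ℓ) := congrArg Units.val hy
    rw [← h3, Units.val_pow_eq_pow_val, map_pow] at h2
    exact (pow_eq_one_iff.mp h2).resolve_right hM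
  rw [QuotientGroup.eq_one_iff]
  refine ⟨y', Units.map_injective (f := ((baseLoc F ℓ).subtype : baseLoc F ℓ →* F))
    Subtype.val_injective ?_⟩
  rw [← hy, powMonoidHom_apply, map_pow]
  rfl

end UnitClass

section RadicalUnits
variable {F : Type*} [Field F] {L : Type*} [Field L] [Algebra F L] {r ℓ : ℕ}

/-- The units of `𝓞_r` that are congruent to `1` modulo the radical of `ℓ 𝓞_r`. -/
def radicalUnits (F L : Type*) [Field F] [Field L] [Algebra F L] (r ℓ : ℕ) :
    Subgroup (intRing F L r)ˣ :=
  (Units.map (Ideal.Quotient.mk (idealOf (intRing F L r) ℓ).radical :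
    intRing F L r →* intRing F L r ⧸ (idealOf (intRing F L r) ℓ).radical)).ker

theorem mem_radicalUnits {u : (intRing F L r)ˣ} :
    u ∈ radicalUnits F L r ℓ ↔ (u : intRing F L r) - 1 ∈ (idealOf (intRing F L r) ℓ).radical := by
  rw [radicalUnits, MonoidHom.mem_ker, ← Units.val_inj, ← Ideal.Quotient.eq]
  rfl

theorem map_mem_radical {A B : Type*} [CommRing A] [CommRing B] (f : A →+* B) {x : A}
    (h : x ∈ (idealOf A ℓ).radical) : f x ∈ (idealOf B ℓ).radical := by
  obtain ⟨n, hn⟩ := h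
  obtain ⟨y, hy⟩ := Ideal.mem_span_singleton'.mp hn
  exact ⟨n, Ideal.mem_span_singleton'.mpr ⟨f y, by rw [← map_pow, ← hy, map_mul, map_natCast]⟩⟩

theorem map_intRingMap_mem_radicalUnits (hN : Normal F (cyc F L r)) (g : Gal(L/F))
    (u : (intRing F L r)ˣ) (hu : u ∈ radicalUnits F L r ℓ) :
    Units.map (intRingMap hN g : intRing F L r →* intRing F L r) u ∈ radicalUnits F L r ℓ := by
  rw [mem_radicalUnits] at hu ⊢
  have := map_mem_radical (intRingMap hN g) hu
  rwa [map_sub, map_one] at this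

theorem intToRadQuot_eq_of_div_mem {u w : (intRing F L r)ˣ} (h : u / w ∈ radicalUnits F L r ℓ) :
    intToRadQuot F L r ℓ u = intToRadQuot F L r ℓ w := by
  rw [mem_radicalUnits] at h
  have h1 := Ideal.mul_mem_right (w : intRing F L r) _ h
  rw [sub_mul, one_mul, ← Units.val_mul, div_mul_cancel] at h1
  have h2 := map_mem_radical (Subring.inclusion (le_locAt (intRing F L r) ℓ)) h1
  rw [map_sub] at h2
  exact Ideal.Quotient.eq.mpr h2

end RadicalUnits

section Reduce
variable {F : Type*} [Field F] [NumberField F] {L : Type*} [Field L] [Algebra F L] {r ℓ : ℕ}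
  [NumberField (cyc F L r)]

theorem residueToRadQuot_eq_intToRadQuot (hℓ : ℓ.Prime) {t : ResidueRing F ℓ}
    {ρ : (intRing F L r)ˣ}
    (h : ∀ v : HeightOneSpectrum (𝓞 (cyc F L r)), (ℓ : 𝓞 (cyc F L r)) ∈ v.asIdeal →
      ∃ x : Fˣ, Red (v.under (𝓞 F)) t (x : F) ∧ baseUnit F L x / intUnit F L r ρ ∈ congrOne v) :
    residueToRadQuot F L r ℓ t = intToRadQuot F L r ℓ ρ := by
  obtain ⟨w, hw⟩ := exists_cycUnit_eq (intUnit_mem_cyc ρ)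
  have hmem : ((cycUnit F L r w : Lˣ) : L) ∈ intLoc F L r ℓ := by
    rw [hw]
    exact le_locAt _ ℓ (Subtype.mem (ρ : intRing F L r))
  rw [residueToRadQuot_eq_mk_of_div_mem hℓ hmem (by rwa [hw])]
  exact congrArg (Ideal.Quotient.mk _) (Subtype.ext (congrArg Units.val hw))

omit [NumberField F] in
theorem valuation_eq_one_of_cycUnit_eq_intUnit {w : (cyc F L r)ˣ} {u : (intRing F L r)ˣ}
    (h : cycUnit F L r w = intUnit F L r u) (v : HeightOneSpectrum (𝓞 (cyc F L r))) :
    v.valuation (cyc F L r) (w : cyc F L r) = 1 := by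
  have key : ∀ (w : (cyc F L r)ˣ) (u : (intRing F L r)ˣ), cycUnit F L r w = intUnit F L r u →
      v.valuation (cyc F L r) (w : cyc F L r) ≤ 1 := by
    intro w u h
    obtain ⟨a, ha⟩ := mem_intRing_iff.mp (Subtype.mem (u : intRing F L r))
    have : (w : cyc F L r) = a := Subtype.ext ((congrArg Units.val h).trans ha.symm)
    rw [this]
    exact HeightOneSpectrum.valuation_le_one v a
  refine le_antisymm (key w u h) ?_
  have h2 := key w⁻¹ u⁻¹ (by rw [map_inv, h, intUnit_inv])
  rw [Units.val_inv_eq_inv_val, map_inv₀] at h2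
  exact (inv_le_one₀ (zero_lt_iff.mpr (valuation_units_ne_zero w))).mp h2

end Reduce

namespace LocalData
variable {F : Type*} [Field F] [NumberField F] [IsGalois ℚ F] {M : ℕ}
  {L : Type*} [Field L] [Algebra F L] [IsCyclotomicExtension (levels F M) F L]
  {r ℓ : ℕ} (hr : r ∈ levels F M) (hℓ : ℓ.Prime) (hd : ℓ ∣ r)
include hr hℓ hd

/-- The unit has order zero, and the order of `a` at `v` is `ℓ - 1` times its order below. -/
theorem mul_log_valuation_of_intUnit_eq [NumberField (cyc F L r)]
    {v : HeightOneSpectrum (𝓞 (cyc F L r))} (hv : (ℓ : 𝓞 (cyc F L r)) ∈ v.asIdeal)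
    {u : (intRing F L r)ˣ} {a : Fˣ} {w : (cyc F L r)ˣ}
    (h : intUnit F L r u = baseUnit F L a * cycUnit F L r w ^ M) :
    (M : ℤ) * log (v.valuation (cyc F L r) (w : cyc F L r)) =
      -(((ℓ - 1 : ℕ) : ℤ) * log ((v.under (𝓞 F)).valuation F (a : F))) := by
  obtain ⟨x, hx⟩ := exists_cycUnit_eq (intUnit_mem_cyc u)
  have h1 : cycUnit F L r (x / w ^ M) = baseUnit F L a := by
    rw [map_div, map_pow, hx, h, mul_div_cancel_right]
  rw [← log_valuation_of_cycUnit_eq hr hℓ hd hv h1, Units.val_div_eq_div_val, map_div₀,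
    log_div (valuation_units_ne_zero _) (valuation_units_ne_zero _),
    valuation_eq_one_of_cycUnit_eq_intUnit hx, log_one, Units.val_pow_eq_pow_val, map_pow, log_pow,
    nsmul_eq_mul]
  ring

variable (D : LocalData F L M) (ξ : ∀ r : ℕ, (intRing F L r)ˣ)

omit hℓ [IsGalois ℚ F] in
theorem exists_intUnit_eq_derived_div : ∃ u, intUnit F L r u = D.derived ξ (r / ℓ) := by
  obtain ⟨u, hu⟩ := exists_intUnit_eq_gpow (isGalois_cyc (div_mem_levels hr hd)).to_normal
    (ξ (r / ℓ)) (D.Nr' (r / ℓ))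
  obtain ⟨w, hw⟩ := exists_intUnit_eq_of_dvd (Nat.div_dvd_of_dvd hd) u
  exact ⟨w, hw.trans hu⟩

variable [NumberField.IsTotallyReal F] (hM : Odd M) {ξ} (hξ : D.IsEulerSystem ξ)
include hM hξ

/-- In `D_{r/ℓ} = a * b ^ M` the orders of `a` above `ℓ` turn out to be divisible by `M`, so `a`
becomes a unit at `ℓ` after an `M`-th power of `F` is moved into `b ^ M`. -/
theorem exists_derived_eq_unit : ∃ (u : (baseLoc F ℓ)ˣ) (b : Lˣ), (b : L) ∈ cyc F L (r / ℓ) ∧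
    D.derived ξ (r / ℓ) =
      baseUnit F L (Units.map ((baseLoc F ℓ).subtype : baseLoc F ℓ →* F) u) * b ^ M := by
  have := Fact.mk hℓ
  have := numberField_cyc (L := L) hr
  have hs := div_mem_levels hr hd
  have hgood := hr.2 ℓ hℓ hd
  obtain ⟨a, b, hb, hab⟩ := D.exists_derived_eq ξ hM hs hξ
  obtain ⟨w, rfl⟩ := exists_cycUnit_eq (cyc_mono (Nat.div_dvd_of_dvd hd) hb)
  obtain ⟨x, hx⟩ := D.exists_intUnit_eq_derived_div hr hd ξ
  obtain ⟨u, htop, hu⟩ := D.exists_primitive_exponent hgood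
  have hg0 : (((u : ZMod ℓ).val : ℕ) : F) ≠ 0 := by
    exact_mod_cast (ZMod.val_ne_zero (u : ZMod ℓ)).mpr u.ne_zero
  have hdvd : ∀ q : HeightOneSpectrum (𝓞 F), (ℓ : 𝓞 F) ∈ q.asIdeal →
      (M : ℤ) ∣ log (q.valuation F (a : F)) := by
    intro q hq
    obtain ⟨v, hv, rfl⟩ := exists_under_eq (E := cyc F L r) q hq
    have h1 := D.gen_smul_cycUnit_div_mul_mem hr hℓ hd hv hu (gU := Units.mk0 _ hg0) rfl w
    -- `b` lies in `F_{r/ℓ}` and is fixed by `σ_ℓ`, so the tame character gives `g ^ ord_v b ≡ 1`,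
    -- that is, `ℓ - 1 ∣ ord_v b`. With `M * ord_v b = -(ℓ - 1) * ord_w a` this yields `M ∣ ord_w
    -- a`.
    have h2 : D.gen ℓ • cycUnit F L r w = cycUnit F L r w :=
      Units.ext (D.gen_apply_of_mem_cyc hgood hs (coprime_div hr hℓ hd) hb)
    rw [h2, div_self', one_mul, ← baseUnit_zpow, baseUnit_mem_congrOne hv,
      zpow_mem_principalUnits_iff hℓ (natCast_mem_under hv) htop rfl] at h1
    obtain ⟨m, hm⟩ := h1
    have h3 := mul_log_valuation_of_intUnit_eq hr hℓ hd hv (hx.trans hab)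
    have h4 : ((ℓ - 1 : ℕ) : ℤ) ≠ 0 := by
      have := hℓ.two_le
      exact_mod_cast (by omega : ℓ - 1 ≠ 0)
    refine ⟨-m, mul_left_cancel₀ h4 ?_⟩
    rw [hm] at h3
    linear_combination h3
  obtain ⟨c, hc⟩ := exists_log_valuation_eq (K := F) hℓ.ne_zero
    fun q => log (q.valuation F (a : F)) / M
  obtain ⟨y, hy⟩ := exists_baseLoc_unit (ℓ := ℓ) (a / c ^ M) fun q hq => by
    rw [valuation_eq_one_iff_log, Units.val_div_eq_div_val, map_div₀,
      log_div (valuation_units_ne_zero _) (valuation_units_ne_zero _),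
      Units.val_pow_eq_pow_val, map_pow, log_pow, hc q hq, nsmul_eq_mul,
      Int.mul_ediv_cancel' (hdvd q hq), sub_self]
  refine ⟨y, baseUnit F L c * cycUnit F L r w, ?_, ?_⟩
  · rw [Units.val_mul]
    exact mul_mem (baseUnit_mem_cyc _ c) hb
  · rw [hab, hy, mul_pow, ← mul_assoc, ← baseUnit_pow, ← baseUnit_mul, div_mul_cancel]

theorem existsUnique_unitClass :
    ∃! k, unitClassToField F M ℓ k = D.kolyvaginClass ξ (r / ℓ) := by
  have hM0 : M ≠ 0 := by rintro rfl; exact absurd hM (by decide)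
  obtain ⟨u, b, hb, h⟩ := D.exists_derived_eq_unit hr hℓ hd hM hξ
  have h1 : unitClassToField F M ℓ (QuotientGroup.mk u) = D.kolyvaginClass ξ (r / ℓ) :=
    (D.kolyvaginClass_eq ξ hM (div_mem_levels hr hd) hξ hb h).symm
  exact ⟨_, h1, fun k hk => unitClassToField_injective hM0 (hk.trans h1.symm)⟩

theorem exp_kolyvaginClass {ρ₁ : (intRing F L r)ˣ} (hρ : intUnit F L r ρ₁ ^ M =
      gpow (intUnit F L r (ξ r)) (D.Nr' r * (D.sig ℓ - 1))) :
    residueToRadQuot F L r ℓ ((D.exp ℓ (idealClass F M ℓ (D.kolyvaginClass ξ r)) :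
      (ResidueRing F ℓ)ˣ) : ResidueRing F ℓ) = intToRadQuot F L r ℓ ρ₁ := by
  have hM0 : M ≠ 0 := by rintro rfl; exact absurd hM (by decide)
  have := Fact.mk hℓ
  have := numberField_cyc (L := L) hr
  have hN := (isGalois_cyc (L := L) hr).to_normal
  have hgood := hr.2 ℓ hℓ hd
  obtain ⟨a, b, hb, hab⟩ := D.exists_derived_eq ξ hM hr hξ
  obtain ⟨w, rfl⟩ := exists_cycUnit_eq hb
  obtain ⟨x, hx⟩ := exists_intUnit_eq_gpow hN (ξ r) (D.Nr' r)
  obtain ⟨u, htop, hu⟩ := D.exists_primitive_exponent hgood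
  have hg0 : (((u : ZMod ℓ).val : ℕ) : F) ≠ 0 := by
    exact_mod_cast (ZMod.val_ne_zero (u : ZMod ℓ)).mpr u.ne_zero
  -- In `D_r = a * b ^ M` the factor `a` is invariant, so `b ^ (σ_ℓ - 1)` is the `M`-th root of `D_r
  -- ^ (σ_ℓ - 1)`.
  have hroot : intUnit F L r ρ₁ = (D.gen ℓ • cycUnit F L r w) / cycUnit F L r w := by
    refine D.units_eq_of_pow_eq hM hr (intUnit_mem_cyc _) ?_ ?_
    · rw [Units.val_div_eq_div_val]
      exact div_mem (gal_apply_mem_cyc hN _ hb) hb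
    · rw [hρ, D.gpow_Nr'_mul_sub_one ξ, hab, smul_mul', smul_baseUnit, smul_units_pow, div_pow,
        mul_div_mul_left_eq_div]
  rw [D.kolyvaginClass_eq ξ hM hr hξ hb hab]
  refine residueToRadQuot_eq_intToRadQuot hℓ fun v hv =>
    ⟨_, D.red_exp hM0 hgood htop hu (gU := Units.mk0 _ hg0) rfl a (natCast_mem_under hv), ?_⟩
  have h1 := D.gen_smul_cycUnit_div_mul_mem hr hℓ hd hv hu (gU := Units.mk0 _ hg0) rfl w
  have h2 := mul_log_valuation_of_intUnit_eq hr hℓ hd hv (hx.trans hab)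
  -- Dividing the relation between the orders of `a` and `b` by `M` produces exactly the exponent
  -- `(ℓ - 1) / M` that occurs in `exp_ℓ`.
  have h3 : log (v.valuation (cyc F L r) (w : cyc F L r)) =
      -(log ((v.under (𝓞 F)).valuation F (a : F)) * ((ℓ - 1) / M : ℕ)) := by
    refine mul_left_cancel₀ (by exact_mod_cast hM0 : (M : ℤ) ≠ 0) ?_
    rw [h2]
    obtain ⟨k, hk⟩ := hgood.dvd_sub_one
    rw [hk, Nat.mul_div_cancel_left _ (Nat.pos_of_ne_zero hM0)]
    push_cast
    ring
  rw [h3, ← hroot, zpow_neg] at h1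
  rw [baseUnit_zpow, ← inv_mem_iff, inv_div, div_eq_mul_inv]
  exact h1

theorem intToRadQuot_root_eq {ρ₁ ρ₂ : (intRing F L r)ˣ} (hρ₁ : intUnit F L r ρ₁ ^ M =
      gpow (intUnit F L r (ξ r)) (D.Nr' r * (D.sig ℓ - 1)))
    (hρ₂ : intUnit F L r ρ₂ ^ M = gpow (intUnit F L (r / ℓ) (ξ (r / ℓ)))
      (D.Nr' (r / ℓ) * ((ℓ : MonoidAlgebra ℤ Gal(L/F)) - D.Fr ℓ))) :
    intToRadQuot F L r ℓ ρ₁ = intToRadQuot F L r ℓ ρ₂ := by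
  have hN := (isGalois_cyc (L := L) hr).to_normal
  obtain ⟨k, hk⟩ := (hr.2 ℓ hℓ hd).dvd_sub_one
  obtain ⟨x, hx⟩ := exists_intUnit_eq_of_dvd (Nat.div_dvd_of_dvd hd) (ξ (r / ℓ))
  obtain ⟨y, hy, hcong⟩ := hξ.congr_rel r hr ℓ hℓ hd
  obtain rfl : y = x := Subtype.ext (hy.trans (congrArg Units.val hx).symm)
  have hmem : ξ r / x ∈ radicalUnits F L r ℓ := by
    rw [mem_radicalUnits]
    have h1 := Ideal.mul_mem_right ((x⁻¹ : (intRing F L r)ˣ) : intRing F L r) _ hcong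
    rwa [sub_mul, Units.mul_inv, ← Units.val_mul, ← div_eq_mul_inv] at h1
  obtain ⟨z, hz, hzg⟩ := exists_mem_intUnit_eq_gpow hN (radicalUnits F L r ℓ)
    (fun g u hu => map_intRingMap_mem_radicalUnits hN g u hu) hmem (D.Nr' (r / ℓ))
  refine intToRadQuot_eq_of_div_mem ?_
  -- The Frobenius terms in the two `M`-th powers cancel, leaving `(ξ_r / ξ_{r/ℓ}) ^ (N'_{r/ℓ} (ℓ -
  -- 1))` with `ℓ - 1 = M * k`.
  have h2 : ρ₁ / ρ₂ = z ^ k := by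
    apply intUnit_injective
    refine D.units_eq_of_pow_eq hM hr (intUnit_mem_cyc _) (intUnit_mem_cyc _) ?_
    have hdiv : ∀ a b : (intRing F L r)ˣ,
        intUnit F L r (a / b) = intUnit F L r a / intUnit F L r b :=
      fun a b => map_div (Units.map _) a b
    have hpow : intUnit F L r (z ^ k) = intUnit F L r z ^ k := map_pow (Units.map _) z k
    rw [hdiv, div_pow, hρ₁, hρ₂, D.gpow_Nr'_mul_sub_one ξ, D.gpow_Nr'_mul_sub_frob ξ hℓ.ne_zero,
      D.gen_smul_derived_div hr hℓ hd hξ, div_div_div_cancel_right, hpow, ← pow_mul, mul_comm k,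
      ← hk, hzg, hdiv, gpow_div_units, hx, div_pow]
    rfl
  rw [h2]
  exact pow_mem hz k

theorem intToRadQuot_root_eq_nu {ρ₂ : (intRing F L r)ˣ}
    (hρ₂ : intUnit F L r ρ₂ ^ M = gpow (intUnit F L (r / ℓ) (ξ (r / ℓ)))
      (D.Nr' (r / ℓ) * ((ℓ : MonoidAlgebra ℤ Gal(L/F)) - D.Fr ℓ)))
    {k : ModPow (baseLoc F ℓ)ˣ M} (hk : unitClassToField F M ℓ k = D.kolyvaginClass ξ (r / ℓ)) :
    intToRadQuot F L r ℓ ρ₂ = residueToRadQuot F L r ℓ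
      ((nu F M ℓ k : (ResidueRing F ℓ)ˣ) : ResidueRing F ℓ) := by
  have hM0 : M ≠ 0 := by rintro rfl; exact absurd hM (by decide)
  have := numberField_cyc (L := L) hr
  have hN := (isGalois_cyc (L := L) hr).to_normal
  have hgood := hr.2 ℓ hℓ hd
  obtain ⟨u, b, hb, hub⟩ := D.exists_derived_eq_unit hr hℓ hd hM hξ
  obtain rfl : QuotientGroup.mk u = k := unitClassToField_injective hM0
    ((D.kolyvaginClass_eq ξ hM (div_mem_levels hr hd) hξ hb hub).symm.trans hk.symm)
  obtain ⟨w, rfl⟩ := exists_cycUnit_eq (cyc_mono (Nat.div_dvd_of_dvd hd) hb)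
  obtain ⟨x, hx⟩ := D.exists_intUnit_eq_derived_div hr hd ξ
  set c : Fˣ := Units.map ((baseLoc F ℓ).subtype : baseLoc F ℓ →* F) u
  -- In `D_{r/ℓ} = c * b ^ M` the operator `ℓ - Frob_ℓ` acts on `c ∈ F` as the power `ℓ - 1`, and on
  -- `b` its value is `≡ 1` because `Frob_ℓ b ≡ b ^ ℓ`.
  have hroot : intUnit F L r ρ₂ = baseUnit F L (c ^ ((ℓ - 1) / M)) *
      (cycUnit F L r w ^ ℓ / (D.frob ℓ • cycUnit F L r w)) := by
    refine D.units_eq_of_pow_eq hM hr (intUnit_mem_cyc _) ?_ ?_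
    · rw [Units.val_mul, Units.val_div_eq_div_val, Units.val_pow_eq_pow_val]
      exact mul_mem (baseUnit_mem_cyc _ _)
        (div_mem (pow_mem (cycUnit_mem w) _) (gal_apply_mem_cyc hN _ (cycUnit_mem w)))
    · rw [hρ₂, D.gpow_Nr'_mul_sub_frob ξ hℓ.ne_zero, hub, smul_mul', smul_baseUnit,
        smul_units_pow, mul_div_mul_left_eq_div, mul_pow, mul_pow (baseUnit F L _), ← baseUnit_pow,
        ← baseUnit_pow, ← pow_mul c, Nat.div_mul_cancel hgood.dvd_sub_one, mul_div_assoc]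
      congr 1
      rw [div_div_eq_mul_div, ← pow_succ, Nat.sub_add_cancel hℓ.one_lt.le, div_pow, ← pow_mul,
        ← pow_mul, mul_comm M]
  symm
  refine residueToRadQuot_eq_intToRadQuot hℓ fun v hv =>
    ⟨c ^ ((ℓ - 1) / M), ?_, ?_⟩
  · rw [Units.val_pow_eq_pow_val]
    exact red_nu hM0 hgood u (natCast_mem_under hv)
  · rw [hroot, div_mul_cancel_left, inv_div]
    refine D.frob_smul_cycUnit_div_pow_mem hr hℓ hd hv hb ?_
    -- The Frobenius congruence requires `b` to be a `v`-unit, which holds because `D_{r/ℓ}` and `c`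
    -- are.
    rw [valuation_eq_one_iff_log]
    have h2 := mul_log_valuation_of_intUnit_eq hr hℓ hd hv (hx.trans hub)
    rw [show (v.under (𝓞 F)).valuation F (c : F) = 1 from
      valuation_unit_baseLoc u (natCast_mem_under hv), log_one, mul_zero, neg_zero] at h2
    exact (mul_eq_zero.mp h2).resolve_left (by exact_mod_cast hM0)

end LocalData

end

end

end CyclotomicEuler

/-! ### The proposition -/

open CyclotomicEuler in
theorem proposition2p1
    {F : Type*} [Field F] [NumberField F] [IsAbelianGalois ℚ F] [NumberField.IsTotallyReal F]
    (M : ℕ) (hM : Odd M)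
    {L : Type*} [Field L] [Algebra F L] [IsCyclotomicExtension (levels F M) F L]
    (D : LocalData F L M)
    (ξ : ∀ r : ℕ, (intRing F L r)ˣ) (hξ : D.IsEulerSystem ξ) :
    -- the classes `κ_r` and the maps `ν_ℓ` and `exp_ℓ` are well defined
    (∀ r ∈ levels F M, ∃! κ : ModPow Fˣ M, D.IsKolyvaginClass ξ r κ) ∧
    (∀ ℓ : ℕ, IsGoodPrime F M ℓ → (∃! n, IsNu F M ℓ n) ∧ (∃! e, D.IsExp ℓ e)) ∧
    ∀ r ∈ levels F M, ∀ ℓ : ℕ, ℓ.Prime → ℓ ∣ r →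
      -- `κ_{r/ℓ}` lies in `𝓞_(ℓ)ˣ / 𝓞_(ℓ)ˣ^M`
      (∃! k, unitClassToField F M ℓ k = D.kolyvaginClass ξ (r / ℓ)) ∧
      -- the `M`-th roots exist in `𝓞_rˣ` and are unique
      (∃! ρ₁ : (intRing F L r)ˣ, intUnit F L r ρ₁ ^ M =
        gpow (intUnit F L r (ξ r)) (D.Nr' r * (D.sig ℓ - 1))) ∧
      (∃! ρ₂ : (intRing F L r)ˣ, intUnit F L r ρ₂ ^ M =
        gpow (intUnit F L (r / ℓ) (ξ (r / ℓ)))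
            (D.Nr' (r / ℓ) * ((ℓ : MonoidAlgebra ℤ Gal(L/F)) - D.Fr ℓ))) ∧
      -- the congruences
      ∀ (k : ModPow (baseLoc F ℓ)ˣ M) (ρ₁ ρ₂ : (intRing F L r)ˣ),
        unitClassToField F M ℓ k = D.kolyvaginClass ξ (r / ℓ) →
        intUnit F L r ρ₁ ^ M = gpow (intUnit F L r (ξ r)) (D.Nr' r * (D.sig ℓ - 1)) →
        intUnit F L r ρ₂ ^ M =
          gpow (intUnit F L (r / ℓ) (ξ (r / ℓ)))
            (D.Nr' (r / ℓ) * ((ℓ : MonoidAlgebra ℤ Gal(L/F)) - D.Fr ℓ)) →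
        residueToRadQuot F L r ℓ
            ((D.exp ℓ (idealClass F M ℓ (D.kolyvaginClass ξ r)) : (ResidueRing F ℓ)ˣ) :
              ResidueRing F ℓ) = intToRadQuot F L r ℓ ρ₁ ∧
        intToRadQuot F L r ℓ ρ₁ = intToRadQuot F L r ℓ ρ₂ ∧
        intToRadQuot F L r ℓ ρ₂ =
          residueToRadQuot F L r ℓ
            ((nu F M ℓ k : (ResidueRing F ℓ)ˣ) : ResidueRing F ℓ) := by
  have hM0 : M ≠ 0 := by rintro rfl; exact absurd hM (by decide)
  refine ⟨fun r hr => D.existsUnique_isKolyvaginClass ξ hM hr hξ,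
    fun ℓ hℓ => ⟨existsUnique_isNu hM0 hℓ, D.existsUnique_isExp hM0 hℓ⟩,
    fun r hr ℓ hℓ hd => ⟨D.existsUnique_unitClass hr hℓ hd hM hξ,
      D.existsUnique_root_gen ξ hM hr hξ, D.existsUnique_root_frob ξ hM hr hℓ hd hξ,
      fun k ρ₁ ρ₂ hk h₁ h₂ => ⟨D.exp_kolyvaginClass hr hℓ hd hM hξ h₁,
        D.intToRadQuot_root_eq hr hℓ hd hM hξ h₁ h₂,
        D.intToRadQuot_root_eq_nu hr hℓ hd hM hξ h₂ hk⟩⟩⟩
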